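/- Let $n\ge 1$. A partition of degree $n$ is an equivalence relation on $\{1,\dots,n\}\cup\{1',\dots,n'\}$; its classes are called blocks, and its rank is the number of blocks meeting both $\{1,\dots,n\}$ and $\{1',\dots,n'\}$. The product $\alpha\beta$ is obtained by placing $\alpha$ on $\{1,\dots,n\}\cup\{1'',\dots,n''\}$ and $\beta$ on $\{1'',\dots,n''\}\cup\{1',\dots,n'\}$, taking the smallest equivalence relation on the union of the three rows that contains both, and restricting it to $\{1,\dots,n\}\cup\{1',\dots,n'\}$. This gives the partition monoid $\mathcal P_n$, with identity $\mathrm{id}_n$ whose blocks are $\{i,i'\}$. A partition is planar if, for the order $n'<\dots<1'<1<\dots<n$, there are no two distinct blocks $A,X$ and points $a,b\in A$, $x,y\in X$ with $a<x<b<y$. The planar partition monoid $\mathcal{PP}_n$ consists of the planar elements of $\mathcal P_n$, and the Jones (Temperley–Lieb) monoid $\mathcal J_n$ consists of the planar elements all of whose blocks have size $2$. A maximal subsemigroup of a semigroup is a proper subsemigroup (possibly empty) that is contained in no other proper subsemigroup. For a finite monoid $S$ with group of units $G$ and a $\mathscr J$-class $J$ of $S$, the graph $\Delta(S,J)$ is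 the bipartite graph whose vertices are the orbits of the $\mathscr L$-classes of $J$ under right multiplication by $G$ and (taken as distinct vertices) the orbits of the $\mathscr R$-classes of $J$ under left multiplication by $G$; an orbit $A$ of $\mathscr L$-classes is adjacent to an orbit $B$ of $\mathscr R$-classes if and only if $L\cap R$ is a group for some $L\in A$, $R\in B$. Its two bicomponents are the set of all orbits of $\mathscr L$-classes and the set of all orbits of $\mathscr R$-classes. A subset $M\subseteq S$ with $S\setminus M\subseteq J$ has type (M1) with respect to $J$ if $M\cap J=\varnothing$; type (M2) if $M\cap J$ is the union of the members of a proper non-empty set of $\mathscr L$-classes of $J$ and of a proper non-empty set of $\mathscr R$-classes of $J$; type (M3) (resp. (M4)) if $M\cap J$ is the union of a proper non-empty set of $\mathscr L$-classes (resp. $\mathscr R$-classes) of $J$. **Theorem.** Let $n\ge 3$, let $J=\{\alpha\in\mathcal J_n:\operatorname{rank}\alpha=n-2\}$ and $\Delta(\mathcal J_n)=\Delta(\mathcal J_n,J)$. The maximal subsemigroups of $\mathcal J_n$ are exactly the following sets: (a) $\mathcal J_n\setminus\{\mathrm{id}_n\}$ (type (M1) with respect to the group of units); (b) the sets $(\mathcal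 J_n\setminus J)\cup U_K$, where $K$ is a maximal independent subset of $\Delta(\mathcal J_n)$ that is not a bicomponent and $U_K$ is the union of the Green's classes contained in the vertices in $K$ (type (M2) with respect to $J$); (c) $\mathcal J_n\setminus L$, where $L$ is any $\mathscr L$-class of rank $n-2$ (type (M3) with respect to $J$); (d) $\mathcal J_n\setminus R$, where $R$ is any $\mathscr R$-class of rank $n-2$ (type (M4) with respect to $J$). In particular, for $n\ge 3$ there are exactly $2F_{n-1}+2n-3$ maximal subsemigroups of $\mathcal J_n$, where $F_1=F_2=1$ and $F_k=F_{k-1}+F_{k-2}$ for $k\ge3$. The monoid $\mathcal J_2$ is a semilattice of order $2$, and its maximal subsemigroups are exactly its singleton subsets. Moreover, for every $m\ge1$ the monoid $\mathcal{PP}_m$ is isomorphic to $\mathcal J_{2m}$, and for $m\ge2$ it has exactly $2F_{2m-1}+4m-3$ maximal subsemigroups. -/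

import Mathlib

namespace JonesMonoid

/-! ### Auxiliary facts about equivalence relations -/

theorem map_rel_iff {A B : Type*} (r : Setoid A) {f : A → B} (hf : Function.Injective f)
    (x y : B) : r.map f x y ↔ x = y ∨ ∃ a b, r a b ∧ f a = x ∧ f b = y := by
  constructor
  · intro h
    change Relation.EqvGen (Relation.Map r f f) x y at h
    induction h with
    | rel x y h => obtain ⟨a, b, h1, h2, h3⟩ := h; exact Or.inr ⟨a, b, h1, h2, h3⟩
    | refl x => exact Or.inl rfl
    | symm x y h ih =>
      rcases ih with rfl | ⟨a, b, h1, h2, h3⟩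
      · exact Or.inl rfl
      · exact Or.inr ⟨b, a, r.symm h1, h3, h2⟩
    | trans x y z hxy hyz ih1 ih2 =>
      rcases ih1 with rfl | ⟨a, b, h1, h2, h3⟩
      · exact ih2
      · rcases ih2 with rfl | ⟨c, d, h4, h5, h6⟩
        · exact Or.inr ⟨a, b, h1, h2, h3⟩
        · have : b = c := hf (h3.trans h5.symm)
          subst this
          exact Or.inr ⟨a, d, r.trans h1 h4, h2, h6⟩
  · rintro (rfl | ⟨a, b, h1, rfl, rfl⟩)
    · exact (r.map f).refl x
    · exact Relation.EqvGen.rel _ _ ⟨a, b, h1, rfl, rfl⟩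

theorem map_rel_of {A B : Type*} (r : Setoid A) (f : A → B) {a b : A} (h : r a b) :
    r.map f (f a) (f b) :=
  Relation.EqvGen.rel _ _ ⟨a, b, h, rfl, rfl⟩

theorem map_le {A B : Type*} {r : Setoid A} {f : A → B} {s : Setoid B}
    (h : ∀ a b, r a b → s (f a) (f b)) : r.map f ≤ s :=
  Setoid.eqvGen_le (by rintro _ _ ⟨a, b, hab, rfl, rfl⟩; exact h a b hab)

theorem map_sup {A B : Type*} (r s : Setoid A) (f : A → B) :
    (r ⊔ s).map f = r.map f ⊔ s.map f := by
  apply le_antisymm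
  · apply map_le
    intro a b h
    have : r ⊔ s ≤ (r.map f ⊔ s.map f).comap f :=
      sup_le (fun a b h => (le_sup_left : _ ≤ r.map f ⊔ s.map f) (map_rel_of r f h))
        (fun a b h => (le_sup_right : _ ≤ r.map f ⊔ s.map f) (map_rel_of s f h))
    exact this h
  · exact sup_le (map_le fun a b h => map_rel_of _ f ((le_sup_left : r ≤ r ⊔ s) h))
      (map_le fun a b h => map_rel_of _ f ((le_sup_right : s ≤ r ⊔ s) h))

theorem map_map {A B C : Type*} (r : Setoid A) (f : A → B) (g : B → C) :
    (r.map f).map g = r.map (g ∘ f) := by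
  apply le_antisymm
  · apply map_le
    intro a b h
    have : r.map f ≤ (r.map (g ∘ f)).comap g := map_le fun a b h => map_rel_of r (g ∘ f) h
    exact this h
  · exact map_le fun a b h => map_rel_of _ g (map_rel_of r f h)

theorem comap_sup_of_isolated {B C : Type*} (f : B → C)
    (s t : Setoid C)
    (ht : ∀ x y, t x y → x = y ∨ (x ∈ Set.range f ∧ y ∈ Set.range f)) :
    (s ⊔ t).comap f = s.comap f ⊔ t.comap f := by
  apply le_antisymm
  · let Q : Setoid B := s.comap f ⊔ t.comap f
    have hQs : ∀ b c, s (f b) (f c) → Q b c := fun b c h => (le_sup_left : _ ≤ Q) h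
    have hQt : ∀ b c, t (f b) (f c) → Q b c := fun b c h => (le_sup_right : _ ≤ Q) h
    let T : Setoid C :=
      { r := fun u v => s u v ∨ ∃ w w', s u (f w) ∧ s v (f w') ∧ Q w w'
        iseqv :=
          { refl := fun u => Or.inl (s.refl u)
            symm := by
              rintro u v (h | ⟨w, w', h1, h2, h3⟩)
              · exact Or.inl (s.symm h)
              · exact Or.inr ⟨w', w, h2, h1, Q.symm h3⟩
            trans := by
              rintro u v x (h | ⟨w, w', h1, h2, h3⟩) (h' | ⟨y, y', h4, h5, h6⟩)
              · exact Or.inl (s.trans h h')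
              · exact Or.inr ⟨y, y', s.trans h h4, h5, h6⟩
              · exact Or.inr ⟨w, w', h1, s.trans (s.symm h') h2, h3⟩
              · exact Or.inr ⟨w, y', h1, h5,
                  Q.trans h3 (Q.trans (hQs _ _ (s.trans (s.symm h2) h4)) h6)⟩ } }
    have hT : s ⊔ t ≤ T := by
      refine sup_le (fun u v h => Or.inl h) ?_
      intro u v h
      rcases ht u v h with rfl | ⟨⟨w, rfl⟩, ⟨w', rfl⟩⟩
      · exact Or.inl (s.refl _)
      · exact Or.inr ⟨w, w', s.refl _, s.refl _, hQt _ _ h⟩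
    intro b c h
    rcases hT h with h | ⟨w, w', h1, h2, h3⟩
    · exact hQs _ _ h
    · exact Q.trans (hQs _ _ h1) (Q.trans h3 (hQs _ _ (s.symm h2)))
  · exact sup_le (fun b c h => (le_sup_left : s ≤ s ⊔ t) h)
      (fun b c h => (le_sup_right : t ≤ s ⊔ t) h)

/-- Restricting a pushed-forward equivalence along a pullback square of injections. -/
theorem comap_map_square {A B C D : Type*} (r : Setoid B) (a : A → B) (a' : A → C)
    (f : B → D) (g : C → D) (hf : Function.Injective f) (hg : Function.Injective g)
    (hsq : ∀ x, f (a x) = g (a' x)) (hpb : ∀ b c, f b = g c → ∃ x, a x = b ∧ a' x = c) :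
    (r.map f).comap g = (r.comap a).map a' := by
  apply le_antisymm
  · intro c d h
    rcases (map_rel_iff r hf _ _).1 h with h | ⟨b, b', h1, h2, h3⟩
    · rw [hg h]
    · obtain ⟨x, rfl, rfl⟩ := hpb _ _ h2
      obtain ⟨y, rfl, rfl⟩ := hpb _ _ h3
      exact map_rel_of _ _ h1
  · apply map_le
    intro x y h
    change r.map f (g (a' x)) (g (a' y))
    rw [← hsq, ← hsq]
    exact map_rel_of r f h

/-! ### The partition monoid -/

/-- A partition of degree `n`: an equivalence relation on `{1, …, n} ∪ {1', …, n'}`.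
The point `i` is `Sum.inl i` and the point `i'` is `Sum.inr i`. -/
@[ext]
structure PartitionMonoid (n : ℕ) where
  rel : Setoid (Fin n ⊕ Fin n)

/-- The set `{1, …, n} ∪ {1'', …, n''} ∪ {1', …, n'}`. -/
inductive ThreeRows (n : ℕ) where
  | top (i : Fin n)
  | mid (i : Fin n)
  | bot (i : Fin n)

/-- `i ↦ i`, `i' ↦ i''`. -/
def upper {n : ℕ} : Fin n ⊕ Fin n → ThreeRows n := Sum.elim .top .mid

/-- `i ↦ i''`, `i' ↦ i'`. -/
def lower {n : ℕ} : Fin n ⊕ Fin n → ThreeRows n := Sum.elim .mid .bot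

/-- `i ↦ i`, `i' ↦ i'`. -/
def outer {n : ℕ} : Fin n ⊕ Fin n → ThreeRows n := Sum.elim .top .bot

theorem upper_injective {n : ℕ} : Function.Injective (upper (n := n)) := by
  rintro (a | a) (b | b) h <;> simp_all [upper]

theorem lower_injective {n : ℕ} : Function.Injective (lower (n := n)) := by
  rintro (a | a) (b | b) h <;> simp_all [lower]

theorem outer_injective {n : ℕ} : Function.Injective (outer (n := n)) := by
  rintro (a | a) (b | b) h <;> simp_all [outer]

namespace PartitionMonoid

variable {n : ℕ}

/-- The smallest equivalence relation on the three rows containing the copy of `α` on the upper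
two rows and the copy of `β` on the lower two rows. -/
def glued (α β : PartitionMonoid n) : Setoid (ThreeRows n) :=
  α.rel.map upper ⊔ β.rel.map lower

/-- The product of two partitions: restrict `glued α β` to the outer rows. -/
instance : Mul (PartitionMonoid n) := ⟨fun α β => ⟨(glued α β).comap outer⟩⟩

/-- The identity partition, with blocks `{i, i'}`. -/
instance : One (PartitionMonoid n) := ⟨⟨Setoid.ker (Sum.elim id id)⟩⟩

theorem mul_rel (α β : PartitionMonoid n) : (α * β).rel = (glued α β).comap outer := rfl

theorem one_rel_iff (x y : Fin n ⊕ Fin n) :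
    (1 : PartitionMonoid n).rel x y ↔ Sum.elim id id x = Sum.elim id id y := Iff.rfl

/-- Four rows of points, used only for associativity. -/
inductive FourRows (n : ℕ) where
  | r1 (i : Fin n)
  | r2 (i : Fin n)
  | r3 (i : Fin n)
  | r4 (i : Fin n)

def rows123 : ThreeRows n → FourRows n
  | .top i => .r1 i
  | .mid i => .r2 i
  | .bot i => .r3 i

def rows234 : ThreeRows n → FourRows n
  | .top i => .r2 i
  | .mid i => .r3 i
  | .bot i => .r4 i

def rows134 : ThreeRows n → FourRows n
  | .top i => .r1 i
  | .mid i => .r3 i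
  | .bot i => .r4 i

def rows124 : ThreeRows n → FourRows n
  | .top i => .r1 i
  | .mid i => .r2 i
  | .bot i => .r4 i

theorem rows123_injective : Function.Injective (rows123 (n := n)) := by
  rintro (a | a | a) (b | b | b) h <;> simp_all [rows123]

theorem rows234_injective : Function.Injective (rows234 (n := n)) := by
  rintro (a | a | a) (b | b | b) h <;> simp_all [rows234]

theorem rows134_injective : Function.Injective (rows134 (n := n)) := by
  rintro (a | a | a) (b | b | b) h <;> simp_all [rows134]

theorem rows124_injective : Function.Injective (rows124 (n := n)) := by
  rintro (a | a | a) (b | b | b) h <;> simp_all [rows124]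

theorem glued_mul_left (α β γ : PartitionMonoid n) :
    glued (α * β) γ = (α.rel.map (rows123 ∘ upper) ⊔ β.rel.map (rows123 ∘ lower) ⊔
      γ.rel.map (rows234 ∘ lower)).comap rows134 := by
  have hinj : Function.Injective (rows234 ∘ lower (n := n)) :=
    rows234_injective.comp lower_injective
  rw [comap_sup_of_isolated rows134, ← map_map, ← map_map, ← map_sup]
  · rw [comap_map_square _ outer upper rows123 rows134 rows123_injective rows134_injective]
    · rw [comap_map_square _ id lower _ rows134 hinj rows134_injective]
      · rfl
      · rintro (x | x) <;> rfl
      · rintro (x | x) (y | y | y) h <;> simp_all [rows234, lower, rows134]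
    · rintro (x | x) <;> rfl
    · rintro (x | x | x) (y | y | y) h <;> simp_all [rows123, rows134, outer, upper]
  · intro x y h
    rcases (map_rel_iff _ hinj _ _).1 h with h | ⟨a, b, -, rfl, rfl⟩
    · exact Or.inl h
    · right
      constructor
      · rcases a with a | a
        · exact ⟨.mid a, rfl⟩
        · exact ⟨.bot a, rfl⟩
      · rcases b with a | a
        · exact ⟨.mid a, rfl⟩
        · exact ⟨.bot a, rfl⟩

theorem glued_mul_right (α β γ : PartitionMonoid n) :
    glued α (β * γ) = (α.rel.map (rows123 ∘ upper) ⊔ β.rel.map (rows123 ∘ lower) ⊔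
      γ.rel.map (rows234 ∘ lower)).comap rows124 := by
  have hinj : Function.Injective (rows123 ∘ upper (n := n)) :=
    rows123_injective.comp upper_injective
  have hβ : β.rel.map (rows123 ∘ lower) = β.rel.map (rows234 ∘ upper) := by
    congr 1
    funext x
    rcases x with x | x <;> rfl
  rw [sup_assoc, sup_comm, hβ, comap_sup_of_isolated rows124, ← map_map,
    ← map_map _ lower, ← map_sup, sup_comm]
  · rw [comap_map_square _ outer lower rows234 rows124 rows234_injective rows124_injective]
    · rw [comap_map_square _ id upper _ rows124 hinj rows124_injective]
      · rfl
      · rintro (x | x) <;> rfl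
      · rintro (x | x) (y | y | y) h <;> simp_all [rows123, upper, rows124]
    · rintro (x | x) <;> rfl
    · rintro (x | x | x) (y | y | y) h <;> simp_all [rows234, rows124, outer, lower]
  · intro x y h
    rcases (map_rel_iff _ hinj _ _).1 h with h | ⟨a, b, -, rfl, rfl⟩
    · exact Or.inl h
    · right
      constructor
      · rcases a with a | a
        · exact ⟨.top a, rfl⟩
        · exact ⟨.mid a, rfl⟩
      · rcases b with a | a
        · exact ⟨.top a, rfl⟩
        · exact ⟨.mid a, rfl⟩

protected theorem mul_assoc (α β γ : PartitionMonoid n) : α * β * γ = α * (β * γ) := by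
  ext x y
  change glued (α * β) γ (outer x) (outer y) ↔ glued α (β * γ) (outer x) (outer y)
  rw [glued_mul_left, glued_mul_right]
  rcases x with x | x <;> rcases y with y | y <;> exact Iff.rfl

protected theorem one_mul (α : PartitionMonoid n) : 1 * α = α := by
  ext x y
  change glued 1 α (outer x) (outer y) ↔ _
  let c : ThreeRows n → Fin n ⊕ Fin n
    | .top i => .inl i
    | .mid i => .inl i
    | .bot i => .inr i
  constructor
  · intro h
    have hle : glued 1 α ≤ α.rel.comap c := by
      refine sup_le (map_le ?_) (map_le ?_)
      · intro a b hab
        rw [one_rel_iff] at hab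
        have : c (upper a) = c (upper b) := by
          rcases a with a | a <;> rcases b with b | b <;> simp_all [c, upper]
        change α.rel _ _
        rw [this]
      · rintro (a | a) (b | b) hab <;> exact hab
    have := hle h
    rcases x with x | x <;> rcases y with y | y <;> exact this
  · intro h
    have key : ∀ z : Fin n ⊕ Fin n, glued 1 α (outer z) (lower z) := by
      rintro (z | z)
      · exact (le_sup_left : _ ≤ glued 1 α)
          (map_rel_of (1 : PartitionMonoid n).rel upper
            (show (1 : PartitionMonoid n).rel (.inl z) (.inr z) from rfl))
      · exact (glued 1 α).refl _
    exact (glued 1 α).trans (key x) ((glued 1 α).trans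
      ((le_sup_right : _ ≤ glued 1 α) (map_rel_of _ _ h)) ((glued 1 α).symm (key y)))

protected theorem mul_one (α : PartitionMonoid n) : α * 1 = α := by
  ext x y
  change glued α 1 (outer x) (outer y) ↔ _
  let c : ThreeRows n → Fin n ⊕ Fin n
    | .top i => .inl i
    | .mid i => .inr i
    | .bot i => .inr i
  constructor
  · intro h
    have hle : glued α 1 ≤ α.rel.comap c := by
      refine sup_le (map_le ?_) (map_le ?_)
      · rintro (a | a) (b | b) hab <;> exact hab
      · intro a b hab
        rw [one_rel_iff] at hab
        have : c (lower a) = c (lower b) := by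
          rcases a with a | a <;> rcases b with b | b <;> simp_all [c, lower]
        change α.rel _ _
        rw [this]
    have := hle h
    rcases x with x | x <;> rcases y with y | y <;> exact this
  · intro h
    have key : ∀ z : Fin n ⊕ Fin n, glued α 1 (outer z) (upper z) := by
      rintro (z | z)
      · exact (glued α 1).refl _
      · exact (le_sup_right : _ ≤ glued α 1)
          (map_rel_of (1 : PartitionMonoid n).rel lower
            (show (1 : PartitionMonoid n).rel (.inr z) (.inl z) from rfl))
    exact (glued α 1).trans (key x) ((glued α 1).trans
      ((le_sup_left : _ ≤ glued α 1) (map_rel_of _ _ h)) ((glued α 1).symm (key y)))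

instance : Monoid (PartitionMonoid n) where
  mul_assoc := PartitionMonoid.mul_assoc
  one_mul := PartitionMonoid.one_mul
  mul_one := PartitionMonoid.mul_one

/-! ### Planar and Brauer partitions -/

/-- The position of a point in the ordering `n' < (n-1)' < ⋯ < 1' < 1 < 2 < ⋯ < n`. -/
def pos : Fin n ⊕ Fin n → ℤ := Sum.elim (fun i => (i : ℤ) + 1) (fun i => -((i : ℤ) + 1))

/-- No two distinct blocks cross: whenever `a < x < b < y` with `a, b` in a block `A` and `x, y`
in a block `X`, the blocks `A` and `X` coincide. -/
def IsPlanar (α : PartitionMonoid n) : Prop :=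
  ∀ a b x y, α.rel a b → α.rel x y → pos a < pos x → pos x < pos b → pos b < pos y → α.rel a x

/-- Every block has exactly two points. -/
def IsBrauer (α : PartitionMonoid n) : Prop :=
  ∀ B ∈ α.rel.classes, B.ncard = 2

/-- The number of transverse blocks, i.e. of blocks meeting both `{1, …, n}` and `{1', …, n'}`. -/
noncomputable def rank (α : PartitionMonoid n) : ℕ :=
  {B | B ∈ α.rel.classes ∧ (∃ i, Sum.inl i ∈ B) ∧ ∃ j, Sum.inr j ∈ B}.ncard

/-! ### Closure under products

The product is computed by gluing the middle rows of the two factors one pair of points at a time;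
being noncrossing, and having only blocks of size two, are preserved by each gluing step. -/

/-- Merging the classes of `p` and `q`. -/
def merge {P : Type*} (r : Setoid P) (p q : P) : Setoid P where
  r x y := r x y ∨ (r x p ∧ r q y) ∨ (r x q ∧ r p y)
  iseqv :=
    { refl := fun x => Or.inl (r.refl x)
      symm := by
        rintro x y (h | ⟨h, h'⟩ | ⟨h, h'⟩)
        · exact Or.inl (r.symm h)
        · exact Or.inr (Or.inr ⟨r.symm h', r.symm h⟩)
        · exact Or.inr (Or.inl ⟨r.symm h', r.symm h⟩)
      trans := by
        rintro x y z (h | ⟨h, h'⟩ | ⟨h, h'⟩) (k | ⟨k, k'⟩ | ⟨k, k'⟩)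
        · exact Or.inl (r.trans h k)
        · exact Or.inr (Or.inl ⟨r.trans h k, k'⟩)
        · exact Or.inr (Or.inr ⟨r.trans h k, k'⟩)
        · exact Or.inr (Or.inl ⟨h, r.trans h' k⟩)
        · exact Or.inr (Or.inl ⟨h, k'⟩)
        · exact Or.inl (r.trans h k')
        · exact Or.inr (Or.inr ⟨h, r.trans h' k⟩)
        · exact Or.inl (r.trans h k')
        · exact Or.inr (Or.inr ⟨h, k'⟩) }

theorem merge_rel {P : Type*} (r : Setoid P) (p q x y : P) :
    merge r p q x y ↔ r x y ∨ (r x p ∧ r q y) ∨ (r x q ∧ r p y) := Iff.rfl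

/-- Noncrossing on the set `S`, with respect to the order given by `key`. -/
def NoncrossingOn {P : Type*} (key : P → ℤ) (S : Set P) (r : Setoid P) : Prop :=
  ∀ a ∈ S, ∀ b ∈ S, ∀ x ∈ S, ∀ y ∈ S,
    r a b → r x y → key a < key x → key x < key b → key b < key y → r a x

/-- Every class meets `S` in no point or exactly two points. -/
def MatchingOn {P : Type*} (S : Set P) (r : Setoid P) : Prop :=
  ∀ x ∈ S, ∃ y ∈ S, y ≠ x ∧ r x y ∧ ∀ z ∈ S, r x z → z = x ∨ z = y

theorem NoncrossingOn.merge {P : Type*} {key : P → ℤ} {S : Set P} {r : Setoid P}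
    (h : NoncrossingOn key S r) {p q : P} (hp : p ∈ S) (hq : q ∈ S) (hpq : key p < key q)
    (hadj : ∀ z ∈ S, key z ≤ key p ∨ key q ≤ key z)
    (hinj : ∀ z ∈ S, ∀ w ∈ S, key z = key w → z = w) :
    NoncrossingOn key S (merge r p q) := by
  have hlt : ∀ z ∈ S, ¬ r z p → ¬ r z q → key z < key p ∨ key q < key z := by
    intro z hz h1 h2
    have h3 : key z ≠ key p := fun e => h1 (by rw [hinj z hz p hp e])
    have h4 : key z ≠ key q := fun e => h2 (by rw [hinj z hz q hq e])
    have := hadj z hz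
    omega
  intro a ha b hb x hx y hy hab hxy h1 h2 h3
  by_contra hcon
  rw [merge_rel] at hab hxy hcon
  push Not at hcon
  obtain ⟨c1, c2, c3⟩ := hcon
  have sy : ∀ {u v}, r u v → r v u := fun h => r.symm h
  have tr : ∀ {u v w}, r u v → r v w → r u w := fun h k => r.trans h k
  rcases hab with hab | hab
  · rcases hxy with hxy | hxy
    · exact c1 (h a ha b hb x hx y hy hab hxy h1 h2 h3)
    · have hap : ¬ r a p := by
        intro k
        rcases hxy with ⟨k1, k2⟩ | ⟨k1, k2⟩
        · exact c1 (tr k (sy k1))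
        · exact c2 k (sy k1)
      have haq : ¬ r a q := by
        intro k
        rcases hxy with ⟨k1, k2⟩ | ⟨k1, k2⟩
        · exact c3 k (sy k1)
        · exact c1 (tr k (sy k1))
      have hbp : ¬ r b p := fun k => hap (tr hab k)
      have hbq : ¬ r b q := fun k => haq (tr hab k)
      have la := hlt a ha hap haq
      have lb := hlt b hb hbp hbq
      rcases hxy with ⟨k1, k2⟩ | ⟨k1, k2⟩
      · rcases la with la | la
        · rcases lb with lb | lb
          · exact c1 (h a ha b hb x hx p hp hab k1 h1 h2 lb)
          · exact haq (h a ha b hb q hq y hy hab k2 (by omega) (by omega) h3)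
        · exact hap (sy (h p hp x hx a ha b hb (sy k1) hab (by omega) h1 h2))
      · rcases la with la | la
        · rcases lb with lb | lb
          · exact c1 (h a ha b hb x hx q hq hab k1 h1 h2 (by omega))
          · exact hap (h a ha b hb p hp y hy hab k2 (by omega) (by omega) h3)
        · exact haq (sy (h q hq x hx a ha b hb (sy k1) hab (by omega) h1 h2))
  · rcases hxy with hxy | hxy
    · have hxp : ¬ r x p := by
        intro k
        rcases hab with ⟨k1, k2⟩ | ⟨k1, k2⟩
        · exact c1 (tr k1 (sy k))
        · exact c3 k1 (sy k)
      have hxq : ¬ r x q := by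
        intro k
        rcases hab with ⟨k1, k2⟩ | ⟨k1, k2⟩
        · exact c2 k1 (sy k)
        · exact c1 (tr k1 (sy k))
      have hyp : ¬ r y p := fun k => hxp (tr hxy k)
      have hyq : ¬ r y q := fun k => hxq (tr hxy k)
      have lx := hlt x hx hxp hxq
      have ly := hlt y hy hyp hyq
      rcases hab with ⟨k1, k2⟩ | ⟨k1, k2⟩
      · rcases lx with lx | lx
        · rcases ly with ly | ly
          · exact hxq (tr (h x hx y hy b hb q hq hxy (sy k2) h2 h3 (by omega)) (sy k2))
          · exact c1 (h a ha p hp x hx y hy k1 hxy h1 lx (by omega))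
        · exact hxq (sy (h q hq b hb x hx y hy k2 hxy lx h2 h3))
      · rcases lx with lx | lx
        · rcases ly with ly | ly
          · exact hxp (tr (h x hx y hy b hb p hp hxy (sy k2) h2 h3 ly) (sy k2))
          · exact c1 (h a ha q hq x hx y hy k1 hxy h1 (by omega) ly)
        · exact hxp (sy (h p hp b hb x hx y hy k2 hxy (by omega) h2 h3))
    · rcases hab with ⟨k1, k2⟩ | ⟨k1, k2⟩ <;> rcases hxy with ⟨k3, k4⟩ | ⟨k3, k4⟩
      · exact c1 (tr k1 (sy k3))
      · exact c2 k1 (sy k3)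
      · exact c3 k1 (sy k3)
      · exact c1 (tr k1 (sy k3))

theorem MatchingOn.merge {P : Type*} {S : Set P} {r : Setoid P} (h : MatchingOn S r) {p q : P}
    (hp : p ∈ S) (hq : q ∈ S) (hpq : p ≠ q) :
    MatchingOn (S \ {p, q}) (merge r p q) := by
  have sy : ∀ {u v}, r u v → r v u := fun h => r.symm h
  have tr : ∀ {u v w}, r u v → r v w → r u w := fun h k => r.trans h k
  rintro x ⟨hx, hx'⟩
  simp only [Set.mem_insert_iff, Set.mem_singleton_iff, not_or] at hx'
  obtain ⟨hxp, hxq⟩ := hx'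
  obtain ⟨y, hy, hyx, hxy, huniq⟩ := h x hx
  have main : ∀ p q : P, p ∈ S → q ∈ S → p ≠ q → x ≠ p → x ≠ q → r x p →
      (∀ z ∈ S, r x z → z = x ∨ z = p) →
      ∃ y ∈ S \ {p, q}, y ≠ x ∧ JonesMonoid.PartitionMonoid.merge r p q x y ∧
        ∀ z ∈ S \ {p, q}, JonesMonoid.PartitionMonoid.merge r p q x z → z = x ∨ z = y := by
    intro p q hp hq hpq hxp hxq hrp huniq
    have hrq : ¬ r x q := by
      intro k
      rcases huniq q hq k with k | k
      · exact hxq k.symm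
      · exact hpq k.symm
    obtain ⟨w, hw, hwq, hqw, hwu⟩ := h q hq
    refine ⟨w, ⟨hw, ?_⟩, ?_, Or.inr (Or.inl ⟨hrp, hqw⟩), ?_⟩
    · rintro (rfl | rfl)
      · exact hrq (tr hrp (sy hqw))
      · exact hwq rfl
    · rintro rfl
      exact hrq (sy hqw)
    · rintro z ⟨hz, hz'⟩ (k | ⟨k, k'⟩ | ⟨k, k'⟩)
      · rcases huniq z hz k with e | e
        · exact Or.inl e
        · exact (hz' (Or.inl e)).elim
      · rcases hwu z hz k' with e | e
        · exact (hz' (Or.inr e)).elim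
        · exact Or.inr e
      · exact (hrq k).elim
  by_cases hyp : y = p
  · subst hyp
    exact main y q hp hq hpq hxp hxq hxy huniq
  by_cases hyq : y = q
  · subst hyq
    obtain ⟨w, hw, h1, h2, h3⟩ := main y p hq hp (Ne.symm hpq) hxq hxp hxy huniq
    rw [Set.pair_comm] at hw h3
    exact ⟨w, hw, h1, h2.imp id Or.symm, fun z hz k => h3 z hz (k.imp id Or.symm)⟩
  have hrp : ¬ r x p := fun k => (huniq p hp k).elim (fun e => hxp e.symm) (fun e => hyp e.symm)
  have hrq : ¬ r x q := fun k => (huniq q hq k).elim (fun e => hxq e.symm) (fun e => hyq e.symm)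
  refine ⟨y, ⟨hy, by simp [hyp, hyq]⟩, hyx, Or.inl hxy, ?_⟩
  rintro z ⟨hz, -⟩ (k | ⟨k, -⟩ | ⟨k, -⟩)
  · exact huniq z hz k
  · exact (hrp k).elim
  · exact (hrq k).elim

/-- Two disjoint copies of the points: those of the first and those of the second factor. -/
abbrev Pair (n : ℕ) : Type := (Fin n ⊕ Fin n) ⊕ (Fin n ⊕ Fin n)

def pairSetoid (α β : PartitionMonoid n) : Setoid (Pair n) where
  r
    | .inl a, .inl b => α.rel a b
    | .inr a, .inr b => β.rel a b
    | _, _ => False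
  iseqv :=
    { refl := by rintro (a | a) <;> exact Setoid.refl' _ a
      symm := by
        rintro (a | a) (b | b) h
        · exact α.rel.symm h
        · exact h
        · exact h
        · exact β.rel.symm h
      trans := by
        rintro (a | a) (b | b) (c | c) h h'
        · exact α.rel.trans h h'
        all_goals first | exact h.elim | exact h'.elim | skip
        exact β.rel.trans h h' }

def toRows : Pair n → ThreeRows n := Sum.elim upper lower

/-- The points that survive after the first `k` pairs have been glued. -/
def active (n k : ℕ) : Set (Pair n) :=
  {z | (∀ i, z = .inl (.inr i) → k ≤ (i : ℕ)) ∧ (∀ i, z = .inr (.inl i) → k ≤ (i : ℕ))}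

/-- Glue the first `k` pairs of middle points. -/
def glueUpTo (α β : PartitionMonoid n) : ℕ → Setoid (Pair n)
  | 0 => pairSetoid α β
  | k + 1 =>
    if h : k < n then merge (glueUpTo α β k) (.inl (.inr ⟨k, h⟩)) (.inr (.inl ⟨k, h⟩))
    else glueUpTo α β k

theorem glueUpTo_mono (α β : PartitionMonoid n) {k l : ℕ} (h : k ≤ l) :
    glueUpTo α β k ≤ glueUpTo α β l := by
  induction l, h using Nat.le_induction with
  | base => exact le_rfl
  | succ l _ ih =>
    refine ih.trans ?_
    rw [glueUpTo]
    split
    · exact fun x y hxy => Or.inl hxy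
    · exact le_rfl

theorem glueUpTo_mid (α β : PartitionMonoid n) (i : Fin n) :
    glueUpTo α β n (.inl (.inr i)) (.inr (.inl i)) := by
  apply glueUpTo_mono α β (Nat.succ_le_of_lt i.2)
  rw [Nat.succ_eq_add_one, glueUpTo, dif_pos i.2]
  exact Or.inr (Or.inl ⟨Setoid.refl' _ _, Setoid.refl' _ _⟩)

theorem glueUpTo_le (α β : PartitionMonoid n) (k : ℕ) :
    glueUpTo α β k ≤ (glued α β).comap toRows := by
  induction k with
  | zero =>
    rintro (a | a) (b | b) h
    · exact (le_sup_left : _ ≤ glued α β) (map_rel_of _ _ h)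
    · exact h.elim
    · exact h.elim
    · exact (le_sup_right : _ ≤ glued α β) (map_rel_of _ _ h)
  | succ k ih =>
    rw [glueUpTo]
    split
    · rename_i hk
      rintro x y (h | ⟨h, h'⟩ | ⟨h, h'⟩)
      · exact ih h
      all_goals
        have h1 : glued α β (toRows x) (.mid ⟨k, hk⟩) := ih h
        have h2 : glued α β (.mid ⟨k, hk⟩) (toRows y) := ih h'
        exact (glued α β).trans h1 h2
    · exact ih

theorem le_glueUpTo (α β : PartitionMonoid n) :
    (glued α β).comap toRows ≤ glueUpTo α β n := by
  set r := glueUpTo α β n with hr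
  have hmid := glueUpTo_mid α β
  rw [← hr] at hmid
  have hker : ∀ u v : Pair n, toRows u = toRows v → r u v := by
    rintro ((u | u) | (u | u)) ((v | v) | (v | v)) h <;>
      simp only [toRows, upper, lower, Sum.elim_inl, Sum.elim_inr, ThreeRows.top.injEq,
        ThreeRows.mid.injEq, ThreeRows.bot.injEq, reduceCtorEq] at h <;> subst h
    · exact r.refl _
    · exact r.refl _
    · exact hmid _
    · exact r.symm (hmid _)
    · exact r.refl _
    · exact r.refl _
  have hsurj : ∀ x : ThreeRows n, ∃ u, toRows u = x := by
    rintro (x | x | x)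
    · exact ⟨.inl (.inl x), rfl⟩
    · exact ⟨.inl (.inr x), rfl⟩
    · exact ⟨.inr (.inr x), rfl⟩
  have h0 : pairSetoid α β ≤ r := glueUpTo_mono α β (Nat.zero_le n)
  let T : Setoid (ThreeRows n) :=
    { r := fun x y => ∀ u v, toRows u = x → toRows v = y → r u v
      iseqv :=
        { refl := fun x u v hu hv => hker u v (hu.trans hv.symm)
          symm := fun h u v hu hv => r.symm (h v u hv hu)
          trans := by
            intro x y z h h' u v hu hv
            obtain ⟨w, hw⟩ := hsurj y
            exact r.trans (h u w hu hw) (h' w v hw hv) } }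
  have hT : glued α β ≤ T := by
    refine sup_le (map_le ?_) (map_le ?_)
    · intro a b hab u v hu hv
      exact r.trans (hker u (.inl a) hu) (r.trans (h0 (show pairSetoid α β (.inl a) (.inl b) from hab))
        (hker (.inl b) v hv.symm))
    · intro a b hab u v hu hv
      exact r.trans (hker u (.inr a) hu) (r.trans (h0 (show pairSetoid α β (.inr a) (.inr b) from hab))
        (hker (.inr b) v hv.symm))
  intro u v h
  exact hT h u v rfl rfl

/-- The outer points, inside the two disjoint copies. -/
def outerPair : Fin n ⊕ Fin n → Pair n := Sum.map .inl .inr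

theorem mul_rel_iff (α β : PartitionMonoid n) (x y : Fin n ⊕ Fin n) :
    (α * β).rel x y ↔ glueUpTo α β n (outerPair x) (outerPair y) := by
  have e : ∀ z : Fin n ⊕ Fin n, toRows (outerPair z) = outer z := by rintro (z | z) <;> rfl
  change glued α β (outer x) (outer y) ↔ _
  rw [← e, ← e]
  exact ⟨fun h => le_glueUpTo α β h, fun h => glueUpTo_le α β n h⟩

theorem active_succ {k : ℕ} (h : k < n) :
    active n (k + 1) = active n k \ {.inl (.inr ⟨k, h⟩), .inr (.inl ⟨k, h⟩)} := by
  ext z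
  rcases z with (z | z) | (z | z) <;>
    simp [active] <;> rw [Fin.ext_iff] <;> simp only <;> omega

theorem outerPair_mem_active (x : Fin n ⊕ Fin n) : outerPair x ∈ active n n := by
  rcases x with x | x <;> simp [active, outerPair]

theorem exists_outerPair {z : Pair n} (hz : z ∈ active n n) : ∃ x, outerPair x = z := by
  rcases z with (z | z) | (z | z)
  · exact ⟨.inl z, rfl⟩
  · have := hz.1 z rfl; omega
  · have := hz.2 z rfl; omega
  · exact ⟨.inr z, rfl⟩

theorem outerPair_injective : Function.Injective (outerPair (n := n)) := by
  rintro (a | a) (b | b) h <;> simp_all [outerPair]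

theorem glue_induction (α β : PartitionMonoid n) (motive : Set (Pair n) → Setoid (Pair n) → Prop)
    (h0 : motive Set.univ (pairSetoid α β))
    (hs : ∀ (i : Fin n) r, motive (active n i) r →
      motive (active n i \ {.inl (.inr i), .inr (.inl i)})
        (merge r (.inl (.inr i)) (.inr (.inl i)))) :
    motive (active n n) (glueUpTo α β n) := by
  have : ∀ k, k ≤ n → motive (active n k) (glueUpTo α β k) := by
    intro k
    induction k with
    | zero =>
      intro _
      have : active n 0 = Set.univ := by ext z; simp [active]
      rw [this]
      exact h0
    | succ k ih =>
      intro hk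
      rw [active_succ hk, glueUpTo, dif_pos (show k < n from hk)]
      exact hs ⟨k, hk⟩ _ (ih (by omega))
  exact this n le_rfl

/-- The order in which `1, …, n, n'', …, 1''` (first factor) and `1'', …, n'', n', …, 1'`
(second factor) occur along a line. -/
def pairKey : Pair n → ℤ
  | .inl (.inl i) => (i : ℤ) - 2 * n
  | .inl (.inr i) => -((i : ℤ) + 1)
  | .inr (.inl i) => (i : ℤ) + 1
  | .inr (.inr i) => 2 * n - (i : ℤ)

theorem pairKey_injective : Function.Injective (pairKey (n := n)) := by
  rintro ((a | a) | (a | a)) ((b | b) | (b | b)) h <;> simp only [pairKey] at h <;>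
    first
    | (exfalso; omega)
    | (have : a = b := Fin.ext (by omega)
       rw [this])

/-- Being noncrossing does not change when the linear order is rotated. -/
theorem NoncrossingOn.rotate {P : Type*} {k₁ k₂ : P → ℤ} {r : Setoid P} (U : P → Prop)
    (h : NoncrossingOn k₂ Set.univ r)
    (hsame : ∀ u v, (U u ↔ U v) → k₁ u < k₁ v → k₂ u < k₂ v)
    (hpre : ∀ u v, ¬ U u → U v → ¬ k₁ u < k₁ v)
    (hrot : ∀ u v, U u → ¬ U v → k₂ v < k₂ u) : NoncrossingOn k₁ Set.univ r := by
  intro a _ b _ x _ y _ hab hxy h1 h2 h3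
  have N : ∀ a b x y, r a b → r x y → k₂ a < k₂ x → k₂ x < k₂ b → k₂ b < k₂ y → r a x :=
    fun a b x y => h a trivial b trivial x trivial y trivial
  have sy : ∀ {u v}, r u v → r v u := fun h => r.symm h
  have tr : ∀ {u v w}, r u v → r v w → r u w := fun h k => r.trans h k
  by_cases ua : U a
  · by_cases ux : U x
    · by_cases ub : U b
      · by_cases uy : U y
        · exact N a b x y hab hxy (hsame _ _ (by tauto) h1) (hsame _ _ (by tauto) h2)
            (hsame _ _ (by tauto) h3)
        · exact tr (sy (N y x a b (sy hxy) hab (hrot _ _ ua uy) (hsame _ _ (by tauto) h1)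
            (hsame _ _ (by tauto) h2))) (sy hxy)
      · have uy : ¬ U y := fun k => hpre _ _ ub k h3
        exact tr hab (tr (N b a y x (sy hab) (sy hxy) (hsame _ _ (by tauto) h3)
          (hrot _ _ ua uy) (hsame _ _ (by tauto) h1)) (sy hxy))
    · have ub : ¬ U b := fun k => hpre _ _ ux k h2
      have uy : ¬ U y := fun k => hpre _ _ ub k h3
      exact tr hab (sy (N x y b a hxy (sy hab) (hsame _ _ (by tauto) h2)
        (hsame _ _ (by tauto) h3) (hrot _ _ ua uy)))
  · have ux : ¬ U x := fun k => hpre _ _ ua k h1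
    have ub : ¬ U b := fun k => hpre _ _ ux k h2
    have uy : ¬ U y := fun k => hpre _ _ ub k h3
    exact N a b x y hab hxy (hsame _ _ (by tauto) h1) (hsame _ _ (by tauto) h2)
      (hsame _ _ (by tauto) h3)

theorem IsPlanar.noncrossing {α β : PartitionMonoid n} (hα : α.IsPlanar) (hβ : β.IsPlanar) :
    NoncrossingOn pairKey Set.univ (pairSetoid α β) := by
  have h1 : NoncrossingOn (fun z => pairKey (.inl z)) Set.univ α.rel := by
    refine NoncrossingOn.rotate (k₂ := pos) (fun z => z.isLeft = true)
      (fun a _ b _ x _ y _ => hα a b x y) ?_ ?_ ?_ <;>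
    · rintro (u | u) (v | v) <;> simp [pairKey, pos] <;> omega
  have h2 : NoncrossingOn (fun z => pairKey (.inr z)) Set.univ β.rel := by
    refine NoncrossingOn.rotate (k₂ := pos) (fun z => z.isLeft = true)
      (fun a _ b _ x _ y _ => hβ a b x y) ?_ ?_ ?_ <;>
    · rintro (u | u) (v | v) <;> simp [pairKey, pos] <;> omega
  rintro (a | a) - (b | b) - (x | x) - (y | y) - hab hxy k1 k2 k3 <;>
    first | exact hab.elim | exact hxy.elim | skip
  · exact h1 a trivial b trivial x trivial y trivial hab hxy k1 k2 k3
  · exfalso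
    rcases b with b | b <;> rcases x with x | x <;> simp only [pairKey] at k2 <;> omega
  · exfalso
    rcases a with a | a <;> rcases x with x | x <;> simp only [pairKey] at k1 <;> omega
  · exact h2 a trivial b trivial x trivial y trivial hab hxy k1 k2 k3

theorem IsPlanar.mul {α β : PartitionMonoid n} (hα : α.IsPlanar) (hβ : β.IsPlanar) :
    (α * β).IsPlanar := by
  have key := glue_induction α β (fun S r => NoncrossingOn pairKey S r) (hα.noncrossing hβ) (by
    intro i r hr
    have hm : NoncrossingOn pairKey (active n i) (merge r (.inl (.inr i)) (.inr (.inl i))) := by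
      apply hr.merge
      · simp [active]
      · simp [active]
      · simp only [pairKey]; omega
      · rintro ((z | z) | (z | z)) hz <;> simp only [pairKey]
        · omega
        · have := hz.1 z rfl; omega
        · have := hz.2 z rfl; omega
        · omega
      · exact fun z _ w _ h => pairKey_injective h
    exact fun a ha b hb x hx y hy => hm a ha.1 b hb.1 x hx.1 y hy.1)
  have k1 : NoncrossingOn (fun z => pairKey (outerPair z)) Set.univ (α * β).rel := by
    intro a _ b _ x _ y _ hab hxy h1 h2 h3
    rw [mul_rel_iff] at hab hxy ⊢
    exact key _ (outerPair_mem_active a) _ (outerPair_mem_active b) _ (outerPair_mem_active x)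
      _ (outerPair_mem_active y) hab hxy h1 h2 h3
  have k2 : NoncrossingOn pos Set.univ (α * β).rel := by
    refine NoncrossingOn.rotate (k₂ := fun z => pairKey (outerPair z)) (fun z => z.isRight = true)
      k1 ?_ ?_ ?_ <;>
    · rintro (u | u) (v | v) <;> simp [pairKey, pos, outerPair] <;> omega
  exact fun a b x y => k2 a trivial b trivial x trivial y trivial

theorem isBrauer_iff (α : PartitionMonoid n) :
    α.IsBrauer ↔ ∀ x, ∃ y, y ≠ x ∧ α.rel x y ∧ ∀ z, α.rel x z → z = x ∨ z = y := by
  have key : ∀ x, {z | α.rel z x}.ncard = 2 ↔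
      ∃ y, y ≠ x ∧ α.rel x y ∧ ∀ z, α.rel x z → z = x ∨ z = y := by
    intro x
    have hx : x ∈ {z | α.rel z x} := α.rel.refl x
    rw [Set.ncard_eq_two]
    constructor
    · rintro ⟨u, v, huv, h⟩
      have mem : ∀ z, α.rel z x ↔ z = u ∨ z = v := fun z => by
        have : z ∈ {z | α.rel z x} ↔ z ∈ ({u, v} : Set _) := by rw [h]
        simpa using this
      rcases (mem x).1 hx with rfl | rfl
      · exact ⟨v, huv.symm, α.rel.symm ((mem v).2 (Or.inr rfl)),
          fun z hz => (mem z).1 (α.rel.symm hz)⟩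
      · exact ⟨u, huv, α.rel.symm ((mem u).2 (Or.inl rfl)),
          fun z hz => ((mem z).1 (α.rel.symm hz)).symm⟩
    · rintro ⟨y, hne, hxy, hu⟩
      refine ⟨x, y, hne.symm, ?_⟩
      ext z
      simp only [Set.mem_ofPred_eq, Set.mem_insert_iff, Set.mem_singleton_iff]
      constructor
      · exact fun h => hu z (α.rel.symm h)
      · rintro (rfl | rfl)
        · exact hx
        · exact α.rel.symm hxy
  constructor
  · exact fun h x => (key x).1 (h _ (Setoid.mem_classes _ x))
  · rintro h _ ⟨x, rfl⟩
    exact (key x).2 (h x)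

theorem IsBrauer.mul {α β : PartitionMonoid n} (hα : α.IsBrauer) (hβ : β.IsBrauer) :
    (α * β).IsBrauer := by
  rw [isBrauer_iff] at hα hβ
  have key := glue_induction α β (fun S r => MatchingOn S r) (by
    rintro (x | x) -
    · obtain ⟨y, h1, h2, h3⟩ := hα x
      refine ⟨.inl y, trivial, by simpa using h1, h2, ?_⟩
      rintro (z | z) - h
      · exact (h3 z h).imp (congrArg _) (congrArg _)
      · exact h.elim
    · obtain ⟨y, h1, h2, h3⟩ := hβ x
      refine ⟨.inr y, trivial, by simpa using h1, h2, ?_⟩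
      rintro (z | z) - h
      · exact h.elim
      · exact (h3 z h).imp (congrArg _) (congrArg _)) (by
    intro i r hr
    exact hr.merge (by simp [active]) (by simp [active]) (by simp))
  rw [isBrauer_iff]
  intro x
  obtain ⟨y, hy, h1, h2, h3⟩ := key (outerPair x) (outerPair_mem_active x)
  obtain ⟨y, rfl⟩ := exists_outerPair hy
  refine ⟨y, fun h => h1 (by rw [h]), (mul_rel_iff _ _ _ _).2 h2, fun z hz => ?_⟩
  exact (h3 _ (outerPair_mem_active z) ((mul_rel_iff _ _ _ _).1 hz)).imp
    (fun h => outerPair_injective h) (fun h => outerPair_injective h)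

theorem isPlanar_one : (1 : PartitionMonoid n).IsPlanar := by
  rintro (a | a) (b | b) (x | x) (y | y) hab hxy h1 h2 h3 <;>
    simp only [one_rel_iff, Sum.elim_inl, Sum.elim_inr, id, pos] at hab hxy h1 h2 h3 ⊢ <;>
    subst hab <;> subst hxy <;> omega

theorem isBrauer_one : (1 : PartitionMonoid n).IsBrauer := by
  rw [isBrauer_iff]
  rintro (x | x)
  · refine ⟨.inr x, by simp, rfl, ?_⟩
    rintro (z | z) h <;> simp only [one_rel_iff, Sum.elim_inl, Sum.elim_inr, id] at h <;> simp [h]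
  · refine ⟨.inl x, by simp, rfl, ?_⟩
    rintro (z | z) h <;> simp only [one_rel_iff, Sum.elim_inl, Sum.elim_inr, id] at h <;> simp [h]

end PartitionMonoid

/-- The planar partition monoid of degree `n`. -/
def planarPartitionMonoid (n : ℕ) : Submonoid (PartitionMonoid n) where
  carrier := {α | α.IsPlanar}
  mul_mem' := PartitionMonoid.IsPlanar.mul
  one_mem' := PartitionMonoid.isPlanar_one

/-- The Jones (Temperley–Lieb) monoid of degree `n`: the planar partitions all of whose blocks have
size two. -/
def jonesMonoid (n : ℕ) : Submonoid (PartitionMonoid n) where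
  carrier := {α | α.IsBrauer ∧ α.IsPlanar}
  mul_mem' := fun hα hβ => ⟨hα.1.mul hβ.1, hα.2.mul hβ.2⟩
  one_mem' := ⟨PartitionMonoid.isBrauer_one, PartitionMonoid.isPlanar_one⟩

/-! ### Green's classes and the graph `Δ(S, J)` of a monoid -/

section Monoid

variable {S : Type*} [Monoid S]

/-- The `ℒ`-class of `a`: the elements generating the same principal left ideal as `a`. -/
def lClass (a : S) : Set S := {b | (Set.range fun s : S => s * b) = Set.range fun s : S => s * a}

/-- The `ℛ`-class of `a`: the elements generating the same principal right ideal as `a`. -/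
def rClass (a : S) : Set S := {b | (Set.range fun s : S => b * s) = Set.range fun s : S => a * s}

/-- `J / ℒ`, the set of `ℒ`-classes in the `𝒥`-class `J`. -/
def lClasses (J : Set S) : Set (Set S) := {L | ∃ a ∈ J, L = lClass a}

/-- `J / ℛ`, the set of `ℛ`-classes in the `𝒥`-class `J`. -/
def rClasses (J : Set S) : Set (Set S) := {R | ∃ a ∈ J, R = rClass a}

/-- The orbits of `ℒ`-classes of `J` under right multiplication by units. -/
def lOrbits (J : Set S) : Set (Set (Set S)) :=
  {A | ∃ L ∈ lClasses J, A = {L' | ∃ g : Sˣ, L' = (fun x => x * (g : S)) '' L}}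

/-- The orbits of `ℛ`-classes of `J` under left multiplication by units. -/
def rOrbits (J : Set S) : Set (Set (Set S)) :=
  {B | ∃ R ∈ rClasses J, B = {R' | ∃ g : Sˣ, R' = (fun x => (g : S) * x) '' R}}

/-- `H` is a group under the multiplication of `S`. -/
def IsGroupSubset (H : Set S) : Prop :=
  (∀ a ∈ H, ∀ b ∈ H, a * b ∈ H) ∧
    ∃ e ∈ H, ∀ a ∈ H, e * a = a ∧ a * e = a ∧ ∃ b ∈ H, a * b = e ∧ b * a = e

/-- Adjacency between an orbit of `ℒ`-classes and an orbit of `ℛ`-classes. -/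
def OrbitAdj (A B : Set (Set S)) : Prop := ∃ L ∈ A, ∃ R ∈ B, IsGroupSubset (L ∩ R)

/-- The bipartite graph `Δ(S, J)`. Its two bicomponents are `Set.range Sum.inl` and
`Set.range Sum.inr`. -/
def deltaGraph (J : Set S) : SimpleGraph (lOrbits J ⊕ rOrbits J) where
  Adj
    | .inl A, .inr B => OrbitAdj A.1 B.1
    | .inr B, .inl A => OrbitAdj A.1 B.1
    | _, _ => False
  symm := ⟨by rintro (A | A) (B | B) h <;> exact h⟩
  loopless := ⟨by rintro (A | A) h <;> exact h⟩

/-- The union of the Green's classes contained in a set `K` of vertices of `Δ(S, J)`. -/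
def greenUnion {J : Set S} (K : Set (lOrbits J ⊕ rOrbits J)) : Set S :=
  {x | (∃ A, Sum.inl A ∈ K ∧ ∃ L ∈ A.1, x ∈ L) ∨ (∃ B, Sum.inr B ∈ K ∧ ∃ R ∈ B.1, x ∈ R)}

/-- `M` is a maximal subsemigroup of `S`: a proper subsemigroup contained in no other proper
subsemigroup. (The empty subsemigroup is allowed.) -/
def IsMaximalSubsemigroup (M : Set S) : Prop := ∃ T : Subsemigroup S, (T : Set S) = M ∧ IsCoatom T

/-- `M` has its complement inside `J` and has type (M1) with respect to `J`. -/
def IsTypeM1 (J M : Set S) : Prop := Mᶜ ⊆ J ∧ M ∩ J = ∅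

/-- `M` has its complement inside `J` and has type (M2) with respect to `J`: `M ∩ J` is a union of
both `ℒ`-classes and `ℛ`-classes of `J`. -/
def IsTypeM2 (J M : Set S) : Prop :=
  Mᶜ ⊆ J ∧ ∃ A ⊂ lClasses J, ∃ B ⊂ rClasses J,
    A.Nonempty ∧ B.Nonempty ∧ M ∩ J = ⋃₀ A ∪ ⋃₀ B

/-- `M` has its complement inside `J` and has type (M3) with respect to `J`: `M ∩ J` is a non-empty
union of `ℒ`-classes of `J`, not all of them. -/
def IsTypeM3 (J M : Set S) : Prop :=
  Mᶜ ⊆ J ∧ ∃ A ⊂ lClasses J, A.Nonempty ∧ M ∩ J = ⋃₀ A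

/-- `M` has its complement inside `J` and has type (M4) with respect to `J`: `M ∩ J` is a non-empty
union of `ℛ`-classes of `J`, not all of them. -/
def IsTypeM4 (J M : Set S) : Prop :=
  Mᶜ ⊆ J ∧ ∃ B ⊂ rClasses J, B.Nonempty ∧ M ∩ J = ⋃₀ B

end Monoid

/-- The elements of rank `k` of the Jones monoid of degree `n`. -/
def rankSet (n k : ℕ) : Set (jonesMonoid n) := {α | (α : PartitionMonoid n).rank = k}

/-- The set `J_n ∖ {id}`. -/
def familyId (n : ℕ) : Set (Set (jonesMonoid n)) := {{1}ᶜ}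

/-- The unions of the complement of rank `n - 2` and of the Green's classes in a maximal independent
set of `Δ(J_n)` that is not a bicomponent. -/
def familyIndep (n : ℕ) : Set (Set (jonesMonoid n)) :=
  {M | ∃ K, Maximal (deltaGraph (rankSet n (n - 2))).IsIndepSet K ∧
    K ≠ Set.range Sum.inl ∧ K ≠ Set.range Sum.inr ∧ M = (rankSet n (n - 2))ᶜ ∪ greenUnion K}

/-- The complements of single `ℒ`-classes of rank `n - 2`. -/
def familyL (n : ℕ) : Set (Set (jonesMonoid n)) := {M | ∃ L ∈ lClasses (rankSet n (n - 2)), M = Lᶜ}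

/-- The complements of single `ℛ`-classes of rank `n - 2`. -/
def familyR (n : ℕ) : Set (Set (jonesMonoid n)) := {M | ∃ R ∈ rClasses (rankSet n (n - 2)), M = Rᶜ}

end JonesMonoid

/-! Write `e i j` for `hooks n i j`, with `0 ≤ i, j < n - 1`. The elements of rank `n - 2` are
exactly these, and together with the identity they generate the Jones monoid: any planar Brauer
partition other than the identity has an upper and a lower hook (planarity makes an innermost arc
join neighbours), and these two hooks can be moved to the left end and opened into two vertical
strands, which exhibits the element as `e i 0 * γ * e 0 l` with `γ` of larger rank
(`exists_eq_hooks_mul`). Moreover `e i j * e k l = e i l` when `|j - k| ≤ 1`, and otherwise the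
product has rank below `n - 2` (`hooks_mul_hooks`, `rank_hooks_mul_hooks_lt`). Elements of rank
below `n - 2` form an ideal.

These facts are collected in `IsHookSystem`, and the classification uses nothing else. The only unit
is `1`; the `ℒ`-classes in `J` are the columns (fixed `j`), the `ℛ`-classes the rows (fixed `i`),
and every intersection of a column with a row is a single element, a group exactly when `|i - j| ≤
1`. So `Δ` consists of two copies of `{0, …, n - 2}` with indices at distance at most one adjacent,
and a maximal independent set is a pair `(A, B)` in which each side consists of all the vertices
without neighbour in the other (`IsDual`). A maximal subsemigroup containing `1` that meets every
row and every column omits some `e i j`; the columns it meets in row `i` generate, under this Galois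
correspondence, a dual pair whose union of columns and rows contains it
(`IsHookSystem.isMaximalSubsemigroup_iff`).

For the count, put `m = n - 1`. Closed sets `A` correspond by complementation to unions of windows,
a window being an index with its neighbours. Splitting by whether the last index belongs to the
union gives a coupled Fibonacci recursion and `2 F_m` closed sets (`card_windows`,
`ncard_dual_dual`). Discarding the two that give bicomponents and adding `1 + m + m` for the other
types yields `2 F_{n-1} + 2n - 3`.

For the planar partition monoid, replace every boundary point of degree `m` by two consecutive
points. An arc of a planar Brauer partition encloses an even number of points, so it joins the
second copy of one point to the first copy of another; the arcs are thus a permutation `σ` of the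
original points. Identifying the copies (`contract`) turns the cycles of `σ` into blocks, and
planarity forces `σ` to be the cyclic successor within each block. Hence contraction is a bijection
onto the planar partitions (`contract_injective`, `isPlanar_contract`, `exists_contract_eq`). It is
multiplicative because left multiplication by a generator `e i i` can be checked directly: for even
`i` it detaches a point, for odd `i` it merges two neighbouring points (`contract_mul`). -/

namespace JonesMonoid
namespace PartitionMonoid

variable {n : ℕ}

/-! ### Products of Brauer partitions -/

theorem glued_left {α : PartitionMonoid n} (β : PartitionMonoid n) {x y : Fin n ⊕ Fin n}
    (h : α.rel x y) : glued α β (upper x) (upper y) :=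
  (le_sup_left : _ ≤ glued α β) (map_rel_of _ _ h)

theorem glued_right (α : PartitionMonoid n) {β : PartitionMonoid n} {x y : Fin n ⊕ Fin n}
    (h : β.rel x y) : glued α β (lower x) (lower y) :=
  (le_sup_right : _ ≤ glued α β) (map_rel_of _ _ h)

theorem glued_le {α β : PartitionMonoid n} {s : Setoid (ThreeRows n)}
    (h1 : ∀ x y, α.rel x y → s (upper x) (upper y))
    (h2 : ∀ x y, β.rel x y → s (lower x) (lower y)) : glued α β ≤ s :=
  sup_le (map_le h1) (map_le h2)

theorem IsBrauer.eq_or_eq {α : PartitionMonoid n} (hα : α.IsBrauer) {x y z : Fin n ⊕ Fin n}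
    (hy : α.rel x y) (hyx : y ≠ x) (hz : α.rel x z) : z = x ∨ z = y := by
  obtain ⟨w, -, -, hw⟩ := (isBrauer_iff α).1 hα x
  rcases hw y hy with rfl | rfl
  · exact absurd rfl hyx
  · exact hw z hz

theorem IsBrauer.eq_of_rel {α : PartitionMonoid n} (hα : α.IsBrauer) {x y z : Fin n ⊕ Fin n}
    (hy : α.rel x y) (hyx : y ≠ x) (hz : α.rel x z) (hzx : z ≠ x) : z = y :=
  (hα.eq_or_eq hy hyx hz).resolve_left hzx

/-- Equivalence relations all of whose classes have size two are comparable only if equal. Product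
identities thereby reduce to exhibiting paths in the glued diagram; nothing has to be shown
disconnected. -/
theorem IsBrauer.eq_of_le {α β : PartitionMonoid n} (hα : α.IsBrauer) (hβ : β.IsBrauer)
    (h : ∀ x y, x ≠ y → α.rel x y → β.rel x y) : α = β := by
  ext x y
  obtain ⟨z, hzx, hz, hu⟩ := (isBrauer_iff α).1 hα x
  constructor
  · intro hxy
    by_cases e : x = y
    · rw [e]
    · exact h x y e hxy
  · intro hxy
    rcases hβ.eq_or_eq (h x z hzx.symm hz) hzx hxy with rfl | rfl
    · exact α.rel.refl _
    · exact hz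

theorem mul_eq_of_glued {α β γ : PartitionMonoid n} (hα : α.IsBrauer) (hβ : β.IsBrauer)
    (hγ : γ.IsBrauer)
    (h : ∀ x y, x ≠ y → γ.rel x y → glued α β (outer x) (outer y)) : α * β = γ :=
  (hγ.eq_of_le (hα.mul hβ) h).symm

/-- It suffices to connect the points of each block from left to right. -/
theorem mul_eq_of_connected {α β γ : PartitionMonoid n} (hα : α.IsBrauer) (hβ : β.IsBrauer)
    (hγ : γ.IsBrauer)
    (htt : ∀ a b : Fin n, a < b → γ.rel (.inl a) (.inl b) → glued α β (.top a) (.top b))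
    (htb : ∀ a b : Fin n, γ.rel (.inl a) (.inr b) → glued α β (.top a) (.bot b))
    (hbb : ∀ a b : Fin n, a < b → γ.rel (.inr a) (.inr b) → glued α β (.bot a) (.bot b)) :
    α * β = γ := by
  refine mul_eq_of_glued hα hβ hγ ?_
  rintro (x | x) (y | y) hne h
  · rcases lt_trichotomy x y with h1 | h1 | h1
    · exact htt x y h1 h
    · exact absurd (by rw [h1]) hne
    · exact (glued α β).symm (htt y x h1 (γ.rel.symm h))
  · exact htb x y h
  · exact (glued α β).symm (htb y x (γ.rel.symm h))
  · rcases lt_trichotomy x y with h1 | h1 | h1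
    · exact hbb x y h1 h
    · exact absurd (by rw [h1]) hne
    · exact (glued α β).symm (hbb y x h1 (γ.rel.symm h))

/-! ### Domains, codomains and ranks -/

/-- The upper points lying in a transverse block. -/
def dom (α : PartitionMonoid n) : Set (Fin n) := {a | ∃ b, α.rel (.inl a) (.inr b)}

/-- The lower points lying in a transverse block. -/
def codom (α : PartitionMonoid n) : Set (Fin n) := {b | ∃ a, α.rel (.inl a) (.inr b)}

/-- A block of `α` inside the top row is untouched by the gluing, so it remains a block of the
product. -/
theorem dom_mul_subset (α β : PartitionMonoid n) : (α * β).dom ⊆ α.dom := by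
  rintro a ⟨b, hab⟩
  by_contra hcon
  -- The indicator of the block of `a`. It is constant on glued classes, because this block never
  -- reaches the middle row.
  let P : ThreeRows n → Prop
    | .top i => α.rel (.inl a) (.inl i)
    | _ => False
  have hle : glued α β ≤ Setoid.ker P := by
    refine glued_le ?_ ?_
    · have key : ∀ x y, α.rel x y → P (upper x) → P (upper y) := by
        rintro (x | x) (y | y) hxy hx
        · exact α.rel.trans hx hxy
        · exact hcon ⟨y, α.rel.trans hx hxy⟩
        · exact hx.elim
        · exact hx.elim
      exact fun x y hxy => propext ⟨key x y hxy, key y x (α.rel.symm hxy)⟩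
    · rintro (x | x) (y | y) - <;> rfl
  have h : P (.top a) = P (.bot b) := hle hab
  exact (h ▸ α.rel.refl (.inl a) : P (.bot b))

theorem codom_mul_subset (α β : PartitionMonoid n) : (α * β).codom ⊆ β.codom := by
  rintro b ⟨a, hab⟩
  by_contra hcon
  let P : ThreeRows n → Prop
    | .bot i => β.rel (.inr b) (.inr i)
    | _ => False
  have hle : glued α β ≤ Setoid.ker P := by
    refine glued_le ?_ ?_
    · rintro (x | x) (y | y) - <;> rfl
    · have key : ∀ x y, β.rel x y → P (lower x) → P (lower y) := by
        rintro (x | x) (y | y) hxy hx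
        · exact hx.elim
        · exact hx.elim
        · exact hcon ⟨y, β.rel.symm (β.rel.trans hx hxy)⟩
        · exact β.rel.trans hx hxy
      exact fun x y hxy => propext ⟨key x y hxy, key y x (β.rel.symm hxy)⟩
  have h : P (.top a) = P (.bot b) := hle hab
  exact (h.symm ▸ β.rel.refl (.inr b) : P (.top a))

theorem IsBrauer.rank_eq_dom {α : PartitionMonoid n} (hα : α.IsBrauer) :
    α.rank = α.dom.ncard := by
  symm
  refine Set.ncard_congr (fun a _ => {z | α.rel z (.inl a)}) ?_ ?_ ?_
  · rintro a ⟨b, hab⟩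
    exact ⟨Setoid.mem_classes _ _, ⟨a, α.rel.refl _⟩, b, α.rel.symm hab⟩
  · rintro a a' ⟨b, hab⟩ - h
    have h1 : α.rel (.inl a) (.inl a') := by
      have : (Sum.inl a : Fin n ⊕ Fin n) ∈ {z | α.rel z (.inl a)} := α.rel.refl _
      rw [h] at this
      exact this
    rcases hα.eq_or_eq hab (by simp) h1 with h2 | h2
    · exact (Sum.inl_injective h2).symm
    · simp at h2
  · rintro _ ⟨⟨x, rfl⟩, ⟨a, ha⟩, b, hb⟩
    refine ⟨a, ⟨b, α.rel.trans ha (α.rel.symm hb)⟩, ?_⟩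
    ext z
    exact ⟨fun h => α.rel.trans h ha, fun h => α.rel.trans h (α.rel.symm ha)⟩

theorem IsBrauer.rank_eq_codom {α : PartitionMonoid n} (hα : α.IsBrauer) :
    α.rank = α.codom.ncard := by
  symm
  refine Set.ncard_congr (fun a _ => {z | α.rel z (.inr a)}) ?_ ?_ ?_
  · rintro b ⟨a, hab⟩
    exact ⟨Setoid.mem_classes _ _, ⟨a, hab⟩, b, α.rel.refl _⟩
  · rintro b b' ⟨a, hab⟩ - h
    have h1 : α.rel (.inr b) (.inr b') := by
      have : (Sum.inr b : Fin n ⊕ Fin n) ∈ {z | α.rel z (.inr b)} := α.rel.refl _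
      rw [h] at this
      exact this
    rcases hα.eq_or_eq (α.rel.symm hab) (by simp) h1 with h2 | h2
    · exact (Sum.inr_injective h2).symm
    · simp at h2
  · rintro _ ⟨⟨x, rfl⟩, ⟨a, ha⟩, b, hb⟩
    refine ⟨b, ⟨a, α.rel.trans ha (α.rel.symm hb)⟩, ?_⟩
    ext z
    exact ⟨fun h => α.rel.trans h hb, fun h => α.rel.trans h (α.rel.symm hb)⟩

theorem IsBrauer.rank_mul_le_left {α β : PartitionMonoid n} (hα : α.IsBrauer) (hβ : β.IsBrauer) :
    (α * β).rank ≤ α.rank := by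
  rw [hα.rank_eq_dom, (hα.mul hβ).rank_eq_dom]
  exact Set.ncard_le_ncard (dom_mul_subset α β)

theorem IsBrauer.rank_mul_le_right {α β : PartitionMonoid n} (hα : α.IsBrauer) (hβ : β.IsBrauer) :
    (α * β).rank ≤ β.rank := by
  rw [hβ.rank_eq_codom, (hα.mul hβ).rank_eq_codom]
  exact Set.ncard_le_ncard (codom_mul_subset α β)

theorem IsBrauer.notMem_dom {α : PartitionMonoid n} (hα : α.IsBrauer) {a b : Fin n} (hab : a ≠ b)
    (h : α.rel (.inl a) (.inl b)) : a ∉ α.dom := by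
  rintro ⟨c, hc⟩
  have := hα.eq_of_rel h (by simpa using hab.symm) hc (by simp)
  simp at this

theorem IsBrauer.notMem_codom {α : PartitionMonoid n} (hα : α.IsBrauer) {a b : Fin n} (hab : a ≠ b)
    (h : α.rel (.inr a) (.inr b)) : a ∉ α.codom := by
  rintro ⟨c, hc⟩
  have := hα.eq_of_rel h (by simpa using hab.symm) (α.rel.symm hc) (by simp)
  simp at this

theorem rank_one : (1 : PartitionMonoid n).rank = n := by
  rw [isBrauer_one.rank_eq_dom]
  have : (1 : PartitionMonoid n).dom = Set.univ := by
    ext a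
    simp only [Set.mem_univ, iff_true]
    exact ⟨a, rfl⟩
  rw [this, Set.ncard_univ, Nat.card_fin]

/-! ### The elements with one upper hook and one lower hook -/

/-- The labels of the blocks of `hooks n i j`. -/
def hookLabel (i j : ℕ) : Fin n ⊕ Fin n → ℤ :=
  Sum.elim (fun a => if (a : ℕ) < i then (a : ℤ) else if (a : ℕ) ≤ i + 1 then -1 else (a : ℤ) - 2)
    (fun a => if (a : ℕ) < j then (a : ℤ) else if (a : ℕ) ≤ j + 1 then -2 else (a : ℤ) - 2)

/-- The planar partition with an upper hook at the points with indices `i, i + 1`, a lower hook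
at the points with indices `j, j + 1`, and all other blocks transverse. -/
def hooks (n i j : ℕ) : PartitionMonoid n := ⟨Setoid.ker (hookLabel i j)⟩

theorem hooks_rel_iff (i j : ℕ) (x y : Fin n ⊕ Fin n) :
    (hooks n i j).rel x y ↔ hookLabel i j x = hookLabel i j y := Iff.rfl

theorem isBrauer_hooks {i j : ℕ} (hi : i + 1 < n) (hj : j + 1 < n) : (hooks n i j).IsBrauer := by
  rw [isBrauer_iff]
  have key : ∀ (i j : ℕ), i + 1 < n → j + 1 < n → ∀ a : Fin n,
      (∃ b : Fin n, b ≠ a ∧ hookLabel i j (.inl a) = hookLabel i j (.inl b) ∧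
        ∀ z, hookLabel i j (.inl a) = hookLabel i j z → z = .inl a ∨ z = .inl b) ∨
      (∃ b : Fin n, hookLabel i j (.inl a) = hookLabel i j (.inr b) ∧
        ∀ z, hookLabel i j (.inl a) = hookLabel i j z → z = .inl a ∨ z = .inr b) := by
    intro i j hi hj a
    obtain ⟨a, ha⟩ := a
    by_cases h1 : a = i
    · refine Or.inl ⟨⟨i + 1, hi⟩, by simp [Fin.ext_iff]; omega, ?_, ?_⟩
      · simp only [hookLabel, Sum.elim_inl]; split_ifs <;> omega
      · rintro (⟨z, hz⟩ | ⟨z, hz⟩) h <;> simp only [hookLabel, Sum.elim_inl, Sum.elim_inr] at h <;>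
          simp only [Sum.inl.injEq, Fin.mk.injEq, reduceCtorEq, or_false] <;>
          split_ifs at h <;> omega
    by_cases h2 : a = i + 1
    · refine Or.inl ⟨⟨i, by omega⟩, by simp [Fin.ext_iff]; omega, ?_, ?_⟩
      · simp only [hookLabel, Sum.elim_inl]; split_ifs <;> omega
      · rintro (⟨z, hz⟩ | ⟨z, hz⟩) h <;> simp only [hookLabel, Sum.elim_inl, Sum.elim_inr] at h <;>
          simp only [Sum.inl.injEq, Fin.mk.injEq, reduceCtorEq, or_false] <;>
          split_ifs at h <;> omega
    right
    obtain ⟨b, hb, hab⟩ : ∃ b, ∃ hb : b < n,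
        hookLabel i j (.inl (⟨a, ha⟩ : Fin n)) = hookLabel i j (.inr ⟨b, hb⟩) := by
      -- The transverse blocks are numbered `0, …, n - 3` from the left, and `p` is the number of
      -- the one through `a`.
      have h3 : ∃ p : ℕ, p + 2 < n ∧ hookLabel i j (.inl (⟨a, ha⟩ : Fin n)) = p := by
        by_cases h : a < i
        · exact ⟨a, by omega, by simp [hookLabel, h]⟩
        · refine ⟨a - 2, by omega, ?_⟩
          simp only [hookLabel, Sum.elim_inl]; split_ifs <;> omega
      obtain ⟨p, hp, hap⟩ := h3
      by_cases h : p < j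
      · refine ⟨p, by omega, ?_⟩
        rw [hap]
        simp [hookLabel, h]
      · refine ⟨p + 2, by omega, ?_⟩
        rw [hap]
        simp only [hookLabel, Sum.elim_inr]; split_ifs <;> omega
    refine ⟨⟨b, hb⟩, hab, ?_⟩
    rintro (⟨z, hz⟩ | ⟨z, hz⟩) h <;> simp only [hookLabel, Sum.elim_inl, Sum.elim_inr] at h hab <;>
      simp only [Sum.inl.injEq, Sum.inr.injEq, Fin.mk.injEq, reduceCtorEq, or_false, false_or] <;>
      split_ifs at h hab <;> omega
  -- Exchanging the rows exchanges `i` and `j`; the lower points then follow from the upper ones.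
  have flip : ∀ (i j : ℕ) (x y : Fin n ⊕ Fin n),
      hookLabel i j x = hookLabel i j y ↔ hookLabel j i x.swap = hookLabel j i y.swap := by
    intro i j x y
    rcases x with x | x <;> rcases y with y | y <;>
      simp only [hookLabel, Sum.swap, Sum.elim_inl, Sum.elim_inr] <;> split_ifs <;>
      constructor <;> intro h <;> omega
  rintro (a | a)
  · rcases key i j hi hj a with ⟨b, h1, h2, h3⟩ | ⟨b, h2, h3⟩
    · exact ⟨.inl b, by simpa using h1, h2, h3⟩
    · exact ⟨.inr b, by simp, h2, h3⟩
  · rcases key j i hj hi a with ⟨b, h1, h2, h3⟩ | ⟨b, h2, h3⟩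
    · refine ⟨.inr b, by simpa using h1, (flip i j _ _).2 h2, fun z hz => ?_⟩
      rcases z with z | z <;> simpa using h3 _ ((flip i j _ _).1 hz)
    · refine ⟨.inl b, by simp, (flip i j _ _).2 h2, fun z hz => ?_⟩
      rcases z with z | z <;> simpa using h3 _ ((flip i j _ _).1 hz)

theorem isPlanar_hooks (i j : ℕ) : (hooks n i j).IsPlanar := by
  rintro (⟨a, ha⟩ | ⟨a, ha⟩) (⟨b, hb⟩ | ⟨b, hb⟩) (⟨x, hx⟩ | ⟨x, hx⟩) (⟨y, hy⟩ | ⟨y, hy⟩) h1 h2 h3 h4 h5 <;>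
    simp only [hooks_rel_iff, hookLabel, pos, Sum.elim_inl, Sum.elim_inr] at h1 h2 h3 h4 h5 ⊢ <;>
    omega

theorem hooks_rel_upper {i j : ℕ} {a b : Fin n} (ha : (a : ℕ) = i) (hb : (b : ℕ) = i + 1) :
    (hooks n i j).rel (.inl a) (.inl b) := by
  simp [hooks_rel_iff, hookLabel, ha, hb]

theorem hooks_rel_lower {i j : ℕ} {a b : Fin n} (ha : (a : ℕ) = j) (hb : (b : ℕ) = j + 1) :
    (hooks n i j).rel (.inr a) (.inr b) := by
  simp [hooks_rel_iff, hookLabel, ha, hb]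

theorem hooks_rel_upper_iff {i j : ℕ} {a b : Fin n} (hab : a < b) :
    (hooks n i j).rel (.inl a) (.inl b) ↔ (a : ℕ) = i ∧ (b : ℕ) = i + 1 := by
  rw [Fin.lt_def] at hab
  simp only [hooks_rel_iff, hookLabel, Sum.elim_inl]
  split_ifs <;> constructor <;> intro h <;> first | omega | exact h.elim

theorem hooks_rel_lower_iff {i j : ℕ} {a b : Fin n} (hab : a < b) :
    (hooks n i j).rel (.inr a) (.inr b) ↔ (a : ℕ) = j ∧ (b : ℕ) = j + 1 := by
  rw [Fin.lt_def] at hab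
  simp only [hooks_rel_iff, hookLabel, Sum.elim_inr]
  split_ifs <;> constructor <;> intro h <;> first | omega | exact h.elim

/-- The `p`-th transverse block from the left meets each row at `p`, shifted by two once the hook of
that row has been passed. -/
theorem hooks_rel_transverse_iff {i j : ℕ} {a b : Fin n} :
    (hooks n i j).rel (.inl a) (.inr b) ↔
      ∃ p : ℕ, ((a : ℕ) = if p < i then p else p + 2) ∧ (b : ℕ) = if p < j then p else p + 2 := by
  simp only [hooks_rel_iff, hookLabel, Sum.elim_inl, Sum.elim_inr]
  constructor
  · intro h
    by_cases h1 : (a : ℕ) < i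
    · refine ⟨a, by simp [h1], ?_⟩
      split_ifs at h ⊢ <;> omega
    · refine ⟨a - 2, ?_, ?_⟩ <;> split_ifs at h ⊢ <;> omega
  · rintro ⟨p, h1, h2⟩
    split_ifs at h1 h2 ⊢ <;> omega

/-- Strand `p` of the first factor arrives in the middle row at `p` or `p + 2`, and strand `p` of
the second leaves from `p` or `p + 2`. These places differ only for one strand when the two middle
hooks are offset by one. There the two overlapping hooks lead from one place to the other through `p
+ 1`. -/
theorem hooks_mul_hooks {i j k l : ℕ} (hi : i + 1 < n) (hj : j + 1 < n) (hk : k + 1 < n)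
    (hl : l + 1 < n) (hjk : j ≤ k + 1) (hkj : k ≤ j + 1) :
    hooks n i j * hooks n k l = hooks n i l := by
  refine mul_eq_of_connected (isBrauer_hooks hi hj) (isBrauer_hooks hk hl)
    (isBrauer_hooks hi hl) ?_ ?_ ?_
  · intro a b hab h
    rw [hooks_rel_upper_iff hab] at h
    exact glued_left (α := hooks n i j) _ (x := .inl a) (y := .inl b) (hooks_rel_upper h.1 h.2)
  · intro a b h
    rw [hooks_rel_transverse_iff] at h
    obtain ⟨p, ha, hb⟩ := h
    have hp : p + 2 < n := by split_ifs at ha hb <;> omega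
    set g := glued (hooks n i j) (hooks n k l) with hg
    have hleft : ∀ c : Fin n, (c : ℕ) = (if p < j then p else p + 2) → g (.top a) (.mid c) :=
      fun c hc => glued_left (α := hooks n i j) _ (x := .inl a) (y := .inr c)
        (hooks_rel_transverse_iff.2 ⟨p, ha, hc⟩)
    have hright : ∀ c : Fin n, (c : ℕ) = (if p < k then p else p + 2) → g (.mid c) (.bot b) :=
      fun c hc => glued_right _ (β := hooks n k l) (x := .inl c) (y := .inr b)
        (hooks_rel_transverse_iff.2 ⟨p, hc, hb⟩)
    have hmid1 : ∀ c d : Fin n, (c : ℕ) = j → (d : ℕ) = j + 1 → g (.mid c) (.mid d) :=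
      fun c d hc hd => glued_left (α := hooks n i j) _ (x := .inr c) (y := .inr d)
        (hooks_rel_lower hc hd)
    have hmid2 : ∀ c d : Fin n, (c : ℕ) = k → (d : ℕ) = k + 1 → g (.mid c) (.mid d) :=
      fun c d hc hd => glued_right _ (β := hooks n k l) (x := .inl c) (y := .inl d)
        (hooks_rel_upper hc hd)
    by_cases h1 : p < j ↔ p < k
    · have : (if p < j then p else p + 2) < n := by split_ifs <;> omega
      refine g.trans (hleft ⟨_, this⟩ rfl) (hright _ ?_)
      simp [h1]
    · by_cases h2 : p < j
      · have e : p = k ∧ j = k + 1 := by omega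
        refine g.trans (hleft ⟨p, by omega⟩ (by simp [h2])) (g.trans
          (hmid2 _ ⟨p + 1, by omega⟩ (by simp; omega) (by simp; omega)) (g.trans
          (hmid1 _ ⟨p + 2, by omega⟩ (by simp; omega) (by simp; omega)) (hright _ ?_)))
        simp only
        split_ifs <;> omega
      · have e : p = j ∧ k = j + 1 := by omega
        refine g.trans (hleft ⟨p + 2, by omega⟩ (by simp [h2])) (g.trans
          (g.symm (hmid2 ⟨p + 1, by omega⟩ _ (by simp; omega) (by simp; omega))) (g.trans
          (g.symm (hmid1 ⟨p, by omega⟩ _ (by simp; omega) (by simp; omega))) (hright _ ?_)))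
        simp only
        split_ifs <;> omega
  · intro a b hab h
    rw [hooks_rel_lower_iff hab] at h
    exact glued_right _ (β := hooks n k l) (x := .inr a) (y := .inr b) (hooks_rel_lower h.1 h.2)

theorem dom_hooks {i j : ℕ} (hi : i + 1 < n) (hj : j + 1 < n) :
    (hooks n i j).dom = {⟨i, by omega⟩, ⟨i + 1, hi⟩}ᶜ := by
  ext a
  simp only [dom, hooks_rel_transverse_iff, Set.mem_ofPred_eq, Set.mem_compl_iff,
    Set.mem_insert_iff, Set.mem_singleton_iff, Fin.ext_iff]
  have ha := a.2
  constructor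
  · rintro ⟨b, p, h1, h2⟩
    split_ifs at h1 <;> omega
  · intro h
    by_cases h1 : (a : ℕ) < i
    · refine ⟨⟨if (a : ℕ) < j then a else a + 2, by split_ifs <;> omega⟩, a, by simp [h1], rfl⟩
    · refine ⟨⟨if (a : ℕ) - 2 < j then a - 2 else a - 2 + 2, by split_ifs <;> omega⟩, a - 2, ?_, rfl⟩
      split_ifs <;> omega

theorem rank_hooks {i j : ℕ} (hi : i + 1 < n) (hj : j + 1 < n) : (hooks n i j).rank = n - 2 := by
  rw [(isBrauer_hooks hi hj).rank_eq_dom, dom_hooks hi hj, Set.ncard_compl, Set.ncard_pair,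
    Nat.card_fin]
  simp [Fin.ext_iff]

/-- If the two middle hooks are disjoint, the points `k, k + 1` are ends of two consecutive strands
`p, p + 1` of the first factor. The hook at `k` joins these strands, so their upper ends leave the
domain. -/
theorem rank_hooks_mul_hooks_lt {i j k l : ℕ} (hi : i + 1 < n) (hj : j + 1 < n) (hk : k + 1 < n)
    (hl : l + 1 < n) (hjk : ¬ (j ≤ k + 1 ∧ k ≤ j + 1)) :
    (hooks n i j * hooks n k l).rank < n - 2 := by
  have hB := (isBrauer_hooks hi hj).mul (isBrauer_hooks hk hl)
  obtain ⟨p, hpn, hpk, hp⟩ : ∃ p, p + 3 < n ∧ k = (if p < j then p else p + 2) ∧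
      k + 1 = (if p + 1 < j then p + 1 else p + 1 + 2) := by
    by_cases h : k < j
    · exact ⟨k, by omega, by split_ifs <;> omega, by split_ifs <;> omega⟩
    · exact ⟨k - 2, by omega, by split_ifs <;> omega, by split_ifs <;> omega⟩
  have hx : (if p < i then p else p + 2) < n := by split_ifs <;> omega
  have hy : (if p + 1 < i then p + 1 else p + 1 + 2) < n := by split_ifs <;> omega
  have hrel : (hooks n i j * hooks n k l).rel (.inl ⟨_, hx⟩) (.inl ⟨_, hy⟩) := by
    set g := glued (hooks n i j) (hooks n k l) with hg
    refine g.trans (b := .mid ⟨k, by omega⟩) ?_ (g.trans (b := .mid ⟨k + 1, hk⟩) ?_ ?_)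
    · exact glued_left (α := hooks n i j) _ (x := .inl _) (y := .inr ⟨k, _⟩)
        (hooks_rel_transverse_iff.2 ⟨p, rfl, hpk⟩)
    · exact glued_right _ (β := hooks n k l) (x := .inl ⟨k, by omega⟩) (y := .inl ⟨k + 1, hk⟩)
        (hooks_rel_upper rfl rfl)
    · exact glued_left (α := hooks n i j) _ (x := .inr ⟨k + 1, _⟩) (y := .inl _)
        ((hooks n i j).rel.symm (hooks_rel_transverse_iff.2 ⟨p + 1, rfl, hp⟩))
  have hne : (⟨_, hx⟩ : Fin n) ≠ ⟨_, hy⟩ := by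
    rw [Ne, Fin.ext_iff]
    simp only
    split_ifs <;> omega
  rw [hB.rank_eq_dom, ← rank_hooks hi hj, (isBrauer_hooks hi hj).rank_eq_dom]
  refine Set.ncard_lt_ncard ⟨dom_mul_subset _ _, fun h => ?_⟩
  refine hB.notMem_dom hne hrel (h ?_)
  rw [dom_hooks hi hj]
  simp only [Set.mem_compl_iff, Set.mem_insert_iff, Set.mem_singleton_iff, Fin.ext_iff]
  split_ifs <;> omega

end PartitionMonoid
end JonesMonoid

/-! ### Generation of the Jones monoid by its elements of rank `n - 2` -/

namespace JonesMonoid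
namespace PartitionMonoid

variable {n : ℕ}

/-! ### Hooks in planar Brauer partitions -/

/-- By planarity the partner of `a + 1` is trapped under the arc from `a` to `b`, which gives a
shorter arc; the descent ends at an arc joining neighbours. -/
theorem exists_upper_hook {α : PartitionMonoid n} (hα : α.IsBrauer) (hp : α.IsPlanar) {a b : Fin n}
    (hab : a < b) (h : α.rel (.inl a) (.inl b)) :
    ∃ i, ∃ hi : i + 1 < n, α.rel (.inl ⟨i, by omega⟩) (.inl ⟨i + 1, hi⟩) := by
  induction hd : (b : ℕ) - a using Nat.strong_induction_on generalizing a b with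
  | _ d ih =>
  subst hd
  obtain ⟨a, ha⟩ := a
  obtain ⟨b, hb⟩ := b
  rw [Fin.lt_def] at hab
  simp only at hab ih
  by_cases hb1 : b = a + 1
  · subst hb1
    exact ⟨a, hb, h⟩
  have hc : a + 1 < n := by omega
  obtain ⟨y, hyc, hy, -⟩ := (isBrauer_iff α).1 hα (.inl ⟨a + 1, hc⟩)
  have hnot : ¬ α.rel (.inl ⟨a, ha⟩) (.inl ⟨a + 1, hc⟩) := by
    intro k
    have := hα.eq_of_rel h (by simp [Fin.ext_iff]; omega) k (by simp [Fin.ext_iff])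
    simp [Fin.ext_iff] at this
    omega
  have hya : ¬ α.rel (.inl ⟨a, ha⟩) y := fun k => hnot (α.rel.trans k (α.rel.symm hy))
  rcases y with ⟨y, hyn⟩ | ⟨y, hyn⟩
  · have h1 : a < y := by
      rcases lt_trichotomy y a with k | k | k
      · refine absurd (hp (.inl ⟨y, hyn⟩) (.inl ⟨a + 1, hc⟩) (.inl ⟨a, ha⟩) (.inl ⟨b, hb⟩)
          (α.rel.symm hy) h ?_ ?_ ?_) (fun k => hya (α.rel.symm k)) <;> simp [pos] <;> omega
      · subst k; exact absurd (α.rel.refl _) hya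
      · exact k
    have h2 : y < b := by
      rcases lt_trichotomy y b with k | k | k
      · exact k
      · subst k; exact absurd h hya
      · refine absurd (hp (.inl ⟨a, ha⟩) (.inl ⟨b, hb⟩) (.inl ⟨a + 1, hc⟩) (.inl ⟨y, hyn⟩)
          h hy ?_ ?_ ?_) hnot <;> simp [pos] <;> omega
    have h3 : y ≠ a + 1 := fun k => hyc (by simp [k])
    refine ih (y - (a + 1)) (by omega) (a := ⟨a + 1, hc⟩) (b := ⟨y, hyn⟩) ?_ hy rfl
    rw [Fin.lt_def]
    simp only
    omega
  · refine absurd (hp (.inr ⟨y, hyn⟩) (.inl ⟨a + 1, hc⟩) (.inl ⟨a, ha⟩) (.inl ⟨b, hb⟩)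
      (α.rel.symm hy) h ?_ ?_ ?_) (fun k => hya (α.rel.symm k)) <;> simp [pos] <;> omega

theorem exists_lower_hook {α : PartitionMonoid n} (hα : α.IsBrauer) (hp : α.IsPlanar) {a b : Fin n}
    (hab : a < b) (h : α.rel (.inr a) (.inr b)) :
    ∃ i, ∃ hi : i + 1 < n, α.rel (.inr ⟨i, by omega⟩) (.inr ⟨i + 1, hi⟩) := by
  induction hd : (b : ℕ) - a using Nat.strong_induction_on generalizing a b with
  | _ d ih =>
  subst hd
  obtain ⟨a, ha⟩ := a
  obtain ⟨b, hb⟩ := b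
  rw [Fin.lt_def] at hab
  simp only at hab ih
  by_cases hb1 : b = a + 1
  · subst hb1
    exact ⟨a, hb, h⟩
  have hc : a + 1 < n := by omega
  obtain ⟨y, hyc, hy, -⟩ := (isBrauer_iff α).1 hα (.inr ⟨a + 1, hc⟩)
  have hnot : ¬ α.rel (.inr ⟨a, ha⟩) (.inr ⟨a + 1, hc⟩) := by
    intro k
    have := hα.eq_of_rel h (by simp [Fin.ext_iff]; omega) k (by simp [Fin.ext_iff])
    simp [Fin.ext_iff] at this
    omega
  have hya : ¬ α.rel (.inr ⟨a, ha⟩) y := fun k => hnot (α.rel.trans k (α.rel.symm hy))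
  have hyb : ¬ α.rel (.inr ⟨b, hb⟩) y := fun k => hya (α.rel.trans h k)
  rcases y with ⟨y, hyn⟩ | ⟨y, hyn⟩
  · refine absurd (hp (.inr ⟨b, hb⟩) (.inr ⟨a, ha⟩) (.inr ⟨a + 1, hc⟩) (.inl ⟨y, hyn⟩)
      (α.rel.symm h) hy ?_ ?_ ?_) (fun k => hyb (α.rel.trans k hy)) <;> simp [pos] <;> omega
  · have h1 : a < y := by
      rcases lt_trichotomy y a with k | k | k
      · refine absurd (hp (.inr ⟨b, hb⟩) (.inr ⟨a, ha⟩) (.inr ⟨a + 1, hc⟩) (.inr ⟨y, hyn⟩)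
          (α.rel.symm h) hy ?_ ?_ ?_) (fun k => hyb (α.rel.trans k hy)) <;> simp [pos] <;> omega
      · subst k; exact absurd (α.rel.refl _) hya
      · exact k
    have h2 : y < b := by
      rcases lt_trichotomy y b with k | k | k
      · exact k
      · subst k; exact absurd h hya
      · refine absurd (hp (.inr ⟨y, hyn⟩) (.inr ⟨a + 1, hc⟩) (.inr ⟨b, hb⟩) (.inr ⟨a, ha⟩)
          (α.rel.symm hy) (α.rel.symm h) ?_ ?_ ?_) (fun k => hyb (α.rel.symm k)) <;>
          simp [pos] <;> omega
    have h3 : y ≠ a + 1 := fun k => hyc (by simp [k])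
    refine ih (y - (a + 1)) (by omega) (a := ⟨a + 1, hc⟩) (b := ⟨y, hyn⟩) ?_ hy rfl
    rw [Fin.lt_def]
    simp only
    omega

/-- The strands define a self-map of `Fin n`, strictly increasing because strands do not cross, and
the identity is the only such map. -/
theorem eq_one_of_dom_eq_univ {α : PartitionMonoid n} (hα : α.IsBrauer) (hp : α.IsPlanar)
    (h : α.dom = Set.univ) : α = 1 := by
  have h' : ∀ a, ∃ b, α.rel (.inl a) (.inr b) := fun a => by
    have : a ∈ α.dom := by rw [h]; trivial
    exact this
  choose f hf using h'
  have hmono : StrictMono f := by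
    intro a b hab
    have hnot : ¬ α.rel (.inl a) (.inl b) := by
      intro k
      have := hα.eq_of_rel (hf a) (by simp) k (by simp [hab.ne'])
      simp at this
    rcases lt_trichotomy (f a) (f b) with k | k | k
    · exact k
    · exact absurd (α.rel.trans (hf a) (k ▸ α.rel.symm (hf b))) hnot
    · refine absurd (hp (.inr (f a)) (.inl a) (.inr (f b)) (.inl b) (α.rel.symm (hf a))
        (α.rel.symm (hf b)) ?_ ?_ ?_)
        (fun k => hnot (α.rel.trans (hf a) (α.rel.trans k (α.rel.symm (hf b))))) <;>
        rw [Fin.lt_def] at hab k <;> simp [pos] <;> omega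
  have hid : f = id := hmono.eq_id
  subst hid
  symm
  refine isBrauer_one.eq_of_le hα ?_
  rintro (x | x) (y | y) hne hxy <;>
    simp only [one_rel_iff, Sum.elim_inl, Sum.elim_inr, id] at hxy <;> subst hxy
  · exact absurd rfl hne
  · exact hf x
  · exact α.rel.symm (hf x)
  · exact absurd rfl hne

theorem exists_upper_hook_of_ne_one {α : PartitionMonoid n} (hα : α.IsBrauer) (hp : α.IsPlanar)
    (h : α ≠ 1) : ∃ i, ∃ hi : i + 1 < n, α.rel (.inl ⟨i, by omega⟩) (.inl ⟨i + 1, hi⟩) := by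
  obtain ⟨a, ha⟩ := (Set.ne_univ_iff_exists_notMem _).1
    (fun k => h (eq_one_of_dom_eq_univ hα hp k))
  obtain ⟨b | b, hne, hab, -⟩ := (isBrauer_iff α).1 hα (.inl a)
  · rcases lt_or_gt_of_ne (show b ≠ a from fun k => hne (by rw [k])) with k | k
    · exact exists_upper_hook hα hp k (α.rel.symm hab)
    · exact exists_upper_hook hα hp k hab
  · exact absurd ⟨b, hab⟩ ha

theorem exists_lower_hook_of_ne_one {α : PartitionMonoid n} (hα : α.IsBrauer) (hp : α.IsPlanar)
    (h : α ≠ 1) : ∃ i, ∃ hi : i + 1 < n, α.rel (.inr ⟨i, by omega⟩) (.inr ⟨i + 1, hi⟩) := by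
  -- Domain and codomain both have the rank as cardinality, so a full codomain forces a full domain.
  have hne : α.codom ≠ Set.univ := by
    intro k
    refine h (eq_one_of_dom_eq_univ hα hp (Set.eq_of_subset_of_ncard_le (Set.subset_univ _) ?_))
    rw [← k, ← hα.rank_eq_codom, hα.rank_eq_dom]
  obtain ⟨a, ha⟩ := (Set.ne_univ_iff_exists_notMem _).1 hne
  obtain ⟨b | b, hne, hab, -⟩ := (isBrauer_iff α).1 hα (.inr a)
  · exact absurd ⟨b, α.rel.symm hab⟩ ha
  · rcases lt_or_gt_of_ne (show b ≠ a from fun k => hne (by rw [k])) with k | k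
    · exact exists_lower_hook hα hp k (α.rel.symm hab)
    · exact exists_lower_hook hα hp k hab

theorem hooks_rel_self {i : ℕ} {a : Fin n} (h1 : (a : ℕ) ≠ i) (h2 : (a : ℕ) ≠ i + 1) :
    (hooks n i i).rel (.inl a) (.inr a) := by
  rw [hooks_rel_transverse_iff]
  by_cases h : (a : ℕ) < i
  · exact ⟨a, by simp [h], by simp [h]⟩
  · exact ⟨a - 2, by split_ifs <;> omega, by split_ifs <;> omega⟩

theorem IsBrauer.eq_iff_of_upper_hook {α : PartitionMonoid n} (hα : α.IsBrauer) {i : ℕ}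
    {hi : i + 1 < n} (h : α.rel (.inl ⟨i, by omega⟩) (.inl ⟨i + 1, hi⟩)) {a b : Fin n} (hab : a < b)
    (k : α.rel (.inl a) (.inl b)) :
    (a : ℕ) = i ∧ (b : ℕ) = i + 1 ∨
      ((a : ℕ) ≠ i ∧ (a : ℕ) ≠ i + 1) ∧ (b : ℕ) ≠ i ∧ (b : ℕ) ≠ i + 1 := by
  obtain ⟨a, ha⟩ := a
  obtain ⟨b, hb⟩ := b
  rw [Fin.lt_def] at hab
  simp only at hab ⊢
  have key : ∀ x, α.rel (.inl ⟨i, by omega⟩) (.inl x) → (x : ℕ) = i ∨ (x : ℕ) = i + 1 := by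
    intro x hx
    have := hα.eq_or_eq h (by simp [Fin.ext_iff]) hx
    simpa [Fin.ext_iff] using this
  by_cases h1 : a = i
  · subst h1; have := key _ k; simp only at this; omega
  by_cases h2 : a = i + 1
  · subst h2; have := key _ (α.rel.trans h k); simp only at this; omega
  by_cases h3 : b = i
  · subst h3; have := key _ (α.rel.symm k); simp only at this; omega
  by_cases h4 : b = i + 1
  · subst h4; have := key _ (α.rel.trans h (α.rel.symm k)); simp only at this; omega
  omega

theorem IsBrauer.eq_iff_of_lower_hook {α : PartitionMonoid n} (hα : α.IsBrauer) {i : ℕ}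
    {hi : i + 1 < n} (h : α.rel (.inr ⟨i, by omega⟩) (.inr ⟨i + 1, hi⟩)) {a b : Fin n} (hab : a < b)
    (k : α.rel (.inr a) (.inr b)) :
    (a : ℕ) = i ∧ (b : ℕ) = i + 1 ∨
      ((a : ℕ) ≠ i ∧ (a : ℕ) ≠ i + 1) ∧ (b : ℕ) ≠ i ∧ (b : ℕ) ≠ i + 1 := by
  obtain ⟨a, ha⟩ := a
  obtain ⟨b, hb⟩ := b
  rw [Fin.lt_def] at hab
  simp only at hab ⊢
  have key : ∀ x, α.rel (.inr ⟨i, by omega⟩) (.inr x) → (x : ℕ) = i ∨ (x : ℕ) = i + 1 := by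
    intro x hx
    have := hα.eq_or_eq h (by simp [Fin.ext_iff]) hx
    simpa [Fin.ext_iff] using this
  by_cases h1 : a = i
  · subst h1; have := key _ k; simp only at this; omega
  by_cases h2 : a = i + 1
  · subst h2; have := key _ (α.rel.trans h k); simp only at this; omega
  by_cases h3 : b = i
  · subst h3; have := key _ (α.rel.symm k); simp only at this; omega
  by_cases h4 : b = i + 1
  · subst h4; have := key _ (α.rel.trans h (α.rel.symm k)); simp only at this; omega
  omega

theorem IsBrauer.ne_of_mem_dom {α : PartitionMonoid n} (hα : α.IsBrauer) {i : ℕ}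
    {hi : i + 1 < n} (h : α.rel (.inl ⟨i, by omega⟩) (.inl ⟨i + 1, hi⟩)) {a : Fin n}
    (k : a ∈ α.dom) : (a : ℕ) ≠ i ∧ (a : ℕ) ≠ i + 1 := by
  constructor
  · rintro rfl
    exact hα.notMem_dom (by simp [Fin.ext_iff]) h k
  · intro e
    have ha : a = ⟨i + 1, hi⟩ := Fin.ext e
    subst ha
    exact hα.notMem_dom (by simp [Fin.ext_iff]) (α.rel.symm h) k

theorem IsBrauer.ne_of_mem_codom {α : PartitionMonoid n} (hα : α.IsBrauer) {i : ℕ}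
    {hi : i + 1 < n} (h : α.rel (.inr ⟨i, by omega⟩) (.inr ⟨i + 1, hi⟩)) {a : Fin n}
    (k : a ∈ α.codom) : (a : ℕ) ≠ i ∧ (a : ℕ) ≠ i + 1 := by
  constructor
  · rintro rfl
    exact hα.notMem_codom (by simp [Fin.ext_iff]) h k
  · intro e
    have ha : a = ⟨i + 1, hi⟩ := Fin.ext e
    subst ha
    exact hα.notMem_codom (by simp [Fin.ext_iff]) (α.rel.symm h) k

/-- Away from its hooks `hooks n i i` is vertical, so it can change `α` only at `i, i + 1`, where
the hook is already present. -/
theorem hooks_mul_eq_self {α : PartitionMonoid n} (hα : α.IsBrauer) {i : ℕ}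
    {hi : i + 1 < n} (h : α.rel (.inl ⟨i, by omega⟩) (.inl ⟨i + 1, hi⟩)) :
    hooks n i i * α = α := by
  refine mul_eq_of_connected (isBrauer_hooks hi hi) hα hα ?_ ?_ ?_
  · intro a b hab k
    rcases hα.eq_iff_of_upper_hook h hab k with ⟨h1, h2⟩ | ⟨⟨h1, h2⟩, h3, h4⟩
    · exact glued_left (α := hooks n i i) _ (x := .inl a) (y := .inl b) (hooks_rel_upper h1 h2)
    · exact (glued _ _).trans
        (glued_left (α := hooks n i i) _ (x := .inl a) (y := .inr a) (hooks_rel_self h1 h2))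
        ((glued _ _).trans (glued_right _ k)
        ((glued _ _).symm (glued_left (α := hooks n i i) _ (x := .inl b) (y := .inr b)
          (hooks_rel_self h3 h4))))
  · intro a b k
    have hh := hα.ne_of_mem_dom h ⟨b, k⟩
    exact (glued _ _).trans (glued_left (α := hooks n i i) _ (x := .inl a) (y := .inr a)
      (hooks_rel_self hh.1 hh.2)) (glued_right _ k)
  · intro a b _ k
    exact glued_right _ k

theorem mul_hooks_eq_self {α : PartitionMonoid n} (hα : α.IsBrauer) {i : ℕ}
    {hi : i + 1 < n} (h : α.rel (.inr ⟨i, by omega⟩) (.inr ⟨i + 1, hi⟩)) :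
    α * hooks n i i = α := by
  refine mul_eq_of_connected hα (isBrauer_hooks hi hi) hα ?_ ?_ ?_
  · intro a b _ k
    exact glued_left _ k
  · intro a b k
    have hh := hα.ne_of_mem_codom h ⟨a, k⟩
    exact (glued _ _).trans (glued_left _ k) (glued_right _ (β := hooks n i i) (x := .inl b)
      (y := .inr b) (hooks_rel_self hh.1 hh.2))
  · intro a b hab k
    rcases hα.eq_iff_of_lower_hook h hab k with ⟨h1, h2⟩ | ⟨⟨h1, h2⟩, h3, h4⟩
    · exact glued_right _ (β := hooks n i i) (x := .inr a) (y := .inr b) (hooks_rel_lower h1 h2)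
    · exact (glued _ _).trans ((glued _ _).symm
        (glued_right _ (β := hooks n i i) (x := .inl a) (y := .inr a) (hooks_rel_self h1 h2)))
        ((glued _ _).trans (glued_left _ k)
        (glued_right _ (β := hooks n i i) (x := .inl b) (y := .inr b) (hooks_rel_self h3 h4)))

/-! ### Opening the leftmost hooks -/

/-- The index of a point in its row. -/
def index : Fin n ⊕ Fin n → ℕ := Sum.elim Fin.val Fin.val

/-- Replace the blocks on the four leftmost points by two vertical blocks. -/
def openHooks (β : PartitionMonoid n) : PartitionMonoid n where
  rel :=
    { r := fun x y => (2 ≤ index x ∧ 2 ≤ index y ∧ β.rel x y) ∨ (index x < 2 ∧ index x = index y)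
      iseqv :=
        { refl := fun x => by
            by_cases h : 2 ≤ index x
            · exact Or.inl ⟨h, h, β.rel.refl x⟩
            · exact Or.inr ⟨by omega, rfl⟩
          symm := by
            rintro x y (⟨h1, h2, h3⟩ | ⟨h1, h2⟩)
            · exact Or.inl ⟨h2, h1, β.rel.symm h3⟩
            · exact Or.inr ⟨by omega, h2.symm⟩
          trans := by
            rintro x y z (⟨h1, h2, h3⟩ | ⟨h1, h2⟩) (⟨h4, h5, h6⟩ | ⟨h4, h5⟩)
            · exact Or.inl ⟨h1, h5, β.rel.trans h3 h6⟩
            · omega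
            · omega
            · exact Or.inr ⟨h1, h2.trans h5⟩ } }

theorem two_le_index {β : PartitionMonoid n} (hβ : β.IsBrauer) (h2 : 0 + 1 < n)
    (hu : β.rel (.inl ⟨0, by omega⟩) (.inl ⟨0 + 1, h2⟩))
    (hl : β.rel (.inr ⟨0, by omega⟩) (.inr ⟨0 + 1, h2⟩)) {x y : Fin n ⊕ Fin n} (hxy : β.rel x y)
    (hx : 2 ≤ index x) : 2 ≤ index y := by
  by_contra hcon
  have key : ∀ (c d : Fin n ⊕ Fin n), index c < 2 → index d < 2 → d ≠ c → β.rel c d → y = c →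
      False := by
    rintro c d hc hd hne hcd rfl
    rcases hβ.eq_or_eq hcd hne (β.rel.symm hxy) with rfl | rfl <;> omega
  have cases2 : ∀ a : Fin n, ¬ 2 ≤ (a : ℕ) → a = ⟨0, by omega⟩ ∨ a = ⟨0 + 1, h2⟩ := by
    intro a ha
    simp only [Fin.ext_iff]
    omega
  rcases y with y | y <;> simp only [index, Sum.elim_inl, Sum.elim_inr] at hcon <;>
    rcases cases2 y hcon with e | e
  · exact key _ _ (by simp [index]) (by simp [index]) (by simp) hu (by rw [e])
  · exact key _ _ (by simp [index]) (by simp [index]) (by simp) (β.rel.symm hu) (by rw [e])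
  · exact key _ _ (by simp [index]) (by simp [index]) (by simp) hl (by rw [e])
  · exact key _ _ (by simp [index]) (by simp [index]) (by simp) (β.rel.symm hl) (by rw [e])

theorem isBrauer_openHooks {β : PartitionMonoid n} (hβ : β.IsBrauer) (h2 : 0 + 1 < n)
    (hu : β.rel (.inl ⟨0, by omega⟩) (.inl ⟨0 + 1, h2⟩))
    (hl : β.rel (.inr ⟨0, by omega⟩) (.inr ⟨0 + 1, h2⟩)) : (openHooks β).IsBrauer := by
  rw [isBrauer_iff]
  intro x
  by_cases hx : 2 ≤ index x
  · obtain ⟨y, h1, h2', h3⟩ := (isBrauer_iff β).1 hβ x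
    refine ⟨y, h1, Or.inl ⟨hx, two_le_index hβ h2 hu hl h2' hx, h2'⟩, ?_⟩
    rintro z (h | h)
    · exact h3 z h.2.2
    · omega
  · have hidx : ∀ z, (openHooks β).rel x z → index z = index x := by
      rintro z (h | h) <;> omega
    rcases x with x | x
    · refine ⟨.inr x, by simp, Or.inr ⟨by omega, rfl⟩, ?_⟩
      rintro (z | z) hz <;> have := hidx _ hz <;> simp only [index, Sum.elim_inl, Sum.elim_inr] at this
      · exact Or.inl (by rw [Fin.ext this])
      · exact Or.inr (by rw [Fin.ext this])
    · refine ⟨.inl x, by simp, Or.inr ⟨by omega, rfl⟩, ?_⟩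
      rintro (z | z) hz <;> have := hidx _ hz <;> simp only [index, Sum.elim_inl, Sum.elim_inr] at this
      · exact Or.inr (by rw [Fin.ext this])
      · exact Or.inl (by rw [Fin.ext this])

/-- The four points with index below 2 are consecutive in the middle of the boundary order, and the
two vertical blocks on them are nested. -/
theorem isPlanar_openHooks {β : PartitionMonoid n} (hp : β.IsPlanar) : (openHooks β).IsPlanar := by
  rintro a b x y hab hxy h1 h2 h3
  have hidx : ∀ z : Fin n ⊕ Fin n, pos z = index z + 1 ∨ pos z = -(index z + 1 : ℤ) := by
    rintro (z | z) <;> simp [pos, index]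
  have ha := hidx a
  have hb := hidx b
  have hx := hidx x
  have hy := hidx y
  rcases hab with ⟨k1, k2, k3⟩ | ⟨k1, k2⟩ <;> rcases hxy with ⟨k4, k5, k6⟩ | ⟨k4, k5⟩
  · exact Or.inl ⟨k1, k4, hp a b x y k3 k6 h1 h2 h3⟩
  · omega
  · omega
  · omega

theorem hooks_mul_openHooks {β : PartitionMonoid n} (hβ : β.IsBrauer) (h2 : 0 + 1 < n)
    (hu : β.rel (.inl ⟨0, by omega⟩) (.inl ⟨0 + 1, h2⟩))
    (hl : β.rel (.inr ⟨0, by omega⟩) (.inr ⟨0 + 1, h2⟩)) : hooks n 0 0 * openHooks β = β := by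
  have hself : ∀ a : Fin n, 2 ≤ (a : ℕ) →
      glued (hooks n 0 0) (openHooks β) (.top a) (.mid a) := fun a ha =>
    glued_left (α := hooks n 0 0) _ (x := .inl a) (y := .inr a)
      (hooks_rel_self (by omega) (by omega))
  refine mul_eq_of_connected (isBrauer_hooks h2 h2) (isBrauer_openHooks hβ h2 hu hl) hβ ?_ ?_ ?_
  · intro a b hab k
    rcases hβ.eq_iff_of_upper_hook hu hab k with ⟨h1, h2⟩ | ⟨⟨h1, h2⟩, h3, h4⟩
    · exact glued_left (α := hooks n 0 0) _ (x := .inl a) (y := .inl b) (hooks_rel_upper h1 h2)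
    · refine (glued _ _).trans (hself a (by omega)) ((glued _ _).trans ?_
        ((glued _ _).symm (hself b (by omega))))
      exact glued_right _ (β := openHooks β) (x := .inl a) (y := .inl b)
        (Or.inl ⟨by simp [index]; omega, by simp [index]; omega, k⟩)
  · intro a b k
    have h3 := hβ.ne_of_mem_dom hu ⟨b, k⟩
    have h4 := hβ.ne_of_mem_codom hl ⟨a, k⟩
    refine (glued _ _).trans (hself a (by omega)) ?_
    exact glued_right _ (β := openHooks β) (x := .inl a) (y := .inr b)
        (Or.inl ⟨by simp [index]; omega, by simp [index]; omega, k⟩)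
  · intro a b hab k
    rcases hβ.eq_iff_of_lower_hook hl hab k with ⟨h1, h2⟩ | ⟨⟨h1, h2⟩, h3, h4⟩
    -- The lower hook of `β` is the lower hook of `hooks n 0 0` carried down along the two vertical
    -- blocks.
    · refine (glued _ _).trans ((glued _ _).symm ?_) ((glued _ _).trans (a := .mid a)
        (b := .mid b) ?_ ?_)
      · exact glued_right _ (β := openHooks β) (x := .inl a) (y := .inr a)
          (Or.inr ⟨by simp [index]; omega, rfl⟩)
      · exact glued_left (α := hooks n 0 0) _ (x := .inr a) (y := .inr b) (hooks_rel_lower h1 h2)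
      · exact glued_right _ (β := openHooks β) (x := .inl b) (y := .inr b)
          (Or.inr ⟨by simp [index]; omega, rfl⟩)
    · exact glued_right _ (β := openHooks β) (x := .inr a) (y := .inr b)
        (Or.inl ⟨by simp [index]; omega, by simp [index]; omega, k⟩)

theorem rank_lt_rank_openHooks {β : PartitionMonoid n} (hβ : β.IsBrauer) (h2 : 0 + 1 < n)
    (hu : β.rel (.inl ⟨0, by omega⟩) (.inl ⟨0 + 1, h2⟩))
    (hl : β.rel (.inr ⟨0, by omega⟩) (.inr ⟨0 + 1, h2⟩)) : β.rank < (openHooks β).rank := by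
  rw [hβ.rank_eq_dom, (isBrauer_openHooks hβ h2 hu hl).rank_eq_dom]
  refine Set.ncard_lt_ncard ⟨?_, fun h => ?_⟩
  · rintro a ⟨b, k⟩
    have h3 := hβ.ne_of_mem_dom hu ⟨b, k⟩
    have h4 := hβ.ne_of_mem_codom hl ⟨a, k⟩
    exact ⟨b, Or.inl ⟨by simp [index]; omega, by simp [index]; omega, k⟩⟩
  · refine hβ.notMem_dom (by simp [Fin.ext_iff]) hu (h ⟨⟨0, by omega⟩, ?_⟩)
    exact Or.inr ⟨by simp [index], rfl⟩

/-! ### Generation by the elements of rank `n - 2` -/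

/-- Multiplying by rank `n - 2` elements moves an upper hook at `i` and a lower hook at `l` to the
left end, reversibly. There both can be opened, which adds two strands. -/
theorem exists_eq_hooks_mul {α : PartitionMonoid n} (hα : α.IsBrauer) (hp : α.IsPlanar)
    (h : α ≠ 1) : ∃ i l, ∃ γ : PartitionMonoid n, i + 1 < n ∧ l + 1 < n ∧ γ.IsBrauer ∧ γ.IsPlanar ∧
      α.rank < γ.rank ∧ α = hooks n i 0 * γ * hooks n 0 l := by
  obtain ⟨i, hi, hu⟩ := exists_upper_hook_of_ne_one hα hp h
  obtain ⟨l, hl, hd⟩ := exists_lower_hook_of_ne_one hα hp h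
  have h0 : 0 + 1 < n := by omega
  set β := hooks n 0 i * α * hooks n l 0 with hβdef
  have hβ : β.IsBrauer := ((isBrauer_hooks h0 hi).mul hα).mul (isBrauer_hooks hl h0)
  have hβp : β.IsPlanar := ((isPlanar_hooks _ _).mul hp).mul (isPlanar_hooks _ _)
  have hβu : β.rel (.inl ⟨0, by omega⟩) (.inl ⟨0 + 1, h0⟩) := by
    rw [hβdef, mul_assoc]
    exact glued_left (α := hooks n 0 i) _ (x := .inl _) (y := .inl _) (hooks_rel_upper rfl rfl)
  have hβl : β.rel (.inr ⟨0, by omega⟩) (.inr ⟨0 + 1, h0⟩) :=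
    glued_right _ (β := hooks n l 0) (x := .inr _) (y := .inr _) (hooks_rel_lower rfl rfl)
  have hαβ : α = hooks n i 0 * β * hooks n 0 l := by
    have : hooks n i 0 * β * hooks n 0 l =
        (hooks n i 0 * hooks n 0 i) * α * (hooks n l 0 * hooks n 0 l) := by
      simp only [hβdef, mul_assoc]
    rw [this, hooks_mul_hooks hi h0 h0 hi (by omega) (by omega),
      hooks_mul_hooks hl h0 h0 hl (by omega) (by omega), hooks_mul_eq_self hα hu,
      mul_hooks_eq_self hα hd]
  refine ⟨i, l, openHooks β, hi, hl, isBrauer_openHooks hβ h0 hβu hβl, isPlanar_openHooks hβp,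
    ?_, ?_⟩
  · refine lt_of_le_of_lt ?_ (rank_lt_rank_openHooks hβ h0 hβu hβl)
    rw [hαβ]
    exact (((isBrauer_hooks hi h0).mul hβ).rank_mul_le_left (isBrauer_hooks h0 hl)).trans
      ((isBrauer_hooks hi h0).rank_mul_le_right hβ)
  -- `hooks n i 0` absorbs `hooks n 0 0` on its right, and that factor closes the opened hooks
  -- again.
  · have : hooks n i 0 * openHooks β = hooks n i 0 * β := by
      conv_rhs => rw [← hooks_mul_openHooks hβ h0 hβu hβl, ← mul_assoc,
        hooks_mul_hooks hi h0 h0 h0 (by omega) (by omega)]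
    rw [this, ← hαβ]

theorem IsBrauer.rank_le {α : PartitionMonoid n} (hα : α.IsBrauer) : α.rank ≤ n := by
  rw [hα.rank_eq_dom]
  simpa using Set.ncard_le_ncard (Set.subset_univ α.dom)

theorem rank_le_of_ne_one {α : PartitionMonoid n} (hα : α.IsBrauer) (hp : α.IsPlanar)
    (h : α ≠ 1) : α.rank ≤ n - 2 := by
  obtain ⟨i, l, γ, hi, hl, hγ, -, -, e⟩ := exists_eq_hooks_mul hα hp h
  have h0 : 0 + 1 < n := by omega
  rw [e, ← rank_hooks h0 hl]
  exact ((isBrauer_hooks hi h0).mul hγ).rank_mul_le_right (isBrauer_hooks h0 hl)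

/-- The inner factor `γ` has rank above `n - 2`, and only the identity has such a rank. -/
theorem exists_eq_hooks {α : PartitionMonoid n} (hα : α.IsBrauer) (hp : α.IsPlanar)
    (h : α ≠ 1) (hr : α.rank = n - 2) : ∃ i l, i + 1 < n ∧ l + 1 < n ∧ α = hooks n i l := by
  obtain ⟨i, l, γ, hi, hl, hγ, hγp, hlt, e⟩ := exists_eq_hooks_mul hα hp h
  have hγ1 : γ = 1 := by
    by_contra hne
    have := rank_le_of_ne_one hγ hγp hne
    omega
  refine ⟨i, l, hi, hl, ?_⟩
  rw [e, hγ1, mul_one, hooks_mul_hooks hi (by omega) (by omega) hl (by omega) (by omega)]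

/-- Generation by `1` and the hooks, by induction on the corank `n - α.rank`, which is smaller for
the inner factor of `exists_eq_hooks_mul`. -/
theorem jones_induction {P : PartitionMonoid n → Prop} (one : P 1)
    (hook : ∀ i j, i + 1 < n → j + 1 < n → P (hooks n i j))
    (mul : ∀ α β : PartitionMonoid n, α.IsBrauer → α.IsPlanar → β.IsBrauer → β.IsPlanar →
      P α → P β → P (α * β))
    {α : PartitionMonoid n} (hα : α.IsBrauer) (hp : α.IsPlanar) : P α := by
  induction hd : n - α.rank using Nat.strong_induction_on generalizing α with
  | _ d ih =>
  subst hd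
  by_cases h : α = 1
  · rw [h]; exact one
  obtain ⟨i, l, γ, hi, hl, hγ, hγp, hlt, e⟩ := exists_eq_hooks_mul hα hp h
  have h0 : 0 + 1 < n := by omega
  have hγP : P γ := ih (n - γ.rank) (by have := hγ.rank_le; omega) hγ hγp rfl
  rw [e]
  refine mul _ _ ((isBrauer_hooks hi h0).mul hγ) ((isPlanar_hooks _ _).mul hγp)
    (isBrauer_hooks h0 hl) (isPlanar_hooks _ _) ?_ (hook _ _ h0 hl)
  exact mul _ _ (isBrauer_hooks hi h0) (isPlanar_hooks _ _) hγ hγp (hook _ _ hi h0) hγP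

end PartitionMonoid
end JonesMonoid

/-! ### Abstract hook systems: classification of maximal subsemigroups, and the graph `Δ` -/

namespace JonesMonoid

/-! ### Monoids generated by a top `𝒥`-class that is a rectangle with adjacent indices -/

/-- Two indices that differ by at most one. -/
def Near {m : ℕ} (j k : Fin m) : Prop := (j : ℕ) ≤ k + 1 ∧ (k : ℕ) ≤ j + 1

theorem Near.refl {m : ℕ} (j : Fin m) : Near j j := ⟨by omega, by omega⟩

theorem Near.symm {m : ℕ} {j k : Fin m} (h : Near j k) : Near k j := ⟨h.2, h.1⟩

theorem exists_near_ne {m : ℕ} (hm : 2 ≤ m) (j k : Fin m) : ∃ l, l ≠ k ∧ Near j l := by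
  by_cases h : j = k
  · subst h
    by_cases h0 : (j : ℕ) = 0
    · exact ⟨⟨1, by omega⟩, by simp [Fin.ext_iff, h0], by simp [Near, h0]⟩
    · exact ⟨⟨j - 1, by omega⟩, by simp only [Ne, Fin.ext_iff]; omega, by
        simp only [Near]; omega⟩
  · exact ⟨j, h, Near.refl j⟩

section HookSystem

variable {S : Type*} [Monoid S] {m : ℕ}

/-- The elements `e i j` multiply like the elements of rank `n - 2` of a Jones monoid, and together
with `1` generate a monoid whose other elements form an ideal. -/
structure IsHookSystem (e : Fin m → Fin m → S) : Prop where
  inj : ∀ {i j k l}, e i j = e k l → i = k ∧ j = l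
  ne_one : ∀ i j, e i j ≠ 1
  mul_near : ∀ {i j k l}, Near j k → e i j * e k l = e i l
  mul_not_near : ∀ {i j k l}, ¬ Near j k → e i j * e k l ≠ 1 ∧ ∀ p q, e i j * e k l ≠ e p q
  low_mul : ∀ {x}, (x ≠ 1 ∧ ∀ p q, x ≠ e p q) → ∀ y, x * y ≠ 1 ∧ ∀ p q, x * y ≠ e p q
  mul_low : ∀ {x}, (x ≠ 1 ∧ ∀ p q, x ≠ e p q) → ∀ y, y * x ≠ 1 ∧ ∀ p q, y * x ≠ e p q
  gen : ∀ T : Subsemigroup S, 1 ∈ T → (∀ i j, e i j ∈ T) → T = ⊤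

/-- All the elements `e i j`. -/
def hookSet (e : Fin m → Fin m → S) : Set S := {x | ∃ i j, x = e i j}

/-- The elements with second index `j`. -/
def hookCol (e : Fin m → Fin m → S) (j : Fin m) : Set S := {x | ∃ i, x = e i j}

/-- The elements with first index `i`. -/
def hookRow (e : Fin m → Fin m → S) (i : Fin m) : Set S := {x | ∃ j, x = e i j}

/-- `A` and `B` are the two sides of a maximal independent set. -/
def IsDual (A B : Set (Fin m)) : Prop :=
  (∀ j, j ∈ A ↔ ∀ i ∈ B, ¬ Near j i) ∧ ∀ i, i ∈ B ↔ ∀ j ∈ A, ¬ Near j i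

/-- The union of the complement of `hookSet e`, the columns in `A` and the rows in `B`. -/
def hookUnion (e : Fin m → Fin m → S) (A B : Set (Fin m)) : Set S :=
  {x | ∀ i j, x = e i j → j ∈ A ∨ i ∈ B}

theorem IsDual.ne_univ {A B : Set (Fin m)} (hAB : IsDual A B)
    (hB : B.Nonempty) : A ≠ Set.univ := by
  rintro rfl
  obtain ⟨b, hb⟩ := hB
  exact (hAB.1 b).1 trivial b hb (Near.refl b)

theorem IsDual.symm {A B : Set (Fin m)} (hAB : IsDual A B) : IsDual B A :=
  ⟨fun i => (hAB.2 i).trans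
      ⟨fun k j hj hn => k j hj hn.symm, fun k j hj hn => k j hj hn.symm⟩,
    fun j => (hAB.1 j).trans
      ⟨fun k j hj hn => k j hj hn.symm, fun k j hj hn => k j hj hn.symm⟩⟩

theorem isMaximalSubsemigroup_of {M : Set S} (hmul : ∀ x ∈ M, ∀ y ∈ M, x * y ∈ M)
    (hne : M ≠ Set.univ)
    (hmax : ∀ T : Subsemigroup S, M ⊆ T → (∃ x ∈ T, x ∉ M) → T = ⊤) :
    IsMaximalSubsemigroup M := by
  refine ⟨⟨M, fun hx hy => hmul _ hx _ hy⟩, rfl, fun h => hne ?_, fun T hT => ?_⟩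
  · exact congrArg (fun T : Subsemigroup S => (T : Set S)) h
  · exact hmax T hT.le (Set.exists_of_ssubset hT)

/-- The form in which maximality is used: it suffices to trap `M` inside one of the listed proper
subsemigroups. -/
theorem IsMaximalSubsemigroup.eq_of_subset {M N : Set S} (hM : IsMaximalSubsemigroup M)
    (hmul : ∀ x ∈ N, ∀ y ∈ N, x * y ∈ N) (hne : N ≠ Set.univ) (h : M ⊆ N) : M = N := by
  obtain ⟨T, rfl, hT⟩ := hM
  have hle : T ≤ (⟨N, fun hx hy => hmul _ hx _ hy⟩ : Subsemigroup S) := h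
  rcases eq_or_lt_of_le hle with h1 | h1
  · exact congrArg (fun T : Subsemigroup S => (T : Set S)) h1
  · exact absurd (congrArg (fun T : Subsemigroup S => (T : Set S)) (hT.2 _ h1)) hne

theorem IsMaximalSubsemigroup.mul_mem {M : Set S} (hM : IsMaximalSubsemigroup M) {x y : S}
    (hx : x ∈ M) (hy : y ∈ M) : x * y ∈ M := by
  obtain ⟨T, rfl, hT⟩ := hM
  exact T.mul_mem hx hy

namespace IsHookSystem

variable {e : Fin m → Fin m → S} (h : IsHookSystem e)
include h

theorem mul_eq_one {x y : S} (hxy : x * y = 1) : x = 1 ∧ y = 1 := by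
  by_cases hx : x = 1
  · subst hx
    exact ⟨rfl, by simpa using hxy⟩
  exfalso
  by_cases hxe : ∃ i j, x = e i j
  · obtain ⟨i, j, rfl⟩ := hxe
    by_cases hy : y = 1
    · subst hy
      exact hx (by simpa using hxy)
    by_cases hye : ∃ k l, y = e k l
    · obtain ⟨k, l, rfl⟩ := hye
      by_cases hn : Near j k
      · rw [h.mul_near hn] at hxy
        exact h.ne_one _ _ hxy
      · exact (h.mul_not_near hn).1 hxy
    · push Not at hye
      exact (h.mul_low ⟨hy, hye⟩ _).1 hxy
  · push Not at hxe
    exact (h.low_mul ⟨hx, hxe⟩ _).1 hxy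

/-- The elements other than `1` and the hooks form an ideal, and hooks with non-near inner indices
multiply into it. So the only nontrivial factorisations of a hook are the evident ones; closure
under products and Green's classes are read off from this. -/
theorem mul_eq_hook {x y : S} {i j : Fin m} (hxy : x * y = e i j) :
    (x = e i j ∧ y = 1) ∨ (x = 1 ∧ y = e i j) ∨
      ∃ k l, Near k l ∧ x = e i k ∧ y = e l j := by
  by_cases hx : x = 1
  · subst hx
    exact Or.inr (Or.inl ⟨rfl, by simpa using hxy⟩)
  by_cases hxe : ∃ p q, x = e p q
  · obtain ⟨p, q, rfl⟩ := hxe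
    by_cases hy : y = 1
    · subst hy
      exact Or.inl ⟨by simpa using hxy, rfl⟩
    by_cases hye : ∃ k l, y = e k l
    · obtain ⟨k, l, rfl⟩ := hye
      by_cases hn : Near q k
      · rw [h.mul_near hn] at hxy
        obtain ⟨rfl, rfl⟩ := h.inj hxy
        exact Or.inr (Or.inr ⟨q, k, hn, rfl, rfl⟩)
      · exact absurd hxy ((h.mul_not_near hn).2 _ _)
    · push Not at hye
      exact absurd hxy ((h.mul_low ⟨hy, hye⟩ _).2 _ _)
  · push Not at hxe
    exact absurd hxy ((h.low_mul ⟨hx, hxe⟩ _).2 _ _)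

theorem isUnit_iff {x : S} : IsUnit x ↔ x = 1 := by
  constructor
  · rintro ⟨u, rfl⟩
    exact (h.mul_eq_one u.mul_inv).1
  · rintro rfl
    exact isUnit_one

theorem units_eq_one (u : Sˣ) : (u : S) = 1 := h.isUnit_iff.1 u.isUnit

/-! ### The maximal subsemigroups -/

theorem isMaximal_compl_one : IsMaximalSubsemigroup ({1}ᶜ : Set S) := by
  refine isMaximalSubsemigroup_of ?_ ?_ ?_
  · intro x hx y _ hxy
    exact hx (h.mul_eq_one hxy).1
  · exact fun k => (k ▸ Set.mem_univ (1 : S) : (1 : S) ∈ ({1}ᶜ : Set S)) rfl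
  · rintro T hT ⟨x, hxT, hx⟩
    have hx1 : x = 1 := by simpa using hx
    subst hx1
    exact h.gen T hxT fun i j => hT (h.ne_one i j)

theorem mul_mem_col_compl (j : Fin m) :
    ∀ x ∈ (hookCol e j)ᶜ, ∀ y ∈ (hookCol e j)ᶜ, x * y ∈ (hookCol e j)ᶜ := by
  rintro x hx y hy ⟨i, hxy⟩
  rcases h.mul_eq_hook hxy with ⟨rfl, -⟩ | ⟨-, rfl⟩ | ⟨k, l, -, -, rfl⟩
  · exact hx ⟨i, rfl⟩
  · exact hy ⟨i, rfl⟩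
  · exact hy ⟨l, rfl⟩

theorem mul_mem_row_compl (i : Fin m) :
    ∀ x ∈ (hookRow e i)ᶜ, ∀ y ∈ (hookRow e i)ᶜ, x * y ∈ (hookRow e i)ᶜ := by
  rintro x hx y hy ⟨j, hxy⟩
  rcases h.mul_eq_hook hxy with ⟨rfl, -⟩ | ⟨-, rfl⟩ | ⟨k, l, -, rfl, -⟩
  · exact hx ⟨j, rfl⟩
  · exact hy ⟨j, rfl⟩
  · exact hx ⟨k, rfl⟩

/-- If `e i k * e l j = e i j` with neither `i ∈ B` nor `j ∈ A`, then `k ∈ A` and `l ∈ B` are near,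
against independence. -/
theorem mul_mem_hookUnion {A B : Set (Fin m)} (hAB : IsDual A B) :
    ∀ x ∈ hookUnion e A B, ∀ y ∈ hookUnion e A B, x * y ∈ hookUnion e A B := by
  intro x hx y hy i j hxy
  rcases h.mul_eq_hook hxy with ⟨rfl, -⟩ | ⟨-, rfl⟩ | ⟨k, l, hn, rfl, rfl⟩
  · exact hx i j rfl
  · exact hy i j rfl
  · rcases hx i k rfl with h1 | h1
    · rcases hy l j rfl with h2 | h2
      · exact Or.inl h2
      · exact absurd hn ((hAB.1 k).1 h1 l h2)
    · exact Or.inr h1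

omit [Monoid S] h in
theorem col_compl_ne_univ (j : Fin m) : (hookCol e j)ᶜ ≠ Set.univ := by
  intro k
  exact (k ▸ Set.mem_univ (e j j) : e j j ∈ (hookCol e j)ᶜ) ⟨j, rfl⟩

omit [Monoid S] h in
theorem row_compl_ne_univ (i : Fin m) : (hookRow e i)ᶜ ≠ Set.univ := by
  intro k
  exact (k ▸ Set.mem_univ (e i i) : e i i ∈ (hookRow e i)ᶜ) ⟨i, rfl⟩

omit [Monoid S] h in
theorem hookUnion_ne_univ {A B : Set (Fin m)} (hAB : IsDual A B) (hA : A.Nonempty)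
    (hB : B.Nonempty) : hookUnion e A B ≠ Set.univ := by
  intro k
  obtain ⟨a, ha⟩ := hA
  obtain ⟨b, hb⟩ := hB
  rcases (k ▸ Set.mem_univ (e a b) : e a b ∈ hookUnion e A B) a b rfl with h1 | h1
  · exact (hAB.1 b).1 h1 b hb (Near.refl b)
  · exact (hAB.2 a).1 h1 a ha (Near.refl a)

/-- One element `e i j` of the missing column restores the whole column, as `e k q * e i j = e k j`
for `q ≠ j` near `i`. Such a `q` exists because there are at least two columns. -/
theorem isMaximal_col_compl (hm : 2 ≤ m) (j : Fin m) :
    IsMaximalSubsemigroup ((hookCol e j)ᶜ) := by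
  refine isMaximalSubsemigroup_of (h.mul_mem_col_compl j) (col_compl_ne_univ j) ?_
  rintro T hT ⟨x, hxT, hx⟩
  obtain ⟨i, rfl⟩ : x ∈ hookCol e j := by simpa using hx
  have hother : ∀ k l, l ≠ j → e k l ∈ T := by
    intro k l hl
    refine hT ?_
    rintro ⟨p, hp⟩
    exact hl (h.inj hp).2
  refine h.gen T (hT ?_) ?_
  · rintro ⟨p, hp⟩
    exact h.ne_one _ _ hp.symm
  · intro k l
    by_cases hl : l = j
    · subst hl
      obtain ⟨q, hq, hn⟩ := exists_near_ne hm i l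
      rw [← h.mul_near (i := k) (l := l) hn.symm]
      exact T.mul_mem (hother k q hq) hxT
    · exact hother k l hl

theorem isMaximal_row_compl (hm : 2 ≤ m) (i : Fin m) :
    IsMaximalSubsemigroup ((hookRow e i)ᶜ) := by
  refine isMaximalSubsemigroup_of (h.mul_mem_row_compl i) (row_compl_ne_univ i) ?_
  rintro T hT ⟨x, hxT, hx⟩
  obtain ⟨j, rfl⟩ : x ∈ hookRow e i := by simpa using hx
  have hother : ∀ k l, k ≠ i → e k l ∈ T := by
    intro k l hl
    refine hT ?_
    rintro ⟨p, hp⟩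
    exact hl (h.inj hp).1
  refine h.gen T (hT ?_) ?_
  · rintro ⟨p, hp⟩
    exact h.ne_one _ _ hp.symm
  · intro k l
    by_cases hl : k = i
    · subst hl
      obtain ⟨q, hq, hn⟩ := exists_near_ne hm j k
      rw [← h.mul_near (i := k) (l := l) hn]
      exact T.mul_mem hxT (hother q l hq)
    · exact hother k l hl

/-- For an element `e i j` outside, maximality of the independent set provides `a ∈ A` near `i` and
`b ∈ B` near `j`; then `e k a * e i j * e b l = e k l` produces every hook. -/
theorem isMaximal_hookUnion {A B : Set (Fin m)} (hAB : IsDual A B) (hA : A.Nonempty)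
    (hB : B.Nonempty) : IsMaximalSubsemigroup (hookUnion e A B) := by
  refine isMaximalSubsemigroup_of (h.mul_mem_hookUnion hAB) (hookUnion_ne_univ hAB hA hB) ?_
  rintro T hT ⟨x, hxT, hx⟩
  obtain ⟨i, j, rfl, hnot⟩ : ∃ i j, x = e i j ∧ ¬ (j ∈ A ∨ i ∈ B) := by
    simpa [hookUnion] using hx
  push Not at hnot
  obtain ⟨b, hb, hjb⟩ : ∃ b ∈ B, Near j b := by
    by_contra hcon
    push Not at hcon
    exact hnot.1 ((hAB.1 j).2 hcon)
  obtain ⟨a, ha, hai⟩ : ∃ a ∈ A, Near a i := by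
    by_contra hcon
    push Not at hcon
    exact hnot.2 ((hAB.2 i).2 hcon)
  refine h.gen T (hT fun p q hpq => absurd hpq.symm (h.ne_one p q)) fun k l => ?_
  have h1 : e k a ∈ T := hT fun p q hpq => Or.inl ((h.inj hpq).2 ▸ ha)
  have h2 : e b l ∈ T := hT fun p q hpq => Or.inr ((h.inj hpq).1 ▸ hb)
  have := T.mul_mem (T.mul_mem h1 hxT) h2
  rwa [h.mul_near hai, h.mul_near hjb] at this

theorem isMaximalSubsemigroup_iff (hm : 2 ≤ m) (M : Set S) :
    IsMaximalSubsemigroup M ↔ M = {1}ᶜ ∨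
      (∃ A B, IsDual A B ∧ A.Nonempty ∧ B.Nonempty ∧ M = hookUnion e A B) ∨
      (∃ j, M = (hookCol e j)ᶜ) ∨ ∃ i, M = (hookRow e i)ᶜ := by
  constructor
  · intro hM
    by_cases h1 : (1 : S) ∈ M
    swap
    · left
      refine hM.eq_of_subset ?_ ?_ ?_
      · intro x hx y _ hxy
        exact hx (h.mul_eq_one hxy).1
      · exact fun k => (k ▸ Set.mem_univ (1 : S) : (1 : S) ∈ ({1}ᶜ : Set S)) rfl
      · rintro x hx rfl
        exact h1 hx
    right
    by_cases hcol : ∃ j, ∀ i, e i j ∉ M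
    · obtain ⟨j, hj⟩ := hcol
      refine Or.inr (Or.inl ⟨j, hM.eq_of_subset (h.mul_mem_col_compl j)
        (col_compl_ne_univ j) ?_⟩)
      rintro _ hx ⟨i, rfl⟩
      exact hj i hx
    by_cases hrow : ∃ i, ∀ j, e i j ∉ M
    · obtain ⟨i, hi⟩ := hrow
      refine Or.inr (Or.inr ⟨i, hM.eq_of_subset (h.mul_mem_row_compl i)
        (row_compl_ne_univ i) ?_⟩)
      rintro _ hx ⟨j, rfl⟩
      exact hi j hx
    left
    push Not at hcol hrow
    obtain ⟨i, j, hij⟩ : ∃ i j, e i j ∉ M := by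
      by_contra hcon
      push Not at hcon
      obtain ⟨T, rfl, hT⟩ := hM
      exact hT.1 (h.gen T h1 hcon)
    -- If a row `k` is near some `a ∈ A₀`, then `e k l ∈ M` implies `e i l = e i a * e k l ∈ M`, so
    -- `l ∈ A₀`. Thus `M` meets the rows outside `B` only in columns of `A₀`, and passing to the
    -- closure `A` makes the pair dual.
    let A₀ : Set (Fin m) := {l | e i l ∈ M}
    let B : Set (Fin m) := {k | ∀ l ∈ A₀, ¬ Near l k}
    let A : Set (Fin m) := {l | ∀ k ∈ B, ¬ Near l k}
    have hA₀A : A₀ ⊆ A := fun l hl k hk => hk l hl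
    have hAB : IsDual A B :=
      ⟨fun _ => Iff.rfl, fun k => ⟨fun hk l hl => hl k hk, fun hk l hl => hk l (hA₀A hl)⟩⟩
    have hA : A.Nonempty := (hrow i).imp fun l hl => hA₀A hl
    -- The column `j` meets `M` in some row `k`; were `k` near an `l ∈ A₀`, the missing `e i j`
    -- would be a product of elements of `M`.
    have hB : B.Nonempty := by
      obtain ⟨k, hk⟩ := hcol j
      refine ⟨k, fun l hl hn => hij ?_⟩
      rw [← h.mul_near (i := i) (l := j) hn]
      exact hM.mul_mem hl hk
    refine ⟨A, B, hAB, hA, hB, hM.eq_of_subset (h.mul_mem_hookUnion hAB)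
      (hookUnion_ne_univ hAB hA hB) ?_⟩
    rintro _ hx k l rfl
    by_cases hk : k ∈ B
    · exact Or.inr hk
    left
    obtain ⟨a, ha, hn⟩ : ∃ a ∈ A₀, Near a k := by
      by_contra hcon
      push Not at hcon
      exact hk hcon
    refine hA₀A (show e i l ∈ M from ?_)
    rw [← h.mul_near (i := i) (l := l) hn]
    exact hM.mul_mem ha hx
  · rintro (rfl | ⟨A, B, hAB, hA, hB, rfl⟩ | ⟨j, rfl⟩ | ⟨i, rfl⟩)
    · exact h.isMaximal_compl_one
    · exact h.isMaximal_hookUnion hAB hA hB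
    · exact h.isMaximal_col_compl hm j
    · exact h.isMaximal_row_compl hm i

/-! ### Green's classes and the graph -/

theorem lClass_eq (i j : Fin m) : lClass (e i j) = hookCol e j := by
  ext x
  constructor
  · intro hx
    have hx' : (Set.range fun s : S => s * x) = Set.range fun s : S => s * e i j := hx
    have h1 : e i j ∈ Set.range fun s : S => s * x := by rw [hx']; exact ⟨1, one_mul _⟩
    obtain ⟨s, hs⟩ := h1
    rcases h.mul_eq_hook hs with ⟨-, rfl⟩ | ⟨-, rfl⟩ | ⟨k, l, -, -, rfl⟩
    -- The case `x = 1`: the left ideal of `e i j` would be everything, making `1` a multiple of `e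
    -- i j`.
    · have h2 : (1 : S) ∈ Set.range fun s : S => s * e i j := by rw [← hx']; exact ⟨1, one_mul _⟩
      obtain ⟨t, ht⟩ := h2
      exact absurd (h.mul_eq_one ht).2 (h.ne_one _ _)
    · exact ⟨i, rfl⟩
    · exact ⟨l, rfl⟩
  · rintro ⟨k, rfl⟩
    refine Set.Subset.antisymm ?_ ?_
    · rintro _ ⟨s, rfl⟩
      exact ⟨s * e k i, by simp only [mul_assoc, h.mul_near (Near.refl i)]⟩
    · rintro _ ⟨s, rfl⟩
      exact ⟨s * e i k, by simp only [mul_assoc, h.mul_near (Near.refl k)]⟩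

theorem rClass_eq (i j : Fin m) : rClass (e i j) = hookRow e i := by
  ext x
  constructor
  · intro hx
    have hx' : (Set.range fun s : S => x * s) = Set.range fun s : S => e i j * s := hx
    have h1 : e i j ∈ Set.range fun s : S => x * s := by rw [hx']; exact ⟨1, mul_one _⟩
    obtain ⟨s, hs⟩ := h1
    rcases h.mul_eq_hook hs with ⟨rfl, -⟩ | ⟨rfl, -⟩ | ⟨k, l, -, rfl, -⟩
    · exact ⟨j, rfl⟩
    · have h2 : (1 : S) ∈ Set.range fun s : S => e i j * s := by rw [← hx']; exact ⟨1, mul_one _⟩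
      obtain ⟨t, ht⟩ := h2
      exact absurd (h.mul_eq_one ht).1 (h.ne_one _ _)
    · exact ⟨k, rfl⟩
  · rintro ⟨k, rfl⟩
    refine Set.Subset.antisymm ?_ ?_
    · rintro _ ⟨s, rfl⟩
      exact ⟨e j k * s, by simp only [← mul_assoc, h.mul_near (Near.refl j)]⟩
    · rintro _ ⟨s, rfl⟩
      exact ⟨e k j * s, by simp only [← mul_assoc, h.mul_near (Near.refl k)]⟩

theorem mem_lClasses {L : Set S} : L ∈ lClasses (hookSet e) ↔ ∃ j, L = hookCol e j := by
  constructor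
  · rintro ⟨_, ⟨i, j, rfl⟩, rfl⟩
    exact ⟨j, h.lClass_eq i j⟩
  · rintro ⟨j, rfl⟩
    exact ⟨e j j, ⟨j, j, rfl⟩, (h.lClass_eq j j).symm⟩

theorem mem_rClasses {R : Set S} : R ∈ rClasses (hookSet e) ↔ ∃ i, R = hookRow e i := by
  constructor
  · rintro ⟨_, ⟨i, j, rfl⟩, rfl⟩
    exact ⟨i, h.rClass_eq i j⟩
  · rintro ⟨i, rfl⟩
    exact ⟨e i i, ⟨i, i, rfl⟩, (h.rClass_eq i i).symm⟩

/-- The group of units is trivial, so every orbit is a single class. -/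
theorem mem_lOrbits {O : Set (Set S)} : O ∈ lOrbits (hookSet e) ↔ ∃ j, O = {hookCol e j} := by
  have key : ∀ L : Set S, {L' | ∃ g : Sˣ, L' = (fun x => x * (g : S)) '' L} = {L} := by
    intro L
    ext L'
    simp only [Set.mem_ofPred_eq, Set.mem_singleton_iff]
    constructor
    · rintro ⟨g, rfl⟩
      simp [h.units_eq_one g]
    · rintro rfl
      exact ⟨1, by simp⟩
  simp only [lOrbits, key, Set.mem_ofPred_eq, h.mem_lClasses]
  constructor
  · rintro ⟨_, ⟨j, rfl⟩, rfl⟩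
    exact ⟨j, rfl⟩
  · rintro ⟨j, rfl⟩
    exact ⟨_, ⟨j, rfl⟩, rfl⟩

theorem mem_rOrbits {O : Set (Set S)} : O ∈ rOrbits (hookSet e) ↔ ∃ i, O = {hookRow e i} := by
  have key : ∀ R : Set S, {R' | ∃ g : Sˣ, R' = (fun x => (g : S) * x) '' R} = {R} := by
    intro R
    ext R'
    simp only [Set.mem_ofPred_eq, Set.mem_singleton_iff]
    constructor
    · rintro ⟨g, rfl⟩
      simp [h.units_eq_one g]
    · rintro rfl
      exact ⟨1, by simp⟩
  simp only [rOrbits, key, Set.mem_ofPred_eq, h.mem_rClasses]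
  constructor
  · rintro ⟨_, ⟨j, rfl⟩, rfl⟩
    exact ⟨j, rfl⟩
  · rintro ⟨j, rfl⟩
    exact ⟨_, ⟨j, rfl⟩, rfl⟩

/-- The vertex of the graph given by the column `j`. -/
def colVertex (j : Fin m) : lOrbits (hookSet e) := ⟨{hookCol e j}, h.mem_lOrbits.2 ⟨j, rfl⟩⟩

/-- The vertex of the graph given by the row `i`. -/
def rowVertex (i : Fin m) : rOrbits (hookSet e) := ⟨{hookRow e i}, h.mem_rOrbits.2 ⟨i, rfl⟩⟩

theorem exists_colVertex (O : lOrbits (hookSet e)) : ∃ j, O = h.colVertex j := by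
  obtain ⟨j, hj⟩ := h.mem_lOrbits.1 O.2
  exact ⟨j, Subtype.ext hj⟩

theorem exists_rowVertex (O : rOrbits (hookSet e)) : ∃ j, O = h.rowVertex j := by
  obtain ⟨j, hj⟩ := h.mem_rOrbits.1 O.2
  exact ⟨j, Subtype.ext hj⟩

theorem hookCol_injective : Function.Injective (hookCol e) := by
  intro j j' hj
  have : e j j ∈ hookCol e j' := by rw [← hj]; exact ⟨j, rfl⟩
  obtain ⟨k, hk⟩ := this
  exact (h.inj hk).2

theorem hookRow_injective : Function.Injective (hookRow e) := by
  intro j j' hj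
  have : e j j ∈ hookRow e j' := by rw [← hj]; exact ⟨j, rfl⟩
  obtain ⟨k, hk⟩ := this
  exact (h.inj hk).1

theorem colVertex_injective : Function.Injective h.colVertex := fun _ _ hj =>
  h.hookCol_injective (Set.singleton_injective (congrArg Subtype.val hj))

theorem rowVertex_injective : Function.Injective h.rowVertex := fun _ _ hj =>
  h.hookRow_injective (Set.singleton_injective (congrArg Subtype.val hj))

/-- Column `j` and row `i` meet in `e i j` alone, and a one-element set is a group exactly when its
element is idempotent. -/
theorem deltaGraph_adj (i j : Fin m) :
    (deltaGraph (hookSet e)).Adj (.inl (h.colVertex j)) (.inr (h.rowVertex i)) ↔ Near j i := by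
  change (∃ L ∈ ({hookCol e j} : Set (Set S)), ∃ R ∈ ({hookRow e i} : Set (Set S)),
    IsGroupSubset (L ∩ R)) ↔ _
  have hint : hookCol e j ∩ hookRow e i = {e i j} := by
    ext x
    constructor
    · rintro ⟨⟨k, rfl⟩, ⟨l, hl⟩⟩
      rw [(h.inj hl).1]
      rfl
    · rintro rfl
      exact ⟨⟨i, rfl⟩, ⟨j, rfl⟩⟩
  constructor
  · rintro ⟨L, rfl, R, rfl, hG, -⟩
    rw [hint] at hG
    by_contra hn
    exact (h.mul_not_near hn).2 i j (hG _ rfl _ rfl)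
  · intro hn
    refine ⟨_, rfl, _, rfl, ?_⟩
    rw [hint]
    have := h.mul_near (i := i) (l := j) hn
    refine ⟨?_, e i j, rfl, ?_⟩
    · rintro _ rfl _ rfl
      exact this
    · rintro _ rfl
      exact ⟨this, this, _, rfl, this, this⟩

theorem isIndepSet_iff (K : Set (lOrbits (hookSet e) ⊕ rOrbits (hookSet e))) :
    (deltaGraph (hookSet e)).IsIndepSet K ↔
      ∀ j i, .inl (h.colVertex j) ∈ K → .inr (h.rowVertex i) ∈ K → ¬ Near j i := by
  constructor
  · intro hK j i hj hi hn
    exact hK hj hi (by simp) ((h.deltaGraph_adj i j).2 hn)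
  · rintro hK (x | x) hx (y | y) hy - hxy
    · exact hxy
    · obtain ⟨j, rfl⟩ := h.exists_colVertex x
      obtain ⟨i, rfl⟩ := h.exists_rowVertex y
      exact hK j i hx hy ((h.deltaGraph_adj i j).1 hxy)
    · obtain ⟨j, rfl⟩ := h.exists_colVertex y
      obtain ⟨i, rfl⟩ := h.exists_rowVertex x
      exact hK j i hy hx ((h.deltaGraph_adj i j).1 hxy.symm)
    · exact hxy

/-- In a bipartite graph, an independent set is maximal when every vertex with no neighbour in its
opposite part already belongs to it. -/
theorem maximal_isIndepSet_iff (K : Set (lOrbits (hookSet e) ⊕ rOrbits (hookSet e))) :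
    Maximal (deltaGraph (hookSet e)).IsIndepSet K ↔
      IsDual {j | .inl (h.colVertex j) ∈ K} {i | .inr (h.rowVertex i) ∈ K} := by
  constructor
  · intro hK
    have hind := (h.isIndepSet_iff K).1 hK.1
    refine ⟨fun j => ⟨fun hj i hi => hind j i hj hi, fun hj => ?_⟩,
      fun i => ⟨fun hi j hj => hind j i hj hi, fun hi => ?_⟩⟩
    · refine hK.2 (y := insert (.inl (h.colVertex j)) K) ?_ (Set.subset_insert _ _)
        (Set.mem_insert _ _)
      rw [h.isIndepSet_iff]
      rintro k i (hk | hk) (hi | hi)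
      · cases hi
      · rw [h.colVertex_injective (Sum.inl_injective hk)]
        exact hj i hi
      · cases hi
      · exact hind k i hk hi
    · refine hK.2 (y := insert (.inr (h.rowVertex i)) K) ?_ (Set.subset_insert _ _)
        (Set.mem_insert _ _)
      rw [h.isIndepSet_iff]
      rintro k l (hk | hk) (hl | hl)
      · cases hk
      · cases hk
      · rw [h.rowVertex_injective (Sum.inr_injective hl)]
        exact hi k hk
      · exact hind k l hk hl
  · intro hK
    refine ⟨(h.isIndepSet_iff K).2 fun j i hj hi => (hK.1 j).1 hj i hi, ?_⟩
    rintro K' hK' hle (x | x) hx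
    · obtain ⟨j, rfl⟩ := h.exists_colVertex x
      exact (hK.1 j).2 fun i hi => (h.isIndepSet_iff K').1 hK' j i hx (hle hi)
    · obtain ⟨i, rfl⟩ := h.exists_rowVertex x
      exact (hK.2 i).2 fun j hj => (h.isIndepSet_iff K').1 hK' j i (hle hj) hx

theorem compl_union_greenUnion (K : Set (lOrbits (hookSet e) ⊕ rOrbits (hookSet e))) :
    (hookSet e)ᶜ ∪ greenUnion K =
      hookUnion e {j | .inl (h.colVertex j) ∈ K} {i | .inr (h.rowVertex i) ∈ K} := by
  ext x
  by_cases hx : x ∈ hookSet e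
  · obtain ⟨i, j, rfl⟩ := hx
    constructor
    · rintro (hx | ⟨O, hO, L, hL, hx⟩ | ⟨O, hO, L, hL, hx⟩) k l hkl
      · exact absurd ⟨i, j, rfl⟩ hx
      · obtain ⟨j', rfl⟩ := h.exists_colVertex O
        obtain rfl : L = hookCol e j' := hL
        obtain ⟨k', hk'⟩ := hx
        rw [(h.inj (hkl.symm.trans hk')).2]
        exact Or.inl hO
      · obtain ⟨i', rfl⟩ := h.exists_rowVertex O
        obtain rfl : L = hookRow e i' := hL
        obtain ⟨k', hk'⟩ := hx
        rw [(h.inj (hkl.symm.trans hk')).1]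
        exact Or.inr hO
    · intro hx
      right
      rcases hx i j rfl with h1 | h1
      · exact Or.inl ⟨_, h1, _, rfl, i, rfl⟩
      · exact Or.inr ⟨_, h1, _, rfl, j, rfl⟩
  · constructor
    · rintro - i j hij
      exact absurd ⟨i, j, hij⟩ hx
    · intro _
      exact Or.inl hx

/-- The bicomponents are the dual pairs with one side empty: duality then forces the other side to
be everything. -/
theorem mem_indep_family_iff (M : Set S) :
    (∃ K, Maximal (deltaGraph (hookSet e)).IsIndepSet K ∧
      K ≠ Set.range Sum.inl ∧ K ≠ Set.range Sum.inr ∧ M = (hookSet e)ᶜ ∪ greenUnion K) ↔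
    ∃ A B, IsDual A B ∧ A.Nonempty ∧ B.Nonempty ∧ M = hookUnion e A B := by
  constructor
  · rintro ⟨K, hK, hl, hr, rfl⟩
    have hd := (h.maximal_isIndepSet_iff K).1 hK
    refine ⟨_, _, hd, ?_, ?_, h.compl_union_greenUnion K⟩
    · rw [Set.nonempty_iff_ne_empty]
      intro hA
      rw [hA] at hd
      refine hr (Set.Subset.antisymm ?_ ?_)
      · rintro (x | x) hx
        · obtain ⟨j, rfl⟩ := h.exists_colVertex x
          have : j ∈ {j | .inl (h.colVertex j) ∈ K} := hx
          rw [hA] at this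
          exact this.elim
        · exact ⟨x, rfl⟩
      · rintro _ ⟨x, rfl⟩
        obtain ⟨i, rfl⟩ := h.exists_rowVertex x
        exact (hd.2 i).2 fun j hj => hj.elim
    · rw [Set.nonempty_iff_ne_empty]
      intro hB
      rw [hB] at hd
      refine hl (Set.Subset.antisymm ?_ ?_)
      · rintro (x | x) hx
        · exact ⟨x, rfl⟩
        · obtain ⟨j, rfl⟩ := h.exists_rowVertex x
          have : j ∈ {j | .inr (h.rowVertex j) ∈ K} := hx
          rw [hB] at this
          exact this.elim
      · rintro _ ⟨x, rfl⟩
        obtain ⟨i, rfl⟩ := h.exists_colVertex x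
        exact (hd.1 i).2 fun j hj => hj.elim
  · rintro ⟨A, B, hAB, ⟨a, ha⟩, ⟨b, hb⟩, rfl⟩
    let K : Set (lOrbits (hookSet e) ⊕ rOrbits (hookSet e)) :=
      (fun j => .inl (h.colVertex j)) '' A ∪ (fun i => .inr (h.rowVertex i)) '' B
    have hKA : {j | .inl (h.colVertex j) ∈ K} = A := by
      ext j
      simp [K, h.colVertex_injective.eq_iff]
    have hKB : {i | .inr (h.rowVertex i) ∈ K} = B := by
      ext j
      simp [K, h.rowVertex_injective.eq_iff]
    refine ⟨K, (h.maximal_isIndepSet_iff K).2 (by rwa [hKA, hKB]), ?_, ?_, ?_⟩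
    · intro hK
      have : (.inr (h.rowVertex b) : lOrbits (hookSet e) ⊕ rOrbits (hookSet e)) ∈ K :=
        Or.inr ⟨b, hb, rfl⟩
      rw [hK] at this
      simp at this
    · intro hK
      have : (.inl (h.colVertex a) : lOrbits (hookSet e) ⊕ rOrbits (hookSet e)) ∈ K :=
        Or.inl ⟨a, ha, rfl⟩
      rw [hK] at this
      simp at this
    · rw [h.compl_union_greenUnion, hKA, hKB]

/-! ### The types of the maximal subsemigroups -/

theorem isTypeM1 : IsTypeM1 {x : S | IsUnit x} {1}ᶜ := by
  refine ⟨fun x hx => h.isUnit_iff.2 (by simpa using hx), ?_⟩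
  ext x
  simp [h.isUnit_iff]

theorem isTypeM2 {A B : Set (Fin m)} (hAB : IsDual A B) (hA : A.Nonempty) (hB : B.Nonempty) :
    IsTypeM2 (hookSet e) (hookUnion e A B) := by
  refine ⟨?_, hookCol e '' A, ?_, hookRow e '' B, ?_, hA.image _, hB.image _, ?_⟩
  · intro x hx
    by_contra hcon
    exact hx fun i j hij => absurd ⟨i, j, hij⟩ hcon
  · refine ⟨?_, fun hsub => hAB.ne_univ hB (Set.eq_univ_of_forall fun j => ?_)⟩
    · rintro _ ⟨j, -, rfl⟩
      exact h.mem_lClasses.2 ⟨j, rfl⟩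
    · exact (h.hookCol_injective.mem_set_image).1 (hsub (h.mem_lClasses.2 ⟨j, rfl⟩))
  · refine ⟨?_, fun hsub => hAB.symm.ne_univ hA (Set.eq_univ_of_forall fun j => ?_)⟩
    · rintro _ ⟨j, -, rfl⟩
      exact h.mem_rClasses.2 ⟨j, rfl⟩
    · exact (h.hookRow_injective.mem_set_image).1 (hsub (h.mem_rClasses.2 ⟨j, rfl⟩))
  · ext x
    constructor
    · rintro ⟨hx, i, j, rfl⟩
      rcases hx i j rfl with h1 | h1
      · exact Or.inl ⟨_, ⟨j, h1, rfl⟩, i, rfl⟩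
      · exact Or.inr ⟨_, ⟨i, h1, rfl⟩, j, rfl⟩
    · rintro (⟨_, ⟨j, hj, rfl⟩, i, rfl⟩ | ⟨_, ⟨i, hi, rfl⟩, j, rfl⟩)
      · exact ⟨fun k l hkl => Or.inl ((h.inj hkl).2 ▸ hj), i, j, rfl⟩
      · exact ⟨fun k l hkl => Or.inr ((h.inj hkl).1 ▸ hi), i, j, rfl⟩

theorem isTypeM3 (hm : 2 ≤ m) (j : Fin m) : IsTypeM3 (hookSet e) (hookCol e j)ᶜ := by
  refine ⟨?_, hookCol e '' {j}ᶜ, ⟨?_, fun hsub => ?_⟩, ?_, ?_⟩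
  · rw [compl_compl]
    rintro _ ⟨i, rfl⟩
    exact ⟨i, j, rfl⟩
  · rintro _ ⟨j, -, rfl⟩
    exact h.mem_lClasses.2 ⟨j, rfl⟩
  · exact (h.hookCol_injective.mem_set_image).1 (hsub (h.mem_lClasses.2 ⟨j, rfl⟩)) rfl
  · obtain ⟨l, hl, -⟩ := exists_near_ne hm j j
    exact ⟨_, l, hl, rfl⟩
  · ext x
    constructor
    · rintro ⟨hx, i, l, rfl⟩
      refine ⟨_, ⟨l, ?_, rfl⟩, i, rfl⟩
      rintro rfl
      exact hx ⟨i, rfl⟩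
    · rintro ⟨_, ⟨l, hl, rfl⟩, i, rfl⟩
      refine ⟨?_, i, l, rfl⟩
      rintro ⟨k, hk⟩
      exact hl (h.inj hk).2

theorem isTypeM4 (hm : 2 ≤ m) (i : Fin m) : IsTypeM4 (hookSet e) (hookRow e i)ᶜ := by
  refine ⟨?_, hookRow e '' {i}ᶜ, ⟨?_, fun hsub => ?_⟩, ?_, ?_⟩
  · rw [compl_compl]
    rintro _ ⟨j, rfl⟩
    exact ⟨i, j, rfl⟩
  · rintro _ ⟨j, -, rfl⟩
    exact h.mem_rClasses.2 ⟨j, rfl⟩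
  · exact (h.hookRow_injective.mem_set_image).1 (hsub (h.mem_rClasses.2 ⟨i, rfl⟩)) rfl
  · obtain ⟨l, hl, -⟩ := exists_near_ne hm i i
    exact ⟨_, l, hl, rfl⟩
  · ext x
    constructor
    · rintro ⟨hx, k, l, rfl⟩
      refine ⟨_, ⟨k, ?_, rfl⟩, l, rfl⟩
      rintro rfl
      exact hx ⟨l, rfl⟩
    · rintro ⟨_, ⟨k, hk, rfl⟩, l, rfl⟩
      refine ⟨?_, k, l, rfl⟩
      rintro ⟨q, hq⟩
      exact hk (h.inj hq).1

end IsHookSystem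
end HookSystem
end JonesMonoid

/-! ### Fibonacci count of the dual pairs -/

namespace JonesMonoid

/-! ### Counting the unions of windows -/

/-- `C` contains `i < m` together with its neighbours in `{0, …, m - 1}`. -/
def HasWindow (m : ℕ) (C : Finset ℕ) (i : ℕ) : Prop :=
  i < m ∧ i ∈ C ∧ (i = 0 ∨ i - 1 ∈ C) ∧ (i + 1 = m ∨ i + 1 ∈ C)

instance (m : ℕ) (C : Finset ℕ) : DecidablePred (HasWindow m C) := fun i => by
  unfold HasWindow; infer_instance

/-- `C` is a union of windows. -/
def IsWindowUnion (m : ℕ) (C : Finset ℕ) : Prop :=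
  ∀ j ∈ C, HasWindow m C j ∨ (1 ≤ j ∧ HasWindow m C (j - 1)) ∨ HasWindow m C (j + 1)

instance (m : ℕ) : DecidablePred (IsWindowUnion m) := fun C => by
  unfold IsWindowUnion; infer_instance

/-- The unions of windows in `{0, …, m}` that contain `m`. -/
def windowsIn (m : ℕ) : Finset (Finset ℕ) :=
  (Finset.range (m + 1)).powerset.filter fun C => IsWindowUnion (m + 1) C ∧ m ∈ C

/-- The unions of windows in `{0, …, m}` that do not contain `m`. -/
def windowsOut (m : ℕ) : Finset (Finset ℕ) :=
  (Finset.range (m + 1)).powerset.filter fun C => IsWindowUnion (m + 1) C ∧ m ∉ C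

theorem mem_windowsIn {m : ℕ} {C : Finset ℕ} :
    C ∈ windowsIn m ↔ (∀ j ∈ C, j < m + 1) ∧ IsWindowUnion (m + 1) C ∧ m ∈ C := by
  simp [windowsIn, Finset.subset_iff]

theorem mem_windowsOut {m : ℕ} {C : Finset ℕ} :
    C ∈ windowsOut m ↔ (∀ j ∈ C, j < m + 1) ∧ IsWindowUnion (m + 1) C ∧ m ∉ C := by
  simp [windowsOut, Finset.subset_iff]

/-- Let `C` omit `m + 2`. If it also omits `m + 1`, the last index can be dropped. If it contains `m
+ 1`, that index can only be covered by the window centred at `m`, so `m ∈ C`; deleting `m + 1`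
leaves a union of windows in `{0, …, m}`, where the window at `m` is cut off by the new right end.
-/
theorem windowsOut_succ (m : ℕ) :
    windowsOut (m + 2) = windowsOut (m + 1) ∪ (windowsIn m).image (insert (m + 1)) := by
  ext C
  simp only [Finset.mem_union, Finset.mem_image, mem_windowsOut, mem_windowsIn]
  by_cases h2 : m + 2 ∈ C
  · constructor
    · rintro ⟨-, -, h⟩
      exact absurd h2 h
    · rintro (⟨h, -, -⟩ | ⟨D, ⟨h, -, -⟩, rfl⟩)
      · have := h _ h2
        omega
      · rcases Finset.mem_insert.1 h2 with h3 | h3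
        · omega
        · have := h _ h3
          omega
  by_cases h1 : m + 1 ∈ C
  · have hw : ∀ i, HasWindow (m + 3) C i ↔ HasWindow (m + 1) (C.erase (m + 1)) i := by
      intro i
      simp only [HasWindow, Finset.mem_erase]
      grind
    constructor
    · rintro ⟨hr, hC, -⟩
      refine Or.inr ⟨C.erase (m + 1), ⟨?_, ?_, ?_⟩, Finset.insert_erase h1⟩
      · intro j hj
        have := hr j (Finset.mem_of_mem_erase hj)
        have : j ≠ m + 2 := fun e => h2 (e ▸ Finset.mem_of_mem_erase hj)
        have := Finset.ne_of_mem_erase hj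
        omega
      · intro j hj
        simp only [← hw]
        exact hC j (Finset.mem_of_mem_erase hj)
      · have := hC _ h1
        simp only [HasWindow] at this
        grind
    · rintro (⟨-, -, h⟩ | ⟨D, ⟨hr, hD, hm⟩, rfl⟩)
      · exact absurd h1 h
      · have hD1 : m + 1 ∉ D := fun k => by have := hr _ k; omega
        rw [Finset.erase_insert hD1] at hw
        refine ⟨?_, ?_, h2⟩
        · intro j hj
          rcases Finset.mem_insert.1 hj with rfl | hj
          · omega
          · have := hr j hj
            omega
        · intro j hj
          simp only [hw]
          rcases Finset.mem_insert.1 hj with rfl | hj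
          · right; left
            have := hD m hm
            simp only [HasWindow] at this ⊢
            grind
          · exact hD j hj
  · have hw : ∀ i, HasWindow (m + 3) C i ↔ HasWindow (m + 2) C i := by
      intro i
      simp only [HasWindow]
      grind
    constructor
    · rintro ⟨hr, hC, -⟩
      refine Or.inl ⟨?_, ?_, h1⟩
      · intro j hj
        have := hr j hj
        have : j ≠ m + 2 := fun e => h2 (e ▸ hj)
        omega
      · intro j hj
        simp only [← hw]
        exact hC j hj
    · rintro (⟨hr, hC, -⟩ | ⟨D, -, rfl⟩)
      · refine ⟨fun j hj => (hr j hj).trans (by omega), fun j hj => ?_, h2⟩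
        simp only [hw]
        exact hC j hj
      · exact absurd (Finset.mem_insert_self _ _) h1

/-- A union of windows containing the last index `m + 2` also contains `m + 1`. If it contains `m`,
delete `m + 2`; if not, `{m + 1, m + 2}` is the end window standing apart, and both indices are
deleted. -/
theorem windowsIn_succ (m : ℕ) :
    windowsIn (m + 2) = (windowsIn (m + 1)).image (insert (m + 2)) ∪
      (windowsOut m).image (fun D => insert (m + 2) (insert (m + 1) D)) := by
  ext C
  simp only [Finset.mem_union, Finset.mem_image, mem_windowsOut, mem_windowsIn]
  constructor
  · rintro ⟨hr, hC, h2⟩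
    have h1 : m + 1 ∈ C := by
      have := hC _ h2
      simp only [HasWindow] at this
      grind
    by_cases h0 : m ∈ C
    · left
      have hw : ∀ i, HasWindow (m + 3) C i ↔
          HasWindow (m + 2) (C.erase (m + 2)) i ∨ i = m + 2 := by
        intro i
        simp only [HasWindow, Finset.mem_erase]
        grind
      refine ⟨C.erase (m + 2), ⟨?_, ?_, ?_⟩, Finset.insert_erase h2⟩
      · intro j hj
        have := hr j (Finset.mem_of_mem_erase hj)
        have := Finset.ne_of_mem_erase hj
        omega
      · intro j hj
        have h3 := hC j (Finset.mem_of_mem_erase hj)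
        have h4 := hr j (Finset.mem_of_mem_erase hj)
        simp only [hw] at h3
        by_cases h5 : j = m + 1
        · subst h5
          left
          simp only [HasWindow, Finset.mem_erase]
          grind
        · have := Finset.ne_of_mem_erase hj
          grind
      · simp [h1]
    · right
      have hw : ∀ i, HasWindow (m + 3) C i ↔
          HasWindow (m + 1) ((C.erase (m + 2)).erase (m + 1)) i ∨ i = m + 2 := by
        intro i
        simp only [HasWindow, Finset.mem_erase]
        grind
      refine ⟨(C.erase (m + 2)).erase (m + 1), ⟨?_, ?_, ?_⟩, ?_⟩
      · intro j hj
        simp only [Finset.mem_erase] at hj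
        have := hr j hj.2.2
        omega
      · intro j hj
        simp only [Finset.mem_erase] at hj
        have h3 := hC j hj.2.2
        have h4 := hr j hj.2.2
        simp only [hw] at h3
        grind
      · simp [h0]
      · rw [Finset.insert_erase (by simp [h1]), Finset.insert_erase h2]
  · rintro (⟨D, ⟨hr, hD, h1⟩, rfl⟩ | ⟨D, ⟨hr, hD, h0⟩, rfl⟩)
    · have h2 : m + 2 ∉ D := fun k => by have := hr _ k; omega
      have h0 : m ∈ D := by
        have := hD _ h1
        simp only [HasWindow] at this
        grind
      have hw : ∀ i, HasWindow (m + 3) (insert (m + 2) D) i ↔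
          HasWindow (m + 2) D i ∨ i = m + 2 := by
        intro i
        simp only [HasWindow, Finset.mem_insert]
        grind
      refine ⟨?_, ?_, Finset.mem_insert_self _ _⟩
      · intro j hj
        rcases Finset.mem_insert.1 hj with rfl | hj
        · omega
        · have := hr j hj
          omega
      · intro j hj
        simp only [hw]
        rcases Finset.mem_insert.1 hj with rfl | hj
        · exact Or.inl (Or.inr rfl)
        · have := hD j hj
          grind
    · have h2 : m + 2 ∉ D := fun k => by have := hr _ k; omega
      have h1 : m + 1 ∉ D := fun k => by have := hr _ k; omega
      have hw : ∀ i, HasWindow (m + 3) (insert (m + 2) (insert (m + 1) D)) i ↔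
          HasWindow (m + 1) D i ∨ i = m + 2 := by
        intro i
        simp only [HasWindow, Finset.mem_insert]
        grind
      refine ⟨?_, ?_, Finset.mem_insert_self _ _⟩
      · intro j hj
        simp only [Finset.mem_insert] at hj
        rcases hj with rfl | rfl | hj
        · omega
        · omega
        · have := hr j hj
          omega
      · intro j hj
        simp only [hw]
        simp only [Finset.mem_insert] at hj
        rcases hj with rfl | rfl | hj
        · exact Or.inl (Or.inr rfl)
        · exact Or.inr (Or.inr (Or.inr rfl))
        · have := hD j hj
          grind

/-- With `a`, `b` the two cardinalities, the recursions are `a (m+2) = a (m+1) + b m` and `b (m+2) =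
b (m+1) + a m`, with all initial values 1; hence both are Fibonacci. -/
theorem card_windows (m : ℕ) :
    (windowsIn m).card = Nat.fib (m + 1) ∧ (windowsOut m).card = Nat.fib (m + 1) := by
  induction m using Nat.strong_induction_on with
  | _ m ih =>
  match m, ih with
  | 0, _ => decide
  | 1, _ => decide
  | m + 2, ih =>
    obtain ⟨a0, b0⟩ := ih m (by omega)
    obtain ⟨a1, b1⟩ := ih (m + 1) (by omega)
    rw [windowsIn_succ, windowsOut_succ, Finset.card_union_of_disjoint,
      Finset.card_union_of_disjoint, Finset.card_image_of_injOn, Finset.card_image_of_injOn,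
      Finset.card_image_of_injOn, a0, b0, a1, b1, Nat.fib_add_two (n := m + 1)]
    · omega
    · intro C hC D hD hCD
      have h1 : m + 1 ∉ C := fun k => by have := (mem_windowsIn.1 hC).1 _ k; omega
      have h2 : m + 1 ∉ D := fun k => by have := (mem_windowsIn.1 hD).1 _ k; omega
      rw [← Finset.erase_insert h1, ← Finset.erase_insert h2]
      exact congrArg (fun X => Finset.erase X (m + 1)) hCD
    · intro C hC D hD hCD
      have h1 : m + 1 ∉ C := fun k => by have := (mem_windowsOut.1 hC).1 _ k; omega
      have h2 : m + 1 ∉ D := fun k => by have := (mem_windowsOut.1 hD).1 _ k; omega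
      have h3 : m + 2 ∉ insert (m + 1) C := fun k => by
        rcases Finset.mem_insert.1 k with k | k
        · omega
        · have := (mem_windowsOut.1 hC).1 _ k; omega
      have h4 : m + 2 ∉ insert (m + 1) D := fun k => by
        rcases Finset.mem_insert.1 k with k | k
        · omega
        · have := (mem_windowsOut.1 hD).1 _ k; omega
      rw [← Finset.erase_insert h1, ← Finset.erase_insert h2, ← Finset.erase_insert h3,
        ← Finset.erase_insert h4]
      exact congrArg (fun X => Finset.erase (Finset.erase X (m + 2)) (m + 1)) hCD
    · intro C hC D hD hCD
      have h1 : m + 2 ∉ C := fun k => by have := (mem_windowsIn.1 hC).1 _ k; omega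
      have h2 : m + 2 ∉ D := fun k => by have := (mem_windowsIn.1 hD).1 _ k; omega
      rw [← Finset.erase_insert h1, ← Finset.erase_insert h2]
      exact congrArg (fun X => Finset.erase X (m + 2)) hCD
    · rw [Finset.disjoint_left]
      intro C hC hC'
      obtain ⟨D, hD, rfl⟩ := Finset.mem_image.1 hC'
      exact (mem_windowsOut.1 hC).2.2 (Finset.mem_insert_self _ _)
    -- The two families of `windowsIn_succ` are separated by whether `m` belongs to the set.
    · rw [Finset.disjoint_left]
      intro C hC hC'
      obtain ⟨D, hD, rfl⟩ := Finset.mem_image.1 hC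
      obtain ⟨D', hD', e⟩ := Finset.mem_image.1 hC'
      have h0 : m ∈ D := by
        have := (mem_windowsIn.1 hD).2.1 _ (mem_windowsIn.1 hD).2.2
        simp only [HasWindow] at this
        grind
      have h1 : m ∈ insert (m + 2) (insert (m + 1) D') := by
        rw [e]; exact Finset.mem_insert_of_mem h0
      simp only [Finset.mem_insert] at h1
      rcases h1 with h1 | h1 | h1
      · omega
      · omega
      · exact (mem_windowsOut.1 hD').2.2 h1

theorem card_isWindowUnion {m : ℕ} (hm : 1 ≤ m) :
    ((Finset.range m).powerset.filter (IsWindowUnion m)).card = 2 * Nat.fib m := by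
  obtain ⟨m, rfl⟩ : ∃ k, m = k + 1 := ⟨m - 1, by omega⟩
  have h := card_windows m
  have : (Finset.range (m + 1)).powerset.filter (IsWindowUnion (m + 1)) =
      windowsIn m ∪ windowsOut m := by
    ext C
    simp only [windowsIn, windowsOut, Finset.mem_union, Finset.mem_filter]
    tauto
  rw [this, Finset.card_union_of_disjoint, h.1, h.2, two_mul]
  rw [Finset.disjoint_left]
  intro C h1 h2
  exact (mem_windowsOut.1 h2).2.2 (mem_windowsIn.1 h1).2.2

/-! ### Counting the maximal subsemigroups -/

variable {m : ℕ}

/-- The indices that are not adjacent to any index in `A`. -/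
def dual (A : Set (Fin m)) : Set (Fin m) := {i | ∀ j ∈ A, ¬ Near j i}

theorem isDual_iff {A B : Set (Fin m)} : IsDual A B ↔ B = dual A ∧ dual (dual A) = A := by
  constructor
  · intro h
    have h1 : B = dual A := Set.ext h.2
    subst h1
    exact ⟨rfl, (Set.ext h.symm.2).symm⟩
  · rintro ⟨rfl, h⟩
    refine ⟨fun j => ?_, fun i => Iff.rfl⟩
    rw [Set.ext_iff] at h
    exact (h j).symm.trans ⟨fun k i hi hn => k i hi hn.symm, fun k i hi hn => k i hi hn.symm⟩

/-- An index lies in `dual A` exactly when its window avoids `A`. Therefore the complement of `dual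
(dual A)` is the union of all windows avoiding `A`, and `A` is closed exactly when its complement is
a union of windows. -/
theorem ncard_dual_dual (hm : 1 ≤ m) : {A : Set (Fin m) | dual (dual A) = A}.ncard =
    2 * Nat.fib m := by
  classical
  rw [← card_isWindowUnion hm, ← Set.ncard_coe_finset]
  have mem_img : ∀ (A : Set (Fin m)) (k : Fin m),
      (k : ℕ) ∈ (Finset.univ.filter (· ∉ A)).image Fin.val ↔ k ∉ A := by
    intro A k
    simp only [Finset.mem_image, Finset.mem_filter, Finset.mem_univ, true_and]
    exact ⟨fun ⟨l, hl, e⟩ => Fin.ext e ▸ hl, fun hk => ⟨k, hk, rfl⟩⟩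
  have lt_of_mem : ∀ (A : Set (Fin m)) (k : ℕ),
      k ∈ (Finset.univ.filter (· ∉ A)).image Fin.val → k < m := by
    intro A k hk
    obtain ⟨l, -, rfl⟩ := Finset.mem_image.1 hk
    exact l.2
  have window_iff : ∀ (A : Set (Fin m)) (i : ℕ) (hi : i < m),
      HasWindow m ((Finset.univ.filter (· ∉ A)).image Fin.val) i ↔ ⟨i, hi⟩ ∈ dual A := by
    intro A i hi
    constructor
    · rintro ⟨-, h1, h2, h3⟩ j hj hn
      obtain ⟨hn1, hn2⟩ := hn
      simp only at hn1 hn2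
      have hj' := fun k => (mem_img A j).1 k hj
      rcases (by omega : (j : ℕ) = i ∨ ((j : ℕ) = i - 1 ∧ i ≠ 0) ∨ (j : ℕ) = i + 1) with e | ⟨e, e'⟩ | e
      · rw [e] at hj'; exact hj' h1
      · rw [e] at hj'; exact hj' (h2.resolve_left e')
      · rw [e] at hj'
        have := j.2
        exact hj' (h3.resolve_left (by omega))
    · intro h
      have key : ∀ k, k < m → k ≤ i + 1 → i ≤ k + 1 →
          k ∈ (Finset.univ.filter (· ∉ A)).image Fin.val := fun k hk h1 h2 =>
        (mem_img A ⟨k, hk⟩).2 fun hk' => h ⟨k, hk⟩ hk' ⟨h1, h2⟩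
      refine ⟨hi, key i hi (by omega) (by omega), ?_, ?_⟩
      · by_cases h0 : i = 0
        · exact Or.inl h0
        · exact Or.inr (key _ (by omega) (by omega) (by omega))
      · by_cases h0 : i + 1 = m
        · exact Or.inl h0
        · exact Or.inr (key _ (by omega) (by omega) (by omega))
  have closed_iff : ∀ A : Set (Fin m), dual (dual A) = A ↔
      IsWindowUnion m ((Finset.univ.filter (· ∉ A)).image Fin.val) := by
    intro A
    -- The inclusion of `A` in its double dual is automatic; only the reverse one is a condition.
    have : dual (dual A) = A ↔ ∀ j, j ∉ A → ∃ i ∈ dual A, Near i j := by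
      constructor
      · intro h j hj
        rw [← h] at hj
        simpa [dual] using hj
      · intro h
        refine Set.Subset.antisymm (fun j hj => ?_) fun j hj i hi hn => hi j hj hn.symm
        by_contra hcon
        obtain ⟨i, hi, hn⟩ := h j hcon
        exact hj i hi hn
    rw [this]
    constructor
    · intro h j hj
      have hjm := lt_of_mem A j hj
      obtain ⟨⟨i, hi⟩, hiA, hn1, hn2⟩ := h ⟨j, hjm⟩ ((mem_img A ⟨j, hjm⟩).1 hj)
      rw [← window_iff] at hiA
      simp only at hn1 hn2
      rcases (by omega : i = j ∨ (1 ≤ j ∧ i = j - 1) ∨ i = j + 1) with rfl | ⟨h1, rfl⟩ | rfl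
      · exact Or.inl hiA
      · exact Or.inr (Or.inl ⟨h1, hiA⟩)
      · exact Or.inr (Or.inr hiA)
    · intro h j hj
      rcases h j ((mem_img A j).2 hj) with h1 | ⟨h0, h1⟩ | h1
      · exact ⟨⟨j, h1.1⟩, (window_iff _ _ _).1 h1, by simp [Near]⟩
      · exact ⟨⟨_, h1.1⟩, (window_iff _ _ _).1 h1, by simp only [Near]; omega⟩
      · exact ⟨⟨_, h1.1⟩, (window_iff _ _ _).1 h1, by simp only [Near]; omega⟩
  refine Set.ncard_congr (fun A _ => (Finset.univ.filter (· ∉ A)).image Fin.val) ?_ ?_ ?_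
  · intro A hA
    simp only [Finset.coe_filter, Finset.mem_powerset, Set.mem_ofPred_eq]
    exact ⟨fun k hk => Finset.mem_range.2 (lt_of_mem A k hk), (closed_iff A).1 hA⟩
  · intro A A' _ _ e
    ext k
    rw [← not_iff_not, ← mem_img A, ← mem_img A', e]
  · intro C hC
    simp only [Finset.coe_filter, Finset.mem_powerset, Set.mem_ofPred_eq] at hC
    have e : ∀ A : Set (Fin m), (∀ k, k ∉ A ↔ (k : ℕ) ∈ C) →
        (Finset.univ.filter (· ∉ A)).image Fin.val = C := by
      intro A hA
      ext k
      simp only [Finset.mem_image, Finset.mem_filter, Finset.mem_univ, true_and, hA]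
      exact ⟨fun ⟨l, hl, e⟩ => e ▸ hl, fun hk => ⟨⟨k, Finset.mem_range.1 (hC.1 hk)⟩, hk, rfl⟩⟩
    replace e := e {k : Fin m | (k : ℕ) ∉ C} (fun k => not_not)
    refine ⟨{k : Fin m | (k : ℕ) ∉ C}, ?_, e⟩
    refine (closed_iff _).2 ?_
    rw [e]
    exact hC.2

theorem dual_empty : dual (∅ : Set (Fin m)) = Set.univ := by
  ext i
  simp [dual]

theorem dual_univ : dual (Set.univ : Set (Fin m)) = ∅ := by
  ext i
  simp only [dual, Set.mem_univ, true_imp_iff, Set.mem_ofPred_eq, Set.mem_empty_iff_false,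
    iff_false, not_forall, not_not]
  exact ⟨i, Near.refl i⟩

/-! ### The number of maximal subsemigroups of a hook system -/

section HookSystem

variable {S : Type*} [Monoid S] {e : Fin m → Fin m → S}

theorem IsHookSystem.hook_mem_hookUnion (h : IsHookSystem e) {A B : Set (Fin m)} {i j : Fin m} :
    e i j ∈ hookUnion e A B ↔ j ∈ A ∨ i ∈ B :=
  ⟨fun k => k i j rfl, fun k p q hpq => by obtain ⟨rfl, rfl⟩ := h.inj hpq; exact k⟩

/-- `A` is recovered as the set of columns wholly contained in the union: for `a ∈ A` the row `a` is
not in `B`, since `a` is near itself, so it tests every column. -/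
theorem IsHookSystem.hookUnion_left_injective (h : IsHookSystem e) {A B A' B' : Set (Fin m)}
    (hAB : IsDual A B) (hA : A.Nonempty) (hAB' : IsDual A' B') (hA' : A'.Nonempty)
    (k : hookUnion e A B = hookUnion e A' B') : A = A' := by
  have key : ∀ {A B : Set (Fin m)}, IsDual A B → A.Nonempty → ∀ j,
      j ∈ A ↔ ∀ i, e i j ∈ hookUnion e A B := by
    intro A B hAB hA j
    simp only [h.hook_mem_hookUnion]
    constructor
    · exact fun hj i => Or.inl hj
    · intro hj
      obtain ⟨a, ha⟩ := hA
      exact (hj a).resolve_right fun k => (hAB.2 a).1 k a ha (Near.refl a)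
  ext j
  rw [key hAB hA, key hAB' hA', k]

theorem IsHookSystem.ncard_hookUnion (h : IsHookSystem e) (hm : 1 ≤ m) :
    {M : Set S | ∃ A B, IsDual A B ∧ A.Nonempty ∧ B.Nonempty ∧ M = hookUnion e A B}.ncard =
      2 * Nat.fib m - 2 := by
  have hne : (∅ : Set (Fin m)) ≠ Set.univ := fun k =>
    (k ▸ Set.mem_univ (⟨0, hm⟩ : Fin m) : (⟨0, hm⟩ : Fin m) ∈ (∅ : Set (Fin m)))
  -- The closed sets `∅` and `Set.univ` are dual to each other and are exactly those giving an empty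
  -- side.
  rw [← ncard_dual_dual hm, ← Set.ncard_pair hne, ← Set.ncard_sdiff]
  · symm
    refine Set.ncard_congr (fun A _ => hookUnion e A (dual A)) ?_ ?_ ?_
    · rintro A ⟨hA, hA'⟩
      simp only [Set.mem_insert_iff, Set.mem_singleton_iff, not_or] at hA'
      refine ⟨A, dual A, isDual_iff.2 ⟨rfl, hA⟩, Set.nonempty_iff_ne_empty.2 hA'.1,
        Set.nonempty_iff_ne_empty.2 fun k => hA'.2 ?_, rfl⟩
      rw [← hA, k, dual_empty]
    · rintro A A' ⟨hA, hA1⟩ ⟨hA', hA1'⟩ k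
      simp only [Set.mem_insert_iff, Set.mem_singleton_iff, not_or] at hA1 hA1'
      exact h.hookUnion_left_injective (isDual_iff.2 ⟨rfl, hA⟩)
        (Set.nonempty_iff_ne_empty.2 hA1.1) (isDual_iff.2 ⟨rfl, hA'⟩)
        (Set.nonempty_iff_ne_empty.2 hA1'.1) k
    · rintro _ ⟨A, B, hAB, hA, hB, rfl⟩
      have hne := hAB.ne_univ hB
      obtain ⟨rfl, hA'⟩ := isDual_iff.1 hAB
      refine ⟨A, ⟨hA', ?_⟩, rfl⟩
      simp only [Set.mem_insert_iff, Set.mem_singleton_iff, not_or]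
      exact ⟨hA.ne_empty, hne⟩
  · rintro A (rfl | rfl)
    · change dual (dual ∅) = ∅
      rw [dual_empty, dual_univ]
    · change dual (dual Set.univ) = Set.univ
      rw [dual_univ, dual_empty]

theorem IsHookSystem.ncard_maximal (h : IsHookSystem e) (hm : 2 ≤ m) :
    {M : Set S | IsMaximalSubsemigroup M}.ncard = 2 * Nat.fib m + 2 * m - 1 := by
  set F := {M : Set S | ∃ A B, IsDual A B ∧ A.Nonempty ∧ B.Nonempty ∧ M = hookUnion e A B} with hF
  have hunion : {M : Set S | IsMaximalSubsemigroup M} =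
      {{1}ᶜ} ∪ (F ∪ (Set.range (fun j => (hookCol e j)ᶜ) ∪ Set.range fun i => (hookRow e i)ᶜ)) := by
    ext M
    simp only [Set.mem_ofPred_eq, h.isMaximalSubsemigroup_iff hm M, Set.mem_union,
      Set.mem_singleton_iff, hF, Set.mem_range, eq_comm (a := M)]
  have hFfin : F.Finite := by
    refine (Set.finite_range fun P : Set (Fin m) × Set (Fin m) => hookUnion e P.1 P.2).subset ?_
    rintro _ ⟨A, B, -, -, -, rfl⟩
    exact ⟨(A, B), rfl⟩
  have hcol : (Set.range fun j => (hookCol e j)ᶜ).ncard = m := by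
    have hinj : Function.Injective fun j => (hookCol e j)ᶜ :=
      compl_injective.comp h.hookCol_injective
    rw [← Set.image_univ, Set.ncard_image_of_injective _ hinj, Set.ncard_univ, Nat.card_fin]
  have hrow : (Set.range fun j => (hookRow e j)ᶜ).ncard = m := by
    have hinj : Function.Injective fun j => (hookRow e j)ᶜ :=
      compl_injective.comp h.hookRow_injective
    rw [← Set.image_univ, Set.ncard_image_of_injective _ hinj, Set.ncard_univ, Nat.card_fin]
  have hcr : Disjoint (Set.range fun j => (hookCol e j)ᶜ) (Set.range fun j => (hookRow e j)ᶜ) := by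
    rw [Set.disjoint_left]
    rintro _ ⟨j, rfl⟩ ⟨i, hi⟩
    have hi' : hookRow e i = hookCol e j := compl_injective hi
    obtain ⟨l, hl, -⟩ := exists_near_ne hm j j
    obtain ⟨p, hp⟩ : e i l ∈ hookCol e j := by rw [← hi']; exact ⟨l, rfl⟩
    exact hl (h.inj hp).2
  have hFcr : Disjoint F
      (Set.range (fun j => (hookCol e j)ᶜ) ∪ Set.range fun i => (hookRow e i)ᶜ) := by
    rw [Set.disjoint_left]
    rintro _ ⟨A, B, hAB, ⟨a, ha⟩, ⟨b, hb⟩, rfl⟩ (⟨j, hj⟩ | ⟨i, hi⟩)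
    -- A column complement contains `e a l` for `l ≠ j` near `b`, but a hook union does not: `l ∉ A`
    -- because of `b`, and `a ∉ B` because of `a`.
    · obtain ⟨l, hl, hn⟩ := exists_near_ne hm b j
      have h1 : e a l ∈ hookUnion e A B := by
        rw [← hj]
        rintro ⟨p, hp⟩
        exact hl (h.inj hp).2
      rcases h1 a l rfl with h2 | h2
      · exact (hAB.1 l).1 h2 b hb hn.symm
      · exact (hAB.2 a).1 h2 a ha (Near.refl a)
    · obtain ⟨l, hl, hn⟩ := exists_near_ne hm a i
      have h1 : e l b ∈ hookUnion e A B := by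
        rw [← hi]
        rintro ⟨p, hp⟩
        exact hl (h.inj hp).1
      rcases h1 l b rfl with h2 | h2
      · exact (hAB.1 b).1 h2 b hb (Near.refl b)
      · exact (hAB.2 l).1 h2 a ha hn
  have h1 : Disjoint {({1}ᶜ : Set S)}
      (F ∪ (Set.range (fun j => (hookCol e j)ᶜ) ∪ Set.range fun i => (hookRow e i)ᶜ)) := by
    rw [Set.disjoint_singleton_left]
    have key : (1 : S) ∉ ({1}ᶜ : Set S) := fun k => k rfl
    rintro (⟨A, B, -, -, -, hM⟩ | ⟨j, hM⟩ | ⟨i, hM⟩)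
    · rw [hM] at key
      exact key fun i j hij => absurd hij.symm (h.ne_one i j)
    · simp only at hM
      rw [← hM] at key
      exact key fun ⟨i, hi⟩ => h.ne_one _ _ hi.symm
    · simp only at hM
      rw [← hM] at key
      exact key fun ⟨i, hi⟩ => h.ne_one _ _ hi.symm
  -- Ensures that the natural subtraction in `2 * Nat.fib m - 2` is not truncated.
  have hfib : 1 ≤ Nat.fib m := Nat.fib_pos.2 (by omega)
  rw [hunion, Set.ncard_union_eq h1 (Set.finite_singleton _) (hFfin.union
    ((Set.finite_range _).union (Set.finite_range _))), Set.ncard_union_eq hFcr hFfin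
    ((Set.finite_range _).union (Set.finite_range _)), Set.ncard_union_eq hcr
    (Set.finite_range _) (Set.finite_range _), hcol, hrow, Set.ncard_singleton,
    h.ncard_hookUnion (by omega)]
  omega

end HookSystem
end JonesMonoid

/-! ### The Jones monoid as a hook system, degree two, and transport along isomorphisms -/

namespace JonesMonoid
open PartitionMonoid

/-! ### The Jones monoid -/

variable {n : ℕ}

/-- The element `hooks n i j` of the Jones monoid. -/
def jonesHook (i j : Fin (n - 1)) : jonesMonoid n :=
  ⟨hooks n i j, isBrauer_hooks (by omega) (by omega), isPlanar_hooks _ _⟩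

theorem rank_jonesHook (i j : Fin (n - 1)) : (jonesHook i j : PartitionMonoid n).rank = n - 2 :=
  rank_hooks (by omega) (by omega)

theorem eq_jonesHook_of_rank (hn : 2 ≤ n) (x : jonesMonoid n)
    (h : (x : PartitionMonoid n).rank = n - 2) : ∃ i j, x = jonesHook i j := by
  have hne : (x : PartitionMonoid n) ≠ 1 := by
    intro k
    rw [k, rank_one] at h
    omega
  obtain ⟨i, j, hi, hj, e⟩ := exists_eq_hooks x.2.1 x.2.2 hne h
  exact ⟨⟨i, by omega⟩, ⟨j, by omega⟩, Subtype.ext e⟩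

theorem rank_lt_of_low (hn : 2 ≤ n) {x : jonesMonoid n}
    (h : x ≠ 1 ∧ ∀ p q, x ≠ jonesHook p q) : (x : PartitionMonoid n).rank < n - 2 := by
  have h1 := rank_le_of_ne_one x.2.1 x.2.2 (fun k => h.1 (Subtype.ext k))
  rcases h1.lt_or_eq with h2 | h2
  · exact h2
  · obtain ⟨i, j, e⟩ := eq_jonesHook_of_rank hn x h2
    exact absurd e (h.2 i j)

theorem low_of_rank_lt {x : jonesMonoid n}
    (h : (x : PartitionMonoid n).rank < n - 2) : x ≠ 1 ∧ ∀ p q, x ≠ jonesHook p q := by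
  refine ⟨?_, ?_⟩
  · rintro rfl
    rw [OneMemClass.coe_one, rank_one] at h
    omega
  · rintro p q rfl
    rw [rank_jonesHook] at h
    omega

/-- The elements other than `1` and the hooks are those of rank below `n - 2`; they form an ideal
because rank does not increase under multiplication. The indices of a hook element are read off from
its two hooks. -/
theorem isHookSystem_jonesHook (hn : 2 ≤ n) : IsHookSystem (jonesHook (n := n)) where
  inj := by
    intro i j k l h
    have h' : hooks n i j = hooks n k l := congrArg Subtype.val h
    constructor
    · have h1 : (hooks n i j).rel (.inl ⟨i, by omega⟩) (.inl ⟨i + 1, by omega⟩) :=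
        hooks_rel_upper rfl rfl
      rw [h', hooks_rel_upper_iff (by simp [Fin.lt_def])] at h1
      exact Fin.ext h1.1
    · have h1 : (hooks n i j).rel (.inr ⟨j, by omega⟩) (.inr ⟨j + 1, by omega⟩) :=
        hooks_rel_lower rfl rfl
      rw [h', hooks_rel_lower_iff (by simp [Fin.lt_def])] at h1
      exact Fin.ext h1.1
  ne_one := by
    intro i j h
    have := rank_jonesHook i j
    rw [h, OneMemClass.coe_one, rank_one] at this
    omega
  mul_near := by
    intro i j k l h
    exact Subtype.ext (hooks_mul_hooks (by omega) (by omega) (by omega) (by omega) h.1 h.2)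
  mul_not_near := by
    intro i j k l h
    exact low_of_rank_lt
      (rank_hooks_mul_hooks_lt (by omega) (by omega) (by omega) (by omega) h)
  low_mul := fun {x} h y =>
    low_of_rank_lt ((x.2.1.rank_mul_le_left y.2.1).trans_lt (rank_lt_of_low hn h))
  mul_low := fun {x} h y =>
    low_of_rank_lt ((y.2.1.rank_mul_le_right x.2.1).trans_lt (rank_lt_of_low hn h))
  gen := by
    intro T h1 hT
    rw [eq_top_iff]
    rintro ⟨x, hx1, hx2⟩ -
    have key : ∃ hx : x ∈ jonesMonoid n, (⟨x, hx⟩ : jonesMonoid n) ∈ T := by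
      refine jones_induction (P := fun x => ∃ hx : x ∈ jonesMonoid n, (⟨x, hx⟩ : jonesMonoid n) ∈ T)
        ⟨one_mem _, h1⟩ ?_ ?_ hx1 hx2
      · intro i j hi hj
        exact ⟨_, hT ⟨i, by omega⟩ ⟨j, by omega⟩⟩
      · rintro α β - - - - ⟨hα, hα'⟩ ⟨hβ, hβ'⟩
        exact ⟨mul_mem hα hβ, T.mul_mem hα' hβ'⟩
    exact key.2

theorem rankSet_eq_hookSet (hn : 2 ≤ n) : rankSet n (n - 2) = hookSet (jonesHook (n := n)) := by
  ext x
  constructor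
  · exact eq_jonesHook_of_rank hn x
  · rintro ⟨i, j, rfl⟩
    exact rank_jonesHook i j

theorem mem_familyIndep (hn : 2 ≤ n) {M : Set (jonesMonoid n)} : M ∈ familyIndep n ↔
    ∃ A B, IsDual A B ∧ A.Nonempty ∧ B.Nonempty ∧ M = hookUnion (jonesHook (n := n)) A B := by
  rw [← (isHookSystem_jonesHook hn).mem_indep_family_iff M, ← rankSet_eq_hookSet hn]
  rfl

theorem mem_familyL (hn : 2 ≤ n) {M : Set (jonesMonoid n)} : M ∈ familyL n ↔
    ∃ j, M = (hookCol (jonesHook (n := n)) j)ᶜ := by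
  change (∃ L ∈ lClasses (rankSet n (n - 2)), M = Lᶜ) ↔ _
  simp only [rankSet_eq_hookSet hn, (isHookSystem_jonesHook hn).mem_lClasses]
  exact ⟨fun ⟨_, ⟨j, rfl⟩, h⟩ => ⟨j, h⟩, fun ⟨j, h⟩ => ⟨_, ⟨j, rfl⟩, h⟩⟩

theorem mem_familyR (hn : 2 ≤ n) {M : Set (jonesMonoid n)} : M ∈ familyR n ↔
    ∃ j, M = (hookRow (jonesHook (n := n)) j)ᶜ := by
  change (∃ L ∈ rClasses (rankSet n (n - 2)), M = Lᶜ) ↔ _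
  simp only [rankSet_eq_hookSet hn, (isHookSystem_jonesHook hn).mem_rClasses]
  exact ⟨fun ⟨_, ⟨j, rfl⟩, h⟩ => ⟨j, h⟩, fun ⟨j, h⟩ => ⟨_, ⟨j, rfl⟩, h⟩⟩

theorem setOf_isMaximalSubsemigroup (hn : 3 ≤ n) :
    {M : Set (jonesMonoid n) | IsMaximalSubsemigroup M} =
      familyId n ∪ familyIndep n ∪ familyL n ∪ familyR n := by
  ext M
  simp only [Set.mem_union, mem_familyIndep (show 2 ≤ n by omega),
    mem_familyL (show 2 ≤ n by omega), mem_familyR (show 2 ≤ n by omega), or_assoc]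
  exact (isHookSystem_jonesHook (by omega)).isMaximalSubsemigroup_iff (by omega) M

theorem ncard_maximal_jones (hn : 3 ≤ n) :
    {M : Set (jonesMonoid n) | IsMaximalSubsemigroup M}.ncard =
      2 * Nat.fib (n - 1) + 2 * n - 3 := by
  rw [(isHookSystem_jonesHook (n := n) (by omega)).ncard_maximal (by omega)]
  omega

/-! ### Degree two -/

theorem jones_two (x : jonesMonoid 2) : x = 1 ∨ x = jonesHook 0 0 := by
  by_contra hcon
  push Not at hcon
  -- For `n = 2` a third element would have rank below 0.
  have := rank_lt_of_low (x := x) le_rfl ⟨hcon.1, fun p q => by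
    rw [show p = 0 from Fin.ext (by omega), show q = 0 from Fin.ext (by omega)]
    exact hcon.2⟩
  omega

theorem jonesHook_two_ne_one : jonesHook (n := 2) 0 0 ≠ 1 :=
  (isHookSystem_jonesHook le_rfl).ne_one 0 0

theorem jonesHook_two_mul_self : jonesHook (n := 2) 0 0 * jonesHook 0 0 = jonesHook 0 0 :=
  (isHookSystem_jonesHook le_rfl).mul_near (Near.refl 0)

theorem jones_two_mul_self (a : jonesMonoid 2) : a * a = a := by
  rcases jones_two a with rfl | rfl
  · exact one_mul 1
  · exact jonesHook_two_mul_self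

theorem jones_two_mul_comm (a b : jonesMonoid 2) : a * b = b * a := by
  rcases jones_two a with rfl | rfl
  · rw [one_mul, mul_one]
  · rcases jones_two b with rfl | rfl
    · rw [one_mul, mul_one]
    · rfl

theorem card_jones_two : Nat.card (jonesMonoid 2) = 2 := by
  rw [← Set.ncard_univ, Set.ncard_eq_two]
  refine ⟨1, jonesHook 0 0, jonesHook_two_ne_one.symm, ?_⟩
  ext x
  simpa using jones_two x

/-- Both elements are idempotent, so both singletons are subsemigroups, and every proper subset lies
in one of them. -/
theorem isMaximalSubsemigroup_jones_two (M : Set (jonesMonoid 2)) :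
    IsMaximalSubsemigroup M ↔ ∃ a, M = {a} := by
  have hother : ∀ a : jonesMonoid 2, ∃ b, b ≠ a ∧ ∀ x, x ≠ a → x = b := by
    intro a
    rcases jones_two a with rfl | rfl
    · exact ⟨jonesHook 0 0, jonesHook_two_ne_one, fun x hx => (jones_two x).resolve_left hx⟩
    · exact ⟨1, jonesHook_two_ne_one.symm, fun x hx => (jones_two x).resolve_right hx⟩
  have hmul : ∀ a : jonesMonoid 2, ∀ x ∈ ({a} : Set (jonesMonoid 2)),
      ∀ y ∈ ({a} : Set (jonesMonoid 2)), x * y ∈ ({a} : Set (jonesMonoid 2)) := by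
    rintro a _ rfl _ rfl
    exact jones_two_mul_self _
  have hne : ∀ a : jonesMonoid 2, ({a} : Set (jonesMonoid 2)) ≠ Set.univ := by
    intro a k
    obtain ⟨b, hb, -⟩ := hother a
    exact hb (k ▸ Set.mem_univ b : b ∈ ({a} : Set (jonesMonoid 2)))
  constructor
  · intro hM
    obtain ⟨a, ha⟩ : ∃ a, a ∉ M := by
      by_contra hcon
      push Not at hcon
      obtain ⟨T, rfl, hT⟩ := hM
      exact hT.1 (eq_top_iff.2 fun x _ => hcon x)
    obtain ⟨b, -, hb⟩ := hother a
    refine ⟨b, hM.eq_of_subset (hmul b) (hne b) fun x hx => hb x ?_⟩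
    rintro rfl
    exact ha hx
  · rintro ⟨a, rfl⟩
    refine isMaximalSubsemigroup_of (hmul a) (hne a) ?_
    rintro T hT ⟨x, hxT, hx⟩
    rw [eq_top_iff]
    intro y _
    obtain ⟨b, -, hb⟩ := hother a
    by_cases hy : y = a
    · exact hT hy
    · rw [hb y hy, ← hb x hx]
      exact hxT

/-! ### Transport along isomorphisms -/

theorem IsMaximalSubsemigroup.image {S S' : Type*} [Monoid S] [Monoid S'] (f : S ≃* S') {M : Set S}
    (hM : IsMaximalSubsemigroup M) : IsMaximalSubsemigroup (f '' M) := by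
  obtain ⟨T, rfl, hT⟩ := hM
  refine isMaximalSubsemigroup_of ?_ ?_ ?_
  · rintro _ ⟨x, hx, rfl⟩ _ ⟨y, hy, rfl⟩
    exact ⟨x * y, T.mul_mem hx hy, map_mul f x y⟩
  · intro h
    refine hT.1 (eq_top_iff.2 fun x _ => ?_)
    obtain ⟨y, hy, hxy⟩ : f x ∈ f '' (T : Set S) := by rw [h]; trivial
    rwa [← f.injective hxy]
  · rintro U hU ⟨y, hyU, hy⟩
    have hlt : T < U.comap f.toMulHom := by
      refine lt_of_le_of_ne (fun x hx => hU ⟨x, hx, rfl⟩) fun k => hy ?_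
      refine ⟨f.symm y, ?_, by simp⟩
      rw [k]
      change f (f.symm y) ∈ U
      simpa using hyU
    have h := hT.2 _ hlt
    rw [eq_top_iff]
    intro z _
    have : f.symm z ∈ U.comap f.toMulHom := by rw [h]; trivial
    change f (f.symm z) ∈ U at this
    simpa using this

theorem ncard_maximal_congr {S S' : Type*} [Monoid S] [Monoid S'] (f : S ≃* S') :
    {M : Set S | IsMaximalSubsemigroup M}.ncard = {M : Set S' | IsMaximalSubsemigroup M}.ncard := by
  refine Set.ncard_congr (fun M _ => f '' M) (fun M hM => hM.image f)
    (fun M N _ _ h => f.injective.image_injective h) ?_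
  intro N hN
  refine ⟨f.symm '' N, hN.image f.symm, ?_⟩
  rw [← Set.image_comp]
  simp

end JonesMonoid

/-! ### Planar partitions of degree `m` as planar Brauer partitions of degree `2m` -/

namespace JonesMonoid
namespace PartitionMonoid

/-! ### Consecutive positions around the boundary -/

section LinePos

variable {n : ℕ}

/-- The position of a point in the ordering `n' < ⋯ < 1' < 1 < ⋯ < n`, with consecutive values. -/
def linePos : Fin n ⊕ Fin n → ℤ := Sum.elim (fun i => (i : ℤ)) (fun i => -((i : ℤ) + 1))

theorem linePos_lt_iff (x y : Fin n ⊕ Fin n) : linePos x < linePos y ↔ pos x < pos y := by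
  rcases x with x | x <;> rcases y with y | y <;>
    simp only [linePos, pos, Sum.elim_inl, Sum.elim_inr] <;> omega

theorem linePos_injective : Function.Injective (linePos (n := n)) := by
  rintro (x | x) (y | y) h <;> simp only [linePos, Sum.elim_inl, Sum.elim_inr] at h
  · rw [Fin.ext (show (x : ℕ) = y by omega)]
  · omega
  · omega
  · rw [Fin.ext (show (x : ℕ) = y by omega)]

theorem linePos_bounds (x : Fin n ⊕ Fin n) : -(n : ℤ) ≤ linePos x ∧ linePos x < n := by
  rcases x with x | x <;> simp only [linePos, Sum.elim_inl, Sum.elim_inr] <;> omega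

theorem exists_linePos_eq {p : ℤ} (h1 : -(n : ℤ) ≤ p) (h2 : p < n) :
    ∃ x : Fin n ⊕ Fin n, linePos x = p := by
  by_cases h : 0 ≤ p
  · exact ⟨.inl ⟨p.toNat, by omega⟩, by simp [linePos, h]⟩
  · exact ⟨.inr ⟨(-p - 1).toNat, by omega⟩, by simp only [linePos, Sum.elim_inr]; omega⟩

theorem IsPlanar.not_lt_lt_lt {α : PartitionMonoid n} (hp : α.IsPlanar) {a b x y : Fin n ⊕ Fin n}
    (hab : α.rel a b) (hxy : α.rel x y) (hax : ¬ α.rel a x) :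
    ¬ (linePos a < linePos x ∧ linePos x < linePos b ∧ linePos b < linePos y) := by
  simp only [linePos_lt_iff]
  exact fun h => hax (hp a b x y hab hxy h.1 h.2.1 h.2.2)

theorem isPlanar_iff_linePos {α : PartitionMonoid n} : α.IsPlanar ↔
    ∀ a b x y, α.rel a b → α.rel x y → linePos a < linePos x →
      linePos x < linePos b →
      linePos b < linePos y → α.rel a x := by
  simp only [linePos_lt_iff]
  rfl

/-- Two distinct blocks do not separate each other, whatever the order of their points. -/
theorem IsPlanar.not_cross {α : PartitionMonoid n} (hp : α.IsPlanar) {a b x y : Fin n ⊕ Fin n}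
    (hab : α.rel a b) (hxy : α.rel x y) (hax : ¬ α.rel a x) :
    (linePos a < linePos b →
      (linePos a < linePos x ∧
        linePos x < linePos b ↔
       linePos a < linePos y ∧
        linePos y < linePos b)) ∧
    (linePos b < linePos a →
      (linePos b < linePos x ∧
        linePos x < linePos a ↔
       linePos b < linePos y ∧
        linePos y < linePos a)) := by
  have sy : ∀ {u v}, α.rel u v → α.rel v u := fun h => α.rel.symm h
  have tr : ∀ {u v w}, α.rel u v → α.rel v w → α.rel u w := fun h k => α.rel.trans h k
  have hay : ¬ α.rel a y := fun k => hax (tr k (sy hxy))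
  have hbx : ¬ α.rel b x := fun k => hax (tr hab k)
  have hby : ¬ α.rel b y := fun k => hay (tr hab k)
  have ne : ∀ {u v}, ¬ α.rel u v → linePos u ≠ linePos v := fun h k =>
    h (by rw [linePos_injective k])
  have n1 := ne hax
  have n2 := ne hay
  have n3 := ne hbx
  have n4 := ne hby
  -- Each orientation of the two pairs excludes one crossing pattern; the eight together cover every
  -- order of the four points.
  have h1 := hp.not_lt_lt_lt hab hxy hax
  have h2 := hp.not_lt_lt_lt hab (sy hxy) hay
  have h3 := hp.not_lt_lt_lt (sy hab) hxy hbx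
  have h4 := hp.not_lt_lt_lt (sy hab) (sy hxy) hby
  have h5 := hp.not_lt_lt_lt hxy hab (fun k => hax (sy k))
  have h6 := hp.not_lt_lt_lt hxy (sy hab) (fun k => hbx (sy k))
  have h7 := hp.not_lt_lt_lt (sy hxy) hab (fun k => hay (sy k))
  have h8 := hp.not_lt_lt_lt (sy hxy) (sy hab) (fun k => hby (sy k))
  omega

/-- Taking partners is a fixed-point-free involution on the points under an arc, since no arc
crosses it. -/
theorem IsPlanar.even_card_between {α : PartitionMonoid n} (hα : α.IsBrauer) (hp : α.IsPlanar)
    {x y : Fin n ⊕ Fin n} (hxy : α.rel x y) :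
    Even (Finset.univ.filter fun z : Fin n ⊕ Fin n => linePos x < linePos z ∧ linePos z < linePos y).card := by
  rw [← ZMod.natCast_eq_zero_iff_even, Finset.card_eq_sum_ones, Nat.cast_sum]
  choose p hp1 hp2 hp3 using (isBrauer_iff α).1 hα
  have hpp : ∀ z, p (p z) = z := fun z =>
    ((hp3 (p z) z (α.rel.symm (hp2 z))).resolve_left (hp1 z).symm).symm
  refine Finset.sum_involution (fun z _ => p z) ?_ ?_ ?_ ?_
  · intro z _
    decide
  · intro z _ _
    exact hp1 z
  · intro z hz
    simp only [Finset.mem_filter, Finset.mem_univ, true_and] at hz ⊢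
    have hxz : ¬ α.rel x z := by
      intro k
      have hne : y ≠ x := by
        rintro rfl
        omega
      rcases hα.eq_or_eq hxy hne k with rfl | rfl <;> omega
    have := (hp.not_cross hxy (hp2 z) hxz).1
    omega
  · intro z _
    exact hpp z

/-- Partners have positions of opposite parity. This needs `linePos`, whose values are consecutive,
since `pos` skips 0. -/
theorem IsPlanar.odd_sub {α : PartitionMonoid n} (hα : α.IsBrauer) (hp : α.IsPlanar)
    {x y : Fin n ⊕ Fin n} (hxy : α.rel x y) (hlt : linePos x < linePos y) :
    Odd (linePos y - linePos x) := by
  have h := IsPlanar.even_card_between hα hp hxy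
  have e : (Finset.univ.filter fun z : Fin n ⊕ Fin n => linePos x < linePos z ∧ linePos z < linePos y).card =
      (Finset.Ioo (linePos x) (linePos y)).card := by
    refine Finset.card_bij (fun z _ => linePos z) ?_ ?_ ?_
    · intro z hz
      simpa using hz
    · intro z _ w _ k
      exact linePos_injective k
    · intro q hq
      rw [Finset.mem_Ioo] at hq
      have h1 := linePos_bounds x
      have h2 := linePos_bounds y
      obtain ⟨z, rfl⟩ := exists_linePos_eq (n := n) (p := q) (by omega) (by omega)
      exact ⟨z, by simpa using hq, rfl⟩
  rw [e, Int.card_Ioo] at h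
  obtain ⟨k, hk⟩ := h
  exact ⟨k, by omega⟩

end LinePos

/-! ### Doubling the points -/

section Doubling

variable {m : ℕ}

/-- The first of the two points that replace a point, in the boundary order. -/
def minus : Fin m ⊕ Fin m → Fin (2 * m) ⊕ Fin (2 * m)
  | .inl k => .inl ⟨2 * k, by omega⟩
  | .inr k => .inr ⟨2 * k + 1, by omega⟩

/-- The second of the two points that replace a point, in the boundary order. -/
def plus : Fin m ⊕ Fin m → Fin (2 * m) ⊕ Fin (2 * m)
  | .inl k => .inl ⟨2 * k + 1, by omega⟩
  | .inr k => .inr ⟨2 * k, by omega⟩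

/-- The point that was replaced. -/
def half : Fin (2 * m) ⊕ Fin (2 * m) → Fin m ⊕ Fin m :=
  Sum.map (fun k => ⟨k / 2, by omega⟩) (fun k => ⟨k / 2, by omega⟩)

theorem linePos_minus (a : Fin m ⊕ Fin m) : linePos (minus a) = 2 * linePos a := by
  rcases a with a | a <;> simp only [linePos, minus, Sum.elim_inl, Sum.elim_inr] <;> push_cast <;>
    ring

theorem linePos_plus (a : Fin m ⊕ Fin m) : linePos (plus a) = 2 * linePos a + 1 := by
  rcases a with a | a <;> simp only [linePos, plus, Sum.elim_inl, Sum.elim_inr] <;> push_cast <;>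
    ring

@[simp] theorem half_minus (a : Fin m ⊕ Fin m) : half (minus a) = a := by
  rcases a with a | a <;> simp only [half, minus, Sum.map_inl, Sum.map_inr] <;> congr 1 <;>
    apply Fin.ext <;> simp only <;> omega

@[simp] theorem half_plus (a : Fin m ⊕ Fin m) : half (plus a) = a := by
  rcases a with a | a <;> simp only [half, plus, Sum.map_inl, Sum.map_inr] <;> congr 1 <;>
    apply Fin.ext <;> simp only <;> omega

theorem eq_minus_or_plus (x : Fin (2 * m) ⊕ Fin (2 * m)) : ∃ a, x = minus a ∨ x = plus a := by
  refine ⟨half x, ?_⟩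
  rcases x with ⟨x, hx⟩ | ⟨x, hx⟩ <;> simp only [half, minus, plus, Sum.map_inl, Sum.map_inr,
    Sum.inl.injEq, Sum.inr.injEq, Fin.mk.injEq] <;> omega

theorem plus_ne_minus (a b : Fin m ⊕ Fin m) : plus a ≠ minus b := by
  intro h
  have := congrArg linePos h
  rw [linePos_plus, linePos_minus] at this
  omega

theorem plus_injective : Function.Injective (plus (m := m)) := fun a b h => by
  rw [← half_plus a, h, half_plus]

theorem minus_injective : Function.Injective (minus (m := m)) := fun a b h => by
  rw [← half_minus a, h, half_minus]

theorem IsPlanar.not_rel_plus_plus {μ : PartitionMonoid (2 * m)} (hμ : μ.IsBrauer)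
    (hp : μ.IsPlanar) {a b : Fin m ⊕ Fin m} (hab : a ≠ b) : ¬ μ.rel (plus a) (plus b) := by
  intro h
  have key : ∀ {a b : Fin m ⊕ Fin m}, linePos a < linePos b → ¬ μ.rel (plus a) (plus b) := by
    intro a b hlt h
    obtain ⟨k, hk⟩ := IsPlanar.odd_sub hμ hp h (by rw [linePos_plus, linePos_plus]; omega)
    rw [linePos_plus, linePos_plus] at hk
    omega
  rcases lt_or_gt_of_ne (fun k => hab (linePos_injective k)) with k | k
  · exact key k h
  · exact key k (μ.rel.symm h)

theorem IsPlanar.not_rel_minus_minus {μ : PartitionMonoid (2 * m)} (hμ : μ.IsBrauer)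
    (hp : μ.IsPlanar) {a b : Fin m ⊕ Fin m} (hab : a ≠ b) : ¬ μ.rel (minus a) (minus b) := by
  intro h
  have key : ∀ {a b : Fin m ⊕ Fin m}, linePos a < linePos b → ¬ μ.rel (minus a) (minus b) := by
    intro a b hlt h
    obtain ⟨k, hk⟩ := IsPlanar.odd_sub hμ hp h (by rw [linePos_minus, linePos_minus]; omega)
    rw [linePos_minus, linePos_minus] at hk
    omega
  rcases lt_or_gt_of_ne (fun k => hab (linePos_injective k)) with k | k
  · exact key k h
  · exact key k (μ.rel.symm h)

/-- Following the arcs of a planar Brauer partition permutes the points of half the degree. -/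
theorem exists_step {μ : PartitionMonoid (2 * m)} (hμ : μ.IsBrauer) (hp : μ.IsPlanar) :
    ∃ σ : Fin m ⊕ Fin m → Fin m ⊕ Fin m, Function.Injective σ ∧
      ∀ a b, μ.rel (plus a) (minus b) ↔ σ a = b := by
  have h : ∀ a, ∃ b, μ.rel (plus a) (minus b) := by
    intro a
    obtain ⟨y, hne, hy, -⟩ := (isBrauer_iff μ).1 hμ (plus a)
    obtain ⟨b, rfl | rfl⟩ := eq_minus_or_plus y
    · exact ⟨b, hy⟩
    · exact absurd hy (hp.not_rel_plus_plus hμ fun k => hne (by rw [k]))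
  choose σ hσ using h
  refine ⟨σ, fun a b hab => ?_, fun a b => ⟨fun k => ?_, fun k => k ▸ hσ a⟩⟩
  · by_contra hne
    exact hp.not_rel_plus_plus hμ hne (μ.rel.trans (hσ a) (hab ▸ μ.rel.symm (hσ b)))
  · by_contra hne
    exact hp.not_rel_minus_minus hμ hne (μ.rel.trans (μ.rel.symm (hσ a)) k)

/-- Identify the two points that replace each point. -/
def contract (μ : PartitionMonoid (2 * m)) : PartitionMonoid m := ⟨μ.rel.map half⟩

theorem contract_rel_of {μ : PartitionMonoid (2 * m)} {x y : Fin (2 * m) ⊕ Fin (2 * m)}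
    (h : μ.rel x y) : (contract μ).rel (half x) (half y) := map_rel_of _ _ h

theorem contract_rel_step {μ : PartitionMonoid (2 * m)} {a b : Fin m ⊕ Fin m}
    (h : μ.rel (plus a) (minus b)) : (contract μ).rel a b := by
  simpa using contract_rel_of h

/-- By parity every arc joins some `plus a` to some `minus b`, so these steps generate the
contraction. -/
theorem contract_le {μ : PartitionMonoid (2 * m)} (hμ : μ.IsBrauer) (hp : μ.IsPlanar)
    {s : Setoid (Fin m ⊕ Fin m)} (h : ∀ a b, μ.rel (plus a) (minus b) → s a b) :
    (contract μ).rel ≤ s := by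
  refine map_le ?_
  intro x y hxy
  obtain ⟨a, rfl | rfl⟩ := eq_minus_or_plus x <;> obtain ⟨b, rfl | rfl⟩ := eq_minus_or_plus y <;>
    simp only [half_minus, half_plus]
  · by_cases k : a = b
    · rw [k]
    · exact absurd hxy (hp.not_rel_minus_minus hμ k)
  · exact s.symm (h _ _ (μ.rel.symm hxy))
  · exact h _ _ hxy
  · by_cases k : a = b
    · rw [k]
    · exact absurd hxy (hp.not_rel_plus_plus hμ k)

/-- `c` lies strictly between `a` and `b` in the cyclic order of the boundary. -/
def Between (a c b : Fin m ⊕ Fin m) : Prop :=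
  (linePos a < linePos c ∧ linePos c < linePos b) ∨
    (linePos c < linePos b ∧ linePos b ≤ linePos a) ∨
    (linePos b ≤ linePos a ∧ linePos a < linePos c)

/-- The points on one side of an arc form a union of blocks. -/
theorem between_iff_of_contract_rel {μ : PartitionMonoid (2 * m)} (hμ : μ.IsBrauer)
    (hp : μ.IsPlanar) {d d' : Fin m ⊕ Fin m} (hd : μ.rel (plus d) (minus d'))
    {u v : Fin m ⊕ Fin m} (huv : (contract μ).rel u v) : Between d u d' ↔ Between d v d' := by
  have hle : (contract μ).rel ≤ Setoid.ker fun c => Between d c d' := by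
    refine contract_le hμ hp fun u v huv => propext ?_
    -- Either the step is the arc itself, whose two ends are not strictly between, or it is a
    -- different arc, which does not cross it.
    by_cases hdu : u = d
    · subst hdu
      obtain ⟨σ, -, hσ⟩ := exists_step hμ hp
      have : v = d' := ((hσ _ _).1 huv).symm.trans ((hσ _ _).1 hd)
      subst this
      simp only [Between]
      constructor <;> intro h <;> omega
    · have hn : ¬ μ.rel (plus d) (plus u) := hp.not_rel_plus_plus hμ (Ne.symm hdu)
      have h1 := hp.not_cross hd huv hn
      have h2 := hp.not_cross huv hd fun k => hn (μ.rel.symm k)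
      have n1 : linePos u ≠ linePos d := fun k => hdu (linePos_injective k)
      have n2 : linePos v ≠ linePos d' := by
        intro k
        rw [linePos_injective k] at huv
        exact hn (μ.rel.trans hd (μ.rel.symm huv))
      simp only [linePos_plus, linePos_minus] at h1 h2
      simp only [Between]
      constructor <;> intro h <;> omega
  exact iff_of_eq (hle huv)

theorem not_between_left (a b : Fin m ⊕ Fin m) : ¬ Between a a b := by
  simp only [Between]
  omega

/-- `b` follows `a` in the cyclic order of a block of `α`. -/
def IsNext (α : PartitionMonoid m) (a b : Fin m ⊕ Fin m) : Prop :=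
  α.rel a b ∧ ∀ c, α.rel a c → ¬ Between a c b

/-- The open interval from `a` to `b` is a union of blocks missing `a`, hence misses the whole block
of `a`. -/
theorem isNext_contract {μ : PartitionMonoid (2 * m)} (hμ : μ.IsBrauer) (hp : μ.IsPlanar)
    {a b : Fin m ⊕ Fin m} (h : μ.rel (plus a) (minus b)) : IsNext (contract μ) a b :=
  ⟨contract_rel_step h, fun _ hc hb =>
    not_between_left a b ((between_iff_of_contract_rel hμ hp h hc).2 hb)⟩

theorem IsNext.eq_right {α : PartitionMonoid m} {a b b' : Fin m ⊕ Fin m} (h : IsNext α a b)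
    (h' : IsNext α a b') : b = b' := by
  have h1 := h.2 b' h'.1
  have h2 := h'.2 b h.1
  apply linePos_injective
  simp only [Between] at h1 h2
  omega

theorem IsNext.eq_left {α : PartitionMonoid m} {a a' b : Fin m ⊕ Fin m} (h : IsNext α a b)
    (h' : IsNext α a' b) : a = a' := by
  have h1 := h.2 a' (α.rel.trans h.1 (α.rel.symm h'.1))
  have h2 := h'.2 a (α.rel.trans h'.1 (α.rel.symm h.1))
  apply linePos_injective
  simp only [Between] at h1 h2
  omega

/-- The arc at `plus a` ends at the cyclic successor of `a` in its block, so the blocks determine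
all arcs. -/
theorem contract_injective {μ ν : PartitionMonoid (2 * m)} (hμ : μ.IsBrauer) (hμp : μ.IsPlanar)
    (hν : ν.IsBrauer) (hνp : ν.IsPlanar) (h : contract μ = contract ν) : μ = ν := by
  obtain ⟨σ, -, hσ⟩ := exists_step hν hνp
  have key : ∀ a b, μ.rel (plus a) (minus b) → ν.rel (plus a) (minus b) := by
    intro a b hab
    have h1 := isNext_contract hμ hμp hab
    have h2 := isNext_contract hν hνp ((hσ a _).2 rfl)
    rw [h] at h1
    rw [h1.eq_right h2]
    exact (hσ a _).2 rfl
  refine hμ.eq_of_le hν ?_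
  intro x y hne hxy
  obtain ⟨a, rfl | rfl⟩ := eq_minus_or_plus x <;> obtain ⟨b, rfl | rfl⟩ := eq_minus_or_plus y
  · exact absurd hxy (hμp.not_rel_minus_minus hμ fun k => hne (by rw [k]))
  · exact ν.rel.symm (key _ _ (μ.rel.symm hxy))
  · exact key _ _ hxy
  · exact absurd hxy (hμp.not_rel_plus_plus hμ fun k => hne (by rw [k]))

/-- An injection of a finite set into itself is onto, so `σ` permutes `D` and nothing enters it from
outside. -/
theorem mem_iff_of_mapsTo {A : Type*} [Finite A] {σ : A → A} (hσ : Function.Injective σ) {D : Set A}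
    (hD : ∀ a ∈ D, σ a ∈ D) (a : A) : σ a ∈ D ↔ a ∈ D := by
  refine ⟨fun h => ?_, hD a⟩
  have e : σ '' D = D := by
    refine Set.eq_of_subset_of_ncard_le ?_ ?_
    · rintro _ ⟨b, hb, rfl⟩
      exact hD b hb
    · rw [Set.ncard_image_of_injective _ hσ]
  rw [← e] at h
  exact hσ.mem_set_image.1 h

/-- If the block of `a, b` crossed that of `x, y`, its part `D` strictly between `x` and `y` would
contain `b` but not `a`, so it could not be stable under `σ`. A step leaving `D` is an arc with
exactly one of `x`, `y` on a given side, although `x` and `y` share a block. -/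
theorem isPlanar_contract {μ : PartitionMonoid (2 * m)} (hμ : μ.IsBrauer) (hp : μ.IsPlanar) :
    (contract μ).IsPlanar := by
  rw [isPlanar_iff_linePos]
  intro a b x y hab hxy h1 h2 h3
  by_contra hax
  obtain ⟨σ, hinj, hσ⟩ := exists_step hμ hp
  let D : Set (Fin m ⊕ Fin m) :=
    {c | (contract μ).rel a c ∧ linePos x < linePos c ∧ linePos c < linePos y}
  have hstep : ∀ c, (contract μ).rel c (σ c) := fun c => contract_rel_step ((hσ c _).2 rfl)
  obtain ⟨d, hd, hd'⟩ : ∃ d ∈ D, σ d ∉ D := by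
    by_contra hcon
    push Not at hcon
    have hle : (contract μ).rel ≤ Setoid.ker fun c => c ∈ D := by
      refine contract_le hμ hp fun u v huv => propext ?_
      rw [hσ] at huv
      subst huv
      exact (mem_iff_of_mapsTo hinj hcon u).symm
    have : a ∈ D := (iff_of_eq (hle hab)).2 ⟨hab, h2, by omega⟩
    have := this.2
    omega
  have had' : (contract μ).rel a (σ d) := (contract μ).rel.trans hd.1 (hstep d)
  have n1 : linePos (σ d) ≠ linePos x := fun k => hax (linePos_injective k ▸ had')
  have n2 : linePos (σ d) ≠ linePos y := fun k =>
    hax ((contract μ).rel.trans (linePos_injective k ▸ had') ((contract μ).rel.symm hxy))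
  have n3 : ¬ (linePos x < linePos (σ d) ∧ linePos (σ d) < linePos y) := fun k => hd' ⟨had', k⟩
  have key := between_iff_of_contract_rel hμ hp ((hσ d _).2 rfl) hxy
  obtain ⟨-, hd1, hd2⟩ := hd
  simp only [Between] at key
  by_cases h : linePos (σ d) < linePos x
  · have := key.2 (Or.inr (Or.inr ⟨by omega, by omega⟩))
    omega
  · have := key.2 (Or.inl ⟨by omega, by omega⟩)
    omega

/-! ### The inverse construction -/

theorem exists_isNext (α : PartitionMonoid m) (a : Fin m ⊕ Fin m) : ∃ b, IsNext α a b := by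
  -- Minimising `f` finds the first block point after `a` in cyclic order; the boundary has `2 * m`
  -- points, and `a` itself counts as a full turn.
  let f : Fin m ⊕ Fin m → ℤ := fun c =>
    if linePos a < linePos c then linePos c else linePos c + 2 * m
  obtain ⟨b, hb, hmin⟩ := Set.exists_min_image {c | α.rel a c} f (Set.toFinite _)
    ⟨a, α.rel.refl a⟩
  refine ⟨b, hb, fun c hc hbtw => ?_⟩
  have h1 := hmin c hc
  have h2 := linePos_bounds a
  have h3 := linePos_bounds b
  have h4 := linePos_bounds c
  simp only [f] at h1
  simp only [Between] at hbtw
  split_ifs at h1 <;> omega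

/-- Replace each block of `α` by the arcs joining cyclically consecutive points. -/
theorem exists_contract_eq {α : PartitionMonoid m} (hα : α.IsPlanar) :
    ∃ μ : PartitionMonoid (2 * m), μ.IsBrauer ∧ μ.IsPlanar ∧ contract μ = α := by
  choose σ hσ using exists_isNext α
  have hinj : Function.Injective σ := fun a b hab => (hσ a).eq_left (hab ▸ hσ b)
  have hsurj : Function.Surjective σ := Finite.surjective_of_injective hinj
  -- The arc from `plus a` to `minus (σ a)` carries the label `σ a`.
  let label : Fin (2 * m) ⊕ Fin (2 * m) → Fin m ⊕ Fin m := fun x =>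
    open Classical in if x = plus (half x) then σ (half x) else half x
  have label_plus : ∀ a, label (plus a) = σ a := fun a => by simp [label]
  have label_minus : ∀ a, label (minus a) = a := fun a => by
    simp [label, (plus_ne_minus a a).symm]
  let μ : PartitionMonoid (2 * m) := ⟨Setoid.ker label⟩
  have hμ : μ.IsBrauer := by
    rw [isBrauer_iff]
    intro x
    obtain ⟨a, rfl | rfl⟩ := eq_minus_or_plus x
    · obtain ⟨b, rfl⟩ := hsurj a
      refine ⟨plus b, plus_ne_minus _ _, (label_minus _).trans (label_plus b).symm, ?_⟩
      intro z hz
      replace hz : label (minus (σ b)) = label z := hz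
      rw [label_minus] at hz
      obtain ⟨c, rfl | rfl⟩ := eq_minus_or_plus z
      · rw [label_minus] at hz
        exact Or.inl (by rw [hz])
      · rw [label_plus] at hz
        exact Or.inr (by rw [hinj hz])
    · refine ⟨minus (σ a), (plus_ne_minus _ _).symm, (label_plus a).trans (label_minus _).symm, ?_⟩
      intro z hz
      replace hz : label (plus a) = label z := hz
      rw [label_plus] at hz
      obtain ⟨c, rfl | rfl⟩ := eq_minus_or_plus z
      · rw [label_minus] at hz
        exact Or.inr (by rw [hz])
      · rw [label_plus] at hz
        exact Or.inl (by rw [hinj hz])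
  have hp : μ.IsPlanar := by
    rw [isPlanar_iff_linePos]
    intro A B X Y hAB hXY h1 h2 h3
    by_contra hAX
    have arc : ∀ A B, μ.rel A B → linePos A < linePos B → ∃ a,
        (linePos A = 2 * linePos a + 1 ∧ linePos B = 2 * linePos (σ a) ∧ label A = σ a) ∨
        (linePos B = 2 * linePos a + 1 ∧ linePos A = 2 * linePos (σ a) ∧ label A = σ a) := by
      intro A B hAB hlt
      replace hAB : label A = label B := hAB
      obtain ⟨a, rfl | rfl⟩ := eq_minus_or_plus A <;> obtain ⟨b, rfl | rfl⟩ := eq_minus_or_plus B <;>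
        simp only [label_plus, label_minus] at hAB
      · subst hAB
        exact absurd hlt (lt_irrefl _)
      · exact ⟨b, Or.inr ⟨linePos_plus b, by rw [linePos_minus, hAB], by rw [label_minus, hAB]⟩⟩
      · exact ⟨a, Or.inl ⟨linePos_plus a, by rw [linePos_minus, hAB], label_plus a⟩⟩
      · rw [hinj hAB] at hlt
        exact absurd hlt (lt_irrefl _)
    obtain ⟨a, ha⟩ := arc A B hAB (by omega)
    obtain ⟨c, hc⟩ := arc X Y hXY (by omega)
    have hac : a ≠ c := by
      rintro rfl
      refine hAX (show label A = label X from ?_)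
      rcases ha with ⟨-, -, ha⟩ | ⟨-, -, ha⟩ <;> rcases hc with ⟨-, -, hc⟩ | ⟨-, -, hc⟩ <;>
        rw [ha, hc]
    have hac' : linePos a ≠ linePos c := fun k => hac (linePos_injective k)
    have hσac : linePos (σ a) ≠ linePos (σ c) := fun k => hac (hinj (linePos_injective k))
    have ra := (hσ a).1
    have rc := (hσ c).1
    -- Arcs from one block do not cross because they join cyclically consecutive points; arcs from
    -- different blocks do not cross because `α` is planar.
    by_cases hrel : α.rel a c
    · have k1 := (hσ a).2 c hrel
      have k2 := (hσ a).2 (σ c) (α.rel.trans hrel rc)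
      have k3 := (hσ c).2 a (α.rel.symm hrel)
      have k4 := (hσ c).2 (σ a) (α.rel.trans (α.rel.symm hrel) ra)
      simp only [Between] at k1 k2 k3 k4
      omega
    · have ne1 : linePos a ≠ linePos (σ c) := fun k =>
        hrel (by rw [linePos_injective k]; exact α.rel.symm rc)
      have ne2 : linePos c ≠ linePos (σ a) := fun k =>
        hrel (by rw [linePos_injective k]; exact ra)
      have k1 := hα.not_cross ra rc hrel
      have k2 := hα.not_cross rc ra fun k => hrel (α.rel.symm k)
      omega
  refine ⟨μ, hμ, hp, ?_⟩
  have hstep : ∀ a, (contract μ).rel a (σ a) := fun a =>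
    contract_rel_step ((label_plus a).trans (label_minus _).symm)
  ext a b
  constructor
  · intro hab
    have hle : (contract μ).rel ≤ α.rel := by
      refine contract_le hμ hp fun a b hab => ?_
      replace hab : label (plus a) = label (minus b) := hab
      rw [label_plus, label_minus] at hab
      rw [← hab]
      exact (hσ a).1
    exact hle hab
  · intro hab
    obtain ⟨M, hM, hmax⟩ := Set.exists_max_image {c | α.rel a c} linePos (Set.toFinite _)
      ⟨a, α.rel.refl a⟩
    -- Successors move strictly to the right until the last point `M` of the block is reached, so
    -- every point of the block is connected to `M`.
    have key : ∀ k : ℕ, ∀ c, α.rel a c → (linePos M - linePos c).toNat = k →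
        (contract μ).rel c M := by
      intro k
      induction k using Nat.strong_induction_on with
      | _ k ih =>
      intro c hc hk
      have h1 := hmax c hc
      by_cases hcM : linePos c = linePos M
      · rw [linePos_injective hcM]
      · have h2 := (hσ c).2 M (α.rel.trans (α.rel.symm hc) hM)
        have h3 := hmax (σ c) (α.rel.trans hc (hσ c).1)
        simp only [Between] at h2
        exact (contract μ).rel.trans (hstep c)
          (ih _ (by omega) (σ c) (α.rel.trans hc (hσ c).1) rfl)
    exact (contract μ).rel.trans (key _ a (α.rel.refl a) rfl)
      ((contract μ).rel.symm (key _ b hab rfl))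

end Doubling
end PartitionMonoid
end JonesMonoid

/-! ### Contraction is a homomorphism -/

namespace JonesMonoid
namespace PartitionMonoid

/-! ### Left multiplication by a hook -/

section Hook

variable {n : ℕ} {i : ℕ} {ν : PartitionMonoid n}

theorem hooks_mul_rel_hook (hi : i + 1 < n) :
    (hooks n i i * ν).rel (.inl ⟨i, by omega⟩) (.inl ⟨i + 1, hi⟩) :=
  glued_left (α := hooks n i i) ν (x := .inl _) (y := .inl _) (hooks_rel_upper rfl rfl)

theorem glued_hooks_outer_lower {x : Fin n ⊕ Fin n}
    (hx : ∀ a, x = .inl a → (a : ℕ) ≠ i ∧ (a : ℕ) ≠ i + 1) :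
    glued (hooks n i i) ν (outer x) (lower x) := by
  rcases x with a | a
  · exact glued_left (α := hooks n i i) ν (x := .inl a) (y := .inr a)
      (hooks_rel_self (hx a rfl).1 (hx a rfl).2)
  · exact (glued _ _).refl _

theorem hooks_mul_rel_of_rel {x y : Fin n ⊕ Fin n}
    (hx : ∀ a, x = .inl a → (a : ℕ) ≠ i ∧ (a : ℕ) ≠ i + 1)
    (hy : ∀ a, y = .inl a → (a : ℕ) ≠ i ∧ (a : ℕ) ≠ i + 1) (h : ν.rel x y) :
    (hooks n i i * ν).rel x y :=
  (glued _ _).trans (glued_hooks_outer_lower hx) ((glued _ _).trans (glued_right _ h)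
    ((glued _ _).symm (glued_hooks_outer_lower hy)))

theorem hooks_mul_rel_of_rel_of_rel (hi : i + 1 < n) {x y : Fin n ⊕ Fin n}
    (hx : ∀ a, x = .inl a → (a : ℕ) ≠ i ∧ (a : ℕ) ≠ i + 1)
    (hy : ∀ a, y = .inl a → (a : ℕ) ≠ i ∧ (a : ℕ) ≠ i + 1)
    (h : ν.rel (.inl ⟨i, by omega⟩) x) (h' : ν.rel (.inl ⟨i + 1, hi⟩) y) :
    (hooks n i i * ν).rel x y :=
  (glued _ _).trans (glued_hooks_outer_lower hx) <|
    (glued _ _).trans ((glued _ _).symm (glued_right _ h)) <|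
    (glued _ _).trans (glued_left (α := hooks n i i) ν (x := .inr ⟨i, by omega⟩)
      (y := .inr ⟨i + 1, hi⟩) (hooks_rel_lower rfl rfl)) <|
    (glued _ _).trans (glued_right _ h') ((glued _ _).symm (glued_hooks_outer_lower hy))

theorem index_of_hooks_rel {x y : Fin n ⊕ Fin n} (h : (hooks n i i).rel x y) :
    index x = index y ∨ ((∃ a b : Fin n, (x = .inl a ∧ y = .inl b ∨ x = .inr a ∧ y = .inr b) ∧
      ((a : ℕ) = i ∧ (b : ℕ) = i + 1 ∨ (a : ℕ) = i + 1 ∧ (b : ℕ) = i))) := by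
  rcases x with a | a <;> rcases y with b | b <;>
    simp only [hooks_rel_iff, hookLabel, Sum.elim_inl, Sum.elim_inr] at h
  · by_cases e : (a : ℕ) = b
    · exact Or.inl e
    · refine Or.inr ⟨a, b, Or.inl ⟨rfl, rfl⟩, ?_⟩
      split_ifs at h <;> omega
  · left
    simp only [index, Sum.elim_inl, Sum.elim_inr]
    split_ifs at h <;> omega
  · left
    simp only [index, Sum.elim_inl, Sum.elim_inr]
    split_ifs at h <;> omega
  · by_cases e : (a : ℕ) = b
    · exact Or.inl e
    · refine Or.inr ⟨a, b, Or.inr ⟨rfl, rfl⟩, ?_⟩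
      split_ifs at h <;> omega

end Hook

/-! ### Contraction is multiplicative -/

section Contract

variable {m : ℕ}

/-- Halving indices commutes with the inclusions of rows, so paths in the doubled diagram project.
Only the opposite inclusion uses planarity. -/
theorem contract_mul_le (μ ν : PartitionMonoid (2 * m)) :
    (contract (μ * ν)).rel ≤ (contract μ * contract ν).rel := by
  let c : ThreeRows (2 * m) → ThreeRows m
    | .top i => .top ⟨i / 2, by omega⟩
    | .mid i => .mid ⟨i / 2, by omega⟩
    | .bot i => .bot ⟨i / 2, by omega⟩
  have hu : ∀ x, c (upper x) = upper (half x) := by rintro (x | x) <;> rfl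
  have hl : ∀ x, c (lower x) = lower (half x) := by rintro (x | x) <;> rfl
  have ho : ∀ x, c (outer x) = outer (half x) := by rintro (x | x) <;> rfl
  have hle : glued μ ν ≤ (glued (contract μ) (contract ν)).comap c := by
    refine glued_le ?_ ?_
    · intro x y h
      change glued _ _ (c (upper x)) (c (upper y))
      rw [hu, hu]
      exact glued_left _ (contract_rel_of h)
    · intro x y h
      change glued _ _ (c (lower x)) (c (lower y))
      rw [hl, hl]
      exact glued_right _ (contract_rel_of h)
  refine map_le ?_
  intro x y h
  have : glued _ _ (c (outer x)) (c (outer y)) := hle h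
  rw [ho, ho] at this
  exact this

theorem contract_one : contract (1 : PartitionMonoid (2 * m)) = 1 := by
  ext x y
  constructor
  · intro h
    have hle : (contract (1 : PartitionMonoid (2 * m))).rel ≤ (1 : PartitionMonoid m).rel := by
      refine map_le ?_
      rintro (x | x) (y | y) h <;> rw [one_rel_iff] at h ⊢ <;>
        simp only [Sum.elim_inl, Sum.elim_inr, id] at h <;> subst h <;> rfl
    exact hle h
  · intro h
    have key : ∀ k : Fin m, (contract (1 : PartitionMonoid (2 * m))).rel (.inl k) (.inr k) := by
      intro k
      have h1 := contract_rel_of (μ := (1 : PartitionMonoid (2 * m)))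
        (x := plus (.inl k)) (y := minus (.inr k)) rfl
      simpa using h1
    rcases x with x | x <;> rcases y with y | y <;>
      simp only [one_rel_iff, Sum.elim_inl, Sum.elim_inr, id] at h <;> subst h
    · exact Setoid.refl' _ _
    · exact key x
    · exact (contract _).rel.symm (key x)
    · exact Setoid.refl' _ _

/-- The hook joins `plus K` to `minus K₁`, where `K₁` follows `K`. Unless `ν` already has this arc,
`K` and `K₁` lie on different cycles of `σ`, and multiplication splices these: the arcs `K → σ K`
and `a → K₁` become `K → K₁` and `a → σ K`. Thus blocks are merged and no connection is lost. -/
theorem contract_hooks_le_of_odd {k : ℕ} (hk : k + 1 < m) {ν : PartitionMonoid (2 * m)}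
    (hν : ν.IsBrauer) (hp : ν.IsPlanar) :
    (contract ν).rel ≤ (contract (hooks (2 * m) (2 * k + 1) (2 * k + 1) * ν)).rel := by
  set ξ := hooks (2 * m) (2 * k + 1) (2 * k + 1) * ν with hξ
  set Q := (contract ξ).rel with hQ
  have hi : 2 * k + 1 + 1 < 2 * m := by omega
  have ePK : (Sum.inl ⟨2 * k + 1, by omega⟩ : Fin (2 * m) ⊕ Fin (2 * m)) =
    plus (.inl ⟨k, by omega⟩) := rfl
  have eMK : (Sum.inl ⟨2 * k + 1 + 1, hi⟩ : Fin (2 * m) ⊕ Fin (2 * m)) =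
    minus (.inl ⟨k + 1, hk⟩) := by
    simp only [minus]; congr 1
  have hhook := hooks_mul_rel_hook (ν := ν) hi
  rw [ePK, eMK] at hhook
  have hKK : Q (.inl ⟨k, by omega⟩) (.inl ⟨k + 1, hk⟩) := contract_rel_step hhook
  by_cases hmatch : ν.rel (plus (.inl ⟨k, by omega⟩)) (minus (.inl ⟨k + 1, hk⟩))
  · have : ξ = ν := hooks_mul_eq_self hν (hi := hi) (by rw [ePK, eMK]; exact hmatch)
    rw [hQ, this]
  obtain ⟨σ, hinj, hσ⟩ := exists_step hν hp
  set K : Fin m ⊕ Fin m := .inl ⟨k, by omega⟩ with hKdef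
  set K₁ : Fin m ⊕ Fin m := .inl ⟨k + 1, hk⟩ with hK₁def
  -- Adjacent points of one block are cyclic successors, so they would be joined by the excluded
  -- arc.
  have hsep : ¬ (contract ν).rel K K₁ := by
    intro h
    have h1 := between_iff_of_contract_rel hν hp ((hσ K _).2 rfl) h
    have h2 := not_between_left K (σ K)
    have h3 : linePos (σ K) ≠ linePos K₁ := fun e => hmatch ((hσ _ _).2 (linePos_injective e))
    have h4 : linePos K₁ = linePos K + 1 := by simp [hKdef, hK₁def, linePos]
    simp only [Between] at h1 h2
    omega
  have hplus : ∀ a, a ≠ K → ∀ c : Fin (2 * m), plus a = .inl c →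
      (c : ℕ) ≠ 2 * k + 1 ∧ (c : ℕ) ≠ 2 * k + 1 + 1 := fun a ha c hc =>
    ⟨fun e => ha (plus_injective ((hc.trans (congrArg Sum.inl (Fin.ext e))).trans ePK)),
      fun e => plus_ne_minus a K₁ ((hc.trans (congrArg Sum.inl (Fin.ext e))).trans eMK)⟩
  have hminus : ∀ a, a ≠ K₁ → ∀ c : Fin (2 * m), minus a = .inl c →
      (c : ℕ) ≠ 2 * k + 1 ∧ (c : ℕ) ≠ 2 * k + 1 + 1 := fun a ha c hc =>
    ⟨fun e => plus_ne_minus K a ((hc.trans (congrArg Sum.inl (Fin.ext e))).trans ePK).symm,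
      fun e => ha (minus_injective ((hc.trans (congrArg Sum.inl (Fin.ext e))).trans eMK))⟩
  have hν_step : ∀ a, (contract ν).rel a (σ a) := fun a => contract_rel_step ((hσ a _).2 rfl)
  have hstep : ∀ a, a ≠ K → σ a ≠ K₁ → Q a (σ a) := fun a h1 h2 =>
    contract_rel_step (hooks_mul_rel_of_rel (hplus a h1) (hminus _ h2) ((hσ a _).2 rfl))
  have hσK : σ K ≠ K₁ := fun e => hmatch ((hσ _ _).2 e)
  have hKx : Q K (σ K) := by
    by_contra hcon
    -- Follow the old cycle from `σ K` back to `K`. It uses only surviving arcs: a step into `K₁`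
    -- would put `K₁` in the block of `K`.
    let C : Set (Fin m ⊕ Fin m) := {c | Q (σ K) c ∧ (contract ν).rel (σ K) c}
    have hC : ∀ a ∈ C, σ a ∈ C := by
      rintro a ⟨h1, h2⟩
      have haK : a ≠ K := by
        rintro rfl
        exact hcon (Q.symm h1)
      have hσa : σ a ≠ K₁ := by
        intro e
        refine hsep ((contract ν).rel.trans (hν_step K) ((contract ν).rel.trans h2 ?_))
        rw [← e]
        exact hν_step a
      exact ⟨Q.trans h1 (hstep a haK hσa), (contract ν).rel.trans h2 (hν_step a)⟩
    have : K ∈ C := (mem_iff_of_mapsTo hinj hC K).1 ⟨Q.refl _, (contract ν).rel.refl _⟩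
    exact hcon (Q.symm this.1)
  refine contract_le hν hp fun a b hab => ?_
  rw [hσ] at hab
  subst hab
  by_cases haK : a = K
  · rw [haK]
    exact hKx
  by_cases hσa : σ a = K₁
  · rw [hσa]
    have h1 : ξ.rel (minus (σ K)) (plus a) := by
      refine hooks_mul_rel_of_rel_of_rel hi (hminus _ hσK) (hplus a haK) ?_ ?_
      · rw [ePK]
        exact (hσ K _).2 rfl
      · rw [eMK]
        exact ν.rel.symm ((hσ a _).2 hσa)
    exact Q.trans (contract_rel_step (ξ.rel.symm h1)) (Q.trans (Q.symm hKx) hKK)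
  · exact hstep a haK hσa

/-- The contracted hook merges `k` with `k + 1` and is otherwise vertical, so the top row may be
collapsed onto the middle one. It remains to know that the contraction of the product contains that
merging and all of `contract ν`. -/
theorem contract_hooks_mul_of_odd {k : ℕ} (hk : k + 1 < m) {ν : PartitionMonoid (2 * m)}
    (hν : ν.IsBrauer) (hp : ν.IsPlanar) :
    (contract (hooks (2 * m) (2 * k + 1) (2 * k + 1)) * contract ν).rel ≤
      (contract (hooks (2 * m) (2 * k + 1) (2 * k + 1) * ν)).rel := by
  have hνle := contract_hooks_le_of_odd hk hν hp
  set Q := (contract (hooks (2 * m) (2 * k + 1) (2 * k + 1) * ν)).rel with hQ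
  have hi : 2 * k + 1 + 1 < 2 * m := by omega
  have hhook : ∀ a b : Fin (2 * m), (a : ℕ) = 2 * k + 1 → (b : ℕ) = 2 * k + 1 + 1 →
      Q (half (.inl a)) (half (.inl b)) := by
    intro a b ha hb
    have h := contract_rel_of (hooks_mul_rel_hook (ν := ν) hi)
    have ea : a = ⟨2 * k + 1, by omega⟩ := Fin.ext ha
    have eb : b = ⟨2 * k + 1 + 1, hi⟩ := Fin.ext hb
    rw [ea, eb]
    exact h
  let c : ThreeRows m → Fin m ⊕ Fin m
    | .top a => .inl a
    | .mid a => .inl a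
    | .bot a => .inr a
  have hle : glued (contract (hooks (2 * m) (2 * k + 1) (2 * k + 1))) (contract ν) ≤ Q.comap c := by
    refine sup_le ?_ ?_
    · rw [contract, map_map]
      refine map_le ?_
      intro x y hxy
      have hc : ∀ z : Fin (2 * m) ⊕ Fin (2 * m), c (upper (half z)) =
          half (.inl (Sum.elim id id z)) := by
        rintro (z | z) <;> rfl
      change Q (c (upper (half x))) (c (upper (half y)))
      rw [hc, hc]
      rcases index_of_hooks_rel hxy with h | ⟨a, b, h, h'⟩
      · have : (Sum.elim id id x : Fin (2 * m)) = Sum.elim id id y := by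
          apply Fin.ext
          rcases x with x | x <;> rcases y with y | y <;> exact h
        rw [this]
      · have h1 : Sum.elim id id x = a ∧ Sum.elim id id y = b := by
          rcases h with ⟨rfl, rfl⟩ | ⟨rfl, rfl⟩ <;> exact ⟨rfl, rfl⟩
        rw [h1.1, h1.2]
        rcases h' with ⟨ha, hb⟩ | ⟨ha, hb⟩
        · exact hhook a b ha hb
        · exact Q.symm (hhook b a hb ha)
    · refine map_le ?_
      rintro (x | x) (y | y) hxy <;> exact hνle hxy
  rintro (x | x) (y | y) hxy <;> exact hle hxy

/-- Here the hook covers the two copies of `k`, so its contraction isolates `k` in both rows.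
Multiplying by it detaches the top point `K` and keeps the rest of its block together through the
middle point. -/
theorem contract_hooks_mul_of_even {k : ℕ} (hk : k < m) {ν : PartitionMonoid (2 * m)}
    (hν : ν.IsBrauer) :
    (contract (hooks (2 * m) (2 * k) (2 * k)) * contract ν).rel ≤
      (contract (hooks (2 * m) (2 * k) (2 * k) * ν)).rel := by
  set ξ := hooks (2 * m) (2 * k) (2 * k) * ν with hξ
  set Q := (contract ξ).rel with hQ
  have hi : 2 * k + 1 < 2 * m := by omega
  set K : Fin m ⊕ Fin m := .inl ⟨k, hk⟩ with hK
  have half_eq : ∀ z : Fin (2 * m) ⊕ Fin (2 * m), half z = K →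
      z = .inl ⟨2 * k, by omega⟩ ∨ z = .inl ⟨2 * k + 1, hi⟩ := by
    rintro (⟨z, hz⟩ | ⟨z, hz⟩) h <;>
      simp only [half, Sum.map_inl, Sum.map_inr, hK, Sum.inl.injEq, Fin.mk.injEq, reduceCtorEq] at h ⊢
    omega
  have hhalf0 : half (.inl ⟨2 * k, by omega⟩) = K := by
    simp only [half, Sum.map_inl, hK, Sum.inl.injEq, Fin.mk.injEq]; omega
  have hhalf1 : half (.inl ⟨2 * k + 1, hi⟩) = K := by
    simp only [half, Sum.map_inl, hK, Sum.inl.injEq, Fin.mk.injEq]; omega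
  have hξB : ξ.IsBrauer := (isBrauer_hooks hi hi).mul hν
  have hne01 : (Sum.inl ⟨2 * k + 1, hi⟩ : Fin (2 * m) ⊕ Fin (2 * m)) ≠ .inl ⟨2 * k, by omega⟩ := by
    simp [Fin.ext_iff]
  have hhook : ξ.rel (.inl ⟨2 * k, by omega⟩) (.inl ⟨2 * k + 1, hi⟩) := hooks_mul_rel_hook hi
  have hiso : ∀ a b, Q a b → (a = K ↔ b = K) := by
    have key : ∀ x y, ξ.rel x y → half x = K → half y = K := by
      intro x y hxy hx
      have h0y : ξ.rel (.inl ⟨2 * k, by omega⟩) y := by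
        rcases half_eq x hx with rfl | rfl
        · exact hxy
        · exact ξ.rel.trans hhook hxy
      rcases hξB.eq_or_eq hhook hne01 h0y with rfl | rfl
      · exact hhalf0
      · exact hhalf1
    have hle : Q ≤ Setoid.ker fun c => c = K :=
      map_le fun x y hxy => propext ⟨key x y hxy, key y x (ξ.rel.symm hxy)⟩
    exact fun a b hab => iff_of_eq (hle hab)
  obtain ⟨x₀, hx₀, hνx₀, hux₀⟩ := (isBrauer_iff ν).1 hν (.inl ⟨2 * k, by omega⟩)
  -- `R` reattaches `K` to the block it was detached from, represented by the `ν`-partner of its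
  -- first copy. It contains `contract ν`, and it agrees with `Q` away from `K`.
  set R := merge Q K (half x₀) with hR
  have hQR : Q ≤ R := fun x y h => Or.inl h
  have hKw : R K (half x₀) := Or.inr (Or.inl ⟨Q.refl _, Q.refl _⟩)
  have hout : ∀ z : Fin (2 * m) ⊕ Fin (2 * m), half z ≠ K →
      ∀ a, z = .inl a → (a : ℕ) ≠ 2 * k ∧ (a : ℕ) ≠ 2 * k + 1 := by
    rintro z hz a rfl
    constructor
    · intro e
      apply hz
      rw [← hhalf0]
      congr 2
      exact Fin.ext e
    · intro e
      apply hz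
      rw [← hhalf1]
      congr 2
      exact Fin.ext e
  have hleft : ∀ x y, ν.rel x y → half x = K → half y ≠ K → R K (half y) := by
    intro x y hxy hx hy
    rcases half_eq x hx with rfl | rfl
    · rcases hux₀ y hxy with rfl | rfl
      · exact absurd hhalf0 hy
      · exact hKw
    · by_cases hw : half x₀ = K
      · rcases half_eq x₀ hw with h | h
        · exact absurd h hx₀
        · rw [h] at hνx₀ hux₀
          rcases hux₀ y (ν.rel.trans hνx₀ hxy) with rfl | rfl
          · exact absurd hhalf0 hy
          · exact absurd hhalf1 hy
      · have h1 : ξ.rel x₀ y := hooks_mul_rel_of_rel_of_rel hi (hout _ hw) (hout _ hy) hνx₀ hxy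
        exact R.trans hKw (hQR (contract_rel_of h1))
  have hνle : (contract ν).rel ≤ R := by
    refine map_le ?_
    intro x y hxy
    by_cases hx : half x = K <;> by_cases hy : half y = K
    · rw [hx, hy]
    · rw [hx]
      exact hleft x y hxy hx hy
    · rw [hy]
      exact R.symm (hleft y x (ν.rel.symm hxy) hy hx)
    · exact hQR (contract_rel_of (hooks_mul_rel_of_rel (hout _ hx) (hout _ hy) hxy))
  -- The detached top point goes to `none`, a class of its own, while the middle point `k` still
  -- plays the role of `K` in `R`.
  let c : ThreeRows m → Option (Fin m ⊕ Fin m)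
    | .top a => open Classical in if (a : ℕ) = k then none else some (.inl a)
    | .mid a => some (.inl a)
    | .bot a => some (.inr a)
  let s : Setoid (Option (Fin m ⊕ Fin m)) :=
    { r := fun u v => match u, v with
        | none, none => True
        | some a, some b => R a b
        | _, _ => False
      iseqv :=
        { refl := by
            rintro (_ | a)
            · trivial
            · exact R.refl a
          symm := by
            rintro (_ | a) (_ | b) h
            · trivial
            · exact h
            · exact h
            · exact R.symm h
          trans := by
            rintro (_ | a) (_ | b) (_ | c) h h'
            · trivial
            · exact h'
            · trivial
            · exact h.elim
            · exact h.elim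
            · exact h.elim
            · exact h'.elim
            · exact R.trans h h' } }
  have hle : glued (contract (hooks (2 * m) (2 * k) (2 * k))) (contract ν) ≤ s.comap c := by
    refine sup_le ?_ ?_
    · rw [contract, map_map]
      refine map_le ?_
      have key : ∀ x y, (hooks (2 * m) (2 * k) (2 * k)).rel x y →
          c (upper (half x)) = c (upper (half y)) := by
        intro x y hxy
        rcases index_of_hooks_rel hxy with h | ⟨a, b, h, h'⟩
        · rcases x with ⟨x, hx⟩ | ⟨x, hx⟩ <;> rcases y with ⟨y, hy⟩ | ⟨y, hy⟩ <;>
            simp only [index, Sum.elim_inl, Sum.elim_inr] at h <;> subst h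
          · rfl
          · have h1 : x / 2 ≠ k := by
              simp only [hooks_rel_iff, hookLabel, Sum.elim_inl, Sum.elim_inr] at hxy
              split_ifs at hxy <;> omega
            simp [c, half, upper, h1]
          · have h1 : x / 2 ≠ k := by
              simp only [hooks_rel_iff, hookLabel, Sum.elim_inl, Sum.elim_inr] at hxy
              split_ifs at hxy <;> omega
            simp [c, half, upper, h1]
          · rfl
        · have e : (a : ℕ) / 2 = b / 2 := by omega
          rcases h with ⟨rfl, rfl⟩ | ⟨rfl, rfl⟩ <;> simp [half, upper, e]
      intro x y hxy
      change s (c (upper (half x))) (c (upper (half y)))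
      rw [key x y hxy]
    · refine map_le ?_
      rintro (x | x) (y | y) hxy <;> exact hνle hxy
  have hRQ : ∀ a b, a ≠ K → b ≠ K → R a b → Q a b := by
    rintro a b ha hb (h | ⟨h, h'⟩ | ⟨h, h'⟩)
    · exact h
    · exact absurd ((hiso _ _ h).2 rfl) ha
    · exact absurd ((hiso _ _ h').1 rfl) hb
  have hcouter : ∀ z, (z = K ∧ c (outer z) = none) ∨ (z ≠ K ∧ c (outer z) = some z) := by
    rintro (z | z)
    · by_cases h : (z : ℕ) = k
      · exact Or.inl ⟨by simp [hK, Fin.ext_iff, h], by simp [c, outer, h]⟩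
      · exact Or.inr ⟨by simp [hK, Fin.ext_iff, h], by simp [c, outer, h]⟩
    · exact Or.inr ⟨by simp [hK], rfl⟩
  intro x y hxy
  have h : s (c (outer x)) (c (outer y)) := hle hxy
  rcases hcouter x with ⟨h1, h2⟩ | ⟨h1, h2⟩ <;> rcases hcouter y with ⟨h3, h4⟩ | ⟨h3, h4⟩ <;>
    rw [h2, h4] at h
  · rw [h1, h3]
  · exact h.elim
  · exact h.elim
  · exact hRQ x y h1 h3 h

theorem contract_hooks_mul {i : ℕ} (hi : i + 1 < 2 * m) {ν : PartitionMonoid (2 * m)}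
    (hν : ν.IsBrauer) (hp : ν.IsPlanar) :
    contract (hooks (2 * m) i i * ν) = contract (hooks (2 * m) i i) * contract ν := by
  have hle : (contract (hooks (2 * m) i i) * contract ν).rel ≤
      (contract (hooks (2 * m) i i * ν)).rel := by
    rcases Nat.even_or_odd' i with ⟨k, rfl | rfl⟩
    · exact contract_hooks_mul_of_even (by omega) hν
    · exact contract_hooks_mul_of_odd (by omega) hν hp
  exact PartitionMonoid.ext (le_antisymm (contract_mul_le _ _) hle)

/-- The left factors that are multiplicative against every `ν` are closed under products, so
generators suffice. -/
theorem contract_mul {μ ν : PartitionMonoid (2 * m)} (hμ : μ.IsBrauer) (hμp : μ.IsPlanar)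
    (hν : ν.IsBrauer) (hνp : ν.IsPlanar) : contract (μ * ν) = contract μ * contract ν := by
  have hmul : ∀ α β : PartitionMonoid (2 * m), β.IsBrauer → β.IsPlanar →
      (∀ ν : PartitionMonoid (2 * m), ν.IsBrauer → ν.IsPlanar →
        contract (α * ν) = contract α * contract ν) →
      (∀ ν : PartitionMonoid (2 * m), ν.IsBrauer → ν.IsPlanar →
        contract (β * ν) = contract β * contract ν) →
      ∀ ν : PartitionMonoid (2 * m), ν.IsBrauer → ν.IsPlanar →
        contract (α * β * ν) = contract (α * β) * contract ν := by
    intro α β hβ hβp h1 h2 ν hν hνp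
    rw [mul_assoc, h1 _ (hβ.mul hν) (hβp.mul hνp), h2 _ hν hνp, h1 _ hβ hβp, mul_assoc]
  -- Induction on a bound `d` for `|i - j|`: the hook `(i, j)` is the hook `(i, i)` times the hook
  -- `(i ± 1, j)`, moving one step towards `j`.
  have hhooks : ∀ d i j : ℕ, i + 1 < 2 * m → j + 1 < 2 * m → i ≤ j + d → j ≤ i + d →
      ∀ ν : PartitionMonoid (2 * m), ν.IsBrauer → ν.IsPlanar →
        contract (hooks (2 * m) i j * ν) = contract (hooks (2 * m) i j) * contract ν := by
    intro d
    induction d with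
    | zero =>
      intro i j hi hj h1 h2 ν hν hνp
      obtain rfl : i = j := by omega
      exact contract_hooks_mul hi hν hνp
    | succ d ih =>
      intro i j hi hj h1 h2
      rcases lt_trichotomy i j with h | h | h
      · rw [← hooks_mul_hooks (k := i + 1) hi hi (by omega) hj (by omega) (by omega)]
        exact hmul _ _ (isBrauer_hooks (by omega) hj) (isPlanar_hooks _ _)
          (fun ν hν hνp => contract_hooks_mul hi hν hνp)
          (ih (i + 1) j (by omega) hj (by omega) (by omega))
      · subst h
        exact fun ν hν hνp => contract_hooks_mul hi hν hνp
      · rw [← hooks_mul_hooks (k := i - 1) hi hi (by omega) hj (by omega) (by omega)]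
        exact hmul _ _ (isBrauer_hooks (by omega) hj) (isPlanar_hooks _ _)
          (fun ν hν hνp => contract_hooks_mul hi hν hνp)
          (ih (i - 1) j (by omega) hj (by omega) (by omega))
  refine jones_induction (P := fun μ => ∀ ν : PartitionMonoid (2 * m), ν.IsBrauer → ν.IsPlanar →
    contract (μ * ν) = contract μ * contract ν) ?_ ?_ ?_ hμ hμp ν hν hνp
  · intro ν _ _
    rw [contract_one, one_mul, one_mul]
  · intro i j hi hj
    exact hhooks (i + j) i j hi hj (by omega) (by omega)
  · intro α β _ _ hβ hβp h1 h2
    exact hmul α β hβ hβp h1 h2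

end Contract
end PartitionMonoid

/-! ### The isomorphism and the main theorem -/

open PartitionMonoid

/-- The Jones monoid of even degree is isomorphic to the planar partition monoid of half the
degree. -/
theorem nonempty_mulEquiv (m : ℕ) : Nonempty (planarPartitionMonoid m ≃* jonesMonoid (2 * m)) := by
  let f : jonesMonoid (2 * m) →* planarPartitionMonoid m :=
    { toFun := fun μ => ⟨contract μ.1, isPlanar_contract μ.2.1 μ.2.2⟩
      map_one' := Subtype.ext contract_one
      map_mul' := fun μ ν => Subtype.ext (contract_mul μ.2.1 μ.2.2 ν.2.1 ν.2.2) }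
  have hf : Function.Bijective f := by
    constructor
    · intro μ ν h
      exact Subtype.ext (contract_injective μ.2.1 μ.2.2 ν.2.1 ν.2.2 (congrArg Subtype.val h))
    · rintro ⟨α, hα⟩
      obtain ⟨μ, h1, h2, h3⟩ := exists_contract_eq hα
      exact ⟨⟨μ, h1, h2⟩, Subtype.ext h3⟩
  exact ⟨(MulEquiv.ofBijective f hf).symm⟩

end JonesMonoid

theorem mainTheorem3 :
    (∀ n : ℕ, 3 ≤ n →
      {M : Set (JonesMonoid.jonesMonoid n) | JonesMonoid.IsMaximalSubsemigroup M} =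
          JonesMonoid.familyId n ∪ JonesMonoid.familyIndep n ∪
            JonesMonoid.familyL n ∪ JonesMonoid.familyR n ∧
        (∀ M ∈ JonesMonoid.familyId n, JonesMonoid.IsTypeM1 {x | IsUnit x} M) ∧
        (∀ M ∈ JonesMonoid.familyIndep n,
          JonesMonoid.IsTypeM2 (JonesMonoid.rankSet n (n - 2)) M) ∧
        (∀ M ∈ JonesMonoid.familyL n, JonesMonoid.IsTypeM3 (JonesMonoid.rankSet n (n - 2)) M) ∧
        (∀ M ∈ JonesMonoid.familyR n, JonesMonoid.IsTypeM4 (JonesMonoid.rankSet n (n - 2)) M) ∧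
        {M : Set (JonesMonoid.jonesMonoid n) | JonesMonoid.IsMaximalSubsemigroup M}.ncard =
          2 * Nat.fib (n - 1) + 2 * n - 3) ∧
    ((∀ a b : JonesMonoid.jonesMonoid 2, a * b = b * a) ∧
      (∀ a : JonesMonoid.jonesMonoid 2, a * a = a) ∧
      Nat.card (JonesMonoid.jonesMonoid 2) = 2 ∧
      ∀ M : Set (JonesMonoid.jonesMonoid 2),
        JonesMonoid.IsMaximalSubsemigroup M ↔ ∃ a, M = {a}) ∧
    (∀ m : ℕ, 1 ≤ m →
      Nonempty (JonesMonoid.planarPartitionMonoid m ≃* JonesMonoid.jonesMonoid (2 * m))) ∧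
    (∀ m : ℕ, 2 ≤ m →
      {M : Set (JonesMonoid.planarPartitionMonoid m) |
          JonesMonoid.IsMaximalSubsemigroup M}.ncard =
        2 * Nat.fib (2 * m - 1) + 4 * m - 3) := by
  refine ⟨fun n hn => ⟨JonesMonoid.setOf_isMaximalSubsemigroup hn, ?_, ?_, ?_, ?_,
      JonesMonoid.ncard_maximal_jones hn⟩,
    ⟨JonesMonoid.jones_two_mul_comm, JonesMonoid.jones_two_mul_self, JonesMonoid.card_jones_two,
      JonesMonoid.isMaximalSubsemigroup_jones_two⟩,
    fun m _ => JonesMonoid.nonempty_mulEquiv m, fun m hm => ?_⟩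
  · rintro _ rfl
    exact (JonesMonoid.isHookSystem_jonesHook (by omega)).isTypeM1
  · intro M hM
    obtain ⟨A, B, hAB, hA, hB, rfl⟩ := (JonesMonoid.mem_familyIndep (by omega)).1 hM
    rw [JonesMonoid.rankSet_eq_hookSet (by omega)]
    exact (JonesMonoid.isHookSystem_jonesHook (by omega)).isTypeM2 hAB hA hB
  · intro M hM
    obtain ⟨j, rfl⟩ := (JonesMonoid.mem_familyL (by omega)).1 hM
    rw [JonesMonoid.rankSet_eq_hookSet (by omega)]
    exact (JonesMonoid.isHookSystem_jonesHook (by omega)).isTypeM3 (by omega) j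
  · intro M hM
    obtain ⟨j, rfl⟩ := (JonesMonoid.mem_familyR (by omega)).1 hM
    rw [JonesMonoid.rankSet_eq_hookSet (by omega)]
    exact (JonesMonoid.isHookSystem_jonesHook (by omega)).isTypeM4 (by omega) j
  · obtain ⟨f⟩ := JonesMonoid.nonempty_mulEquiv m
    rw [JonesMonoid.ncard_maximal_congr f, JonesMonoid.ncard_maximal_jones (by omega)]
    omega
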